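/- **Theorem (Explicit eigenfunctions).** Let $n\ge 1$ be an integer, $s\in(0,1]$ and $\nu\in\mathbb R$ with $\nu>-\frac{n}{2s}$. Put $$\widetilde u_\nu(z)=2^{z}\,\frac{\Gamma\!\left(\nu+\frac{n-z}{2s}\right)\Gamma\!\left(\frac z2\right)}{\Gamma\!\left(\frac{n-z}{2}\right)},$$ and let the eigenfunction $u_\nu$ be its inverse Mellin transform $$u_\nu(r)=\frac{1}{2\pi i}\int_{\sigma-i\infty}^{\sigma+i\infty} r^{-z}\,\widetilde u_\nu(z)\,dz,\qquad r>0,\quad 0<\sigma<2s\nu+n .$$ This integral converges absolutely, and for every such $\sigma$ and every $r\in(0,\infty)$ the following holds. Here ${}_1\Psi_1\!\left(\begin{smallmatrix}(a,A)\\(b,B)\end{smallmatrix};z\right)=\sum_{j\ge0}\frac{\Gamma(a+Aj)}{\Gamma(b+Bj)}\frac{z^j}{j!}$ is the Fox–Wright function (with $1/\Gamma=0$ at the poles of $\Gamma$), and ${}_2F_1$ is the Gauss hypergeometric function, continued analytically to $\mathbb C\setminus[1,\infty)$. 1. If $s\in(\frac12,1]$, then $$u_\nu(r)=2\,{}_1\Psi_1\!\left(\begin{matrix}(\nu+\frac{n}{2s},\frac1s)\\(\frac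 n2,1)\end{matrix};-\frac{r^2}{4}\right),$$ where the series converges. 2. If $s=\frac12$, then $$u_\nu(r)=\frac{2\,\Gamma(n+\nu)}{\Gamma(\frac n2)}\;{}_2F_1\!\left(\tfrac{n+\nu}{2},\tfrac{n+\nu+1}{2};\tfrac n2;-r^2\right).$$ Moreover $u_\nu(|x|)=\mathcal F^{-1}\{\widehat u_\nu\}(x)$ for $x\in\mathbb R^n\setminus\{0\}$, where $\widehat u_\nu(\xi)=2^{\frac n2}e^{-|\xi|}|\xi|^{\nu}$ is integrable and $\mathcal F^{-1}w(x)=(2\pi)^{-\frac n2}\int_{\mathbb R^n}e^{ix\cdot\xi}w(\xi)\,d\xi$. In the normalization without the factor $2^{n/2}$, with $r=|x|>0$, $$\mathcal F^{-1}\{e^{-|\xi|}|\xi|^\nu\}(x)=2^{-\frac{n-2}{2}}\frac{\Gamma(n+\nu)}{\Gamma(\frac n2)}\;{}_2F_1\!\left(\tfrac{n+\nu}{2},\tfrac{n+\nu+1}{2};\tfrac n2;-r^2\right)$$ $$=\Gamma(n+\nu)\,r^{-\frac{n-2}{2}}\left(\sqrt{r^2+1}\right)^{-(\frac n2+1+\nu)}P^{-\frac{n-2}{2}}_{\frac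 n2+\nu}\!\left(\frac{1}{\sqrt{r^2+1}}\right),$$ where $P^\mu_N(x)=\frac{1}{\Gamma(1-\mu)}\left(\frac{1+x}{1-x}\right)^{\mu/2}{}_2F_1\!\left(-N,N+1;1-\mu;\frac{1-x}{2}\right)$, $|x|<1$, is the associated Legendre function of the first kind. 3. If $s\in(0,\frac12)$, then $$u_\nu(r)=2s\left(\frac2r\right)^{2s\nu+n}{}_1\Psi_1\!\left(\begin{matrix}(s\nu+\frac n2,s)\\(-s\nu,-s)\end{matrix};-\left(\frac2r\right)^{2s}\right),$$ where the series converges. -/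

import Mathlib

open MeasureTheory

noncomputable section

/-- The function `ũ_ν(z) = 2^z Γ(ν + (n - z)/(2s)) Γ(z/2) / Γ((n - z)/2)`, the Mellin transform of
the eigenfunction `u_ν`. (`Complex.Gamma` vanishes at its poles, so the quotient is `0` at the zeros
of the entire function `1/Γ((n - z)/2)`, as it should be.) -/
def eigenMellin (n : ℕ) (s ν : ℝ) (z : ℂ) : ℂ :=
  2 ^ z * Complex.Gamma (ν + (n - z) / (2 * s)) * Complex.Gamma (z / 2) /
    Complex.Gamma ((n - z) / 2)

/-- The function `û_ν(ξ) = 2^{n/2 + 1} s e^{-|ξ|^{2s}} |ξ|^{2sν}` on `ℝⁿ`, the Fourier transform of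
the eigenfunction `u_ν`. -/
def eigenFourier (n : ℕ) (s ν : ℝ) (ξ : EuclideanSpace ℝ (Fin n)) : ℂ :=
  (((2 : ℝ) ^ ((n : ℝ) / 2 + 1) * s * Real.exp (-‖ξ‖ ^ (2 * s)) * ‖ξ‖ ^ (2 * s * ν) : ℝ) : ℂ)

/-- The inverse Fourier transform on `ℝⁿ` in the unitary normalization,
`(2π)^{-n/2} ∫ e^{i x·ξ} w(ξ) dξ`. -/
def invFourier (n : ℕ) (w : EuclideanSpace ℝ (Fin n) → ℂ) (x : EuclideanSpace ℝ (Fin n)) : ℂ :=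
  (((2 * Real.pi) ^ (-((n : ℝ) / 2)) : ℝ) : ℂ) *
    ∫ ξ : EuclideanSpace ℝ (Fin n), Complex.exp (((inner ℝ x ξ : ℝ) : ℂ) * Complex.I) * w ξ

/-- The `j`-th term `Γ(a + A j) / Γ(b + B j) · z^j / j!` of the Fox–Wright series `₁Ψ₁`. Where
`b + B j` is a pole of `Γ`, the term is `0`, in accordance with `1/Γ = 0` there. -/
def foxWrightTerm (a A b B z : ℂ) (j : ℕ) : ℂ :=
  Complex.Gamma (a + A * j) / Complex.Gamma (b + B * j) * (z ^ j / (j.factorial : ℂ))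

/-- The Fox–Wright function `₁Ψ₁((a, A); (b, B); z)`. -/
def foxWright (a A b B z : ℂ) : ℂ :=
  ∑' j : ℕ, foxWrightTerm a A b B z j

/-- The plane cut along `[1, ∞)`. -/
def cutPlane : Set ℂ := {z | 1 - z ∈ Complex.slitPlane}

/-- `F` is an analytic continuation to `ℂ ∖ [1, ∞)` of the Gauss hypergeometric series, which itself
converges only on the unit disc. -/
def IsGaussContinuation (a b c : ℂ) (F : ℂ → ℂ) : Prop :=
  AnalyticOnNhd ℂ F cutPlane ∧ Set.EqOn F (ordinaryHypergeometric a b c) (Metric.ball 0 1)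

open Classical in
/-- The (principal branch of the) Gauss hypergeometric function `₂F₁(a, b; c; z)` on
`ℂ ∖ [1, ∞)`: the value at `z` of the analytic continuation of the hypergeometric series. -/
def gaussHypergeometric (a b c z : ℂ) : ℂ :=
  if h : ∃ F : ℂ → ℂ, IsGaussContinuation a b c F then h.choose z else 0

/-- The analytic continuation is unique, so `gaussHypergeometric` does not depend on the choice. -/
theorem gaussHypergeometric_eq {a b c : ℂ} {F : ℂ → ℂ} (hF : IsGaussContinuation a b c F)
    {z : ℂ} (hz : z ∈ cutPlane) : gaussHypergeometric a b c z = F z := by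
  have h : ∃ F : ℂ → ℂ, IsGaussContinuation a b c F := ⟨F, hF⟩
  have hdef : gaussHypergeometric a b c z = h.choose z := by
    rw [gaussHypergeometric, dif_pos h]
  have hstar : StarConvex ℝ 0 cutPlane := by
    intro w hw t u ht hu htu
    have h1 := Complex.starConvex_one_slitPlane hw ht hu htu
    have h2 : 1 - (t • (0 : ℂ) + u • w) = t • (1 : ℂ) + u • (1 - w) := by
      have : (t : ℂ) + u = 1 := by exact_mod_cast htu
      simp only [Complex.real_smul]
      linear_combination (-1 : ℂ) * this
    change 1 - (t • (0 : ℂ) + u • w) ∈ Complex.slitPlane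
    rw [h2]
    exact h1
  have h0 : (0 : ℂ) ∈ cutPlane := by simp [cutPlane]
  have hpre : IsPreconnected cutPlane := (StarConvex.isPathConnected hstar h0).isConnected.isPreconnected
  rw [hdef]
  refine h.choose_spec.1.eqOn_of_preconnected_of_eventuallyEq hF.1 hpre h0 ?_ hz
  filter_upwards [Metric.ball_mem_nhds (0 : ℂ) one_pos] with w hw
  rw [h.choose_spec.2 hw, hF.2 hw]

/-- The associated Legendre function of the first kind on `(-1, 1)`,
`P^μ_N(x) = 1/Γ(1 - μ) · ((1 + x)/(1 - x))^{μ/2} · ₂F₁(-N, N + 1; 1 - μ; (1 - x)/2)`;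
the hypergeometric series converges because `(1 - x)/2 ∈ (0, 1)`. -/
def legendreFun (μ N x : ℝ) : ℝ :=
  1 / Real.Gamma (1 - μ) * ((1 + x) / (1 - x)) ^ (μ / 2) *
    ordinaryHypergeometric (-N) (N + 1) (1 - μ) ((1 - x) / 2)

end

/-! The Mellin transform has two families of poles: those of `Γ(z/2)` at `z = -2j` and those of `Γ(ν
+ (n - z)/(2s))` at `z = 2sν + n + 2sj`. The line of integration is moved to the left or to the
right, across one pole at a time, and each residue is one term of a Fox–Wright series. The lines
chosen run half-way between consecutive poles. On them the shifted integral is bounded by the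
general term of a series controlled by the ratio test: `Γ(A + N/s) / (Γ(B + N) Γ(D + N)) * X ^ N` on
the left, summable for `1/s < 2`, and `Γ(A + sN) Γ(D + sN) / Γ(B + N) * X ^ N` on the right,
summable for `2s < 1`. This is the reason for the three cases.

All estimates of `Γ` rest on two facts. The beta integral shows that `|Γ(x + iy)| / Γ(x)` increases
with `x`, and the reflection formula gives exact moduli or sharp bounds on the line `Re z = 1/2` and
half-way between poles. On vertical lines the quotient `Γ(z/2) / Γ((n - z)/2)` grows only
polynomially, so the remaining Gamma factor makes the integral converge absolutely.

In the critical case `s = 1/2` the series on the left converges only for `r < 1`, where the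
duplication formula for Pochhammer symbols makes it a Gauss series. A quadratic transformation
writes `₂F₁(a, a + 1/2; c; w)` through a hypergeometric series whose argument stays in the unit disc
for every `w` off the cut, and so gives the continuation explicitly. With `r = exp t` the inverse
Mellin integral is a Laplace transform, holomorphic in a strip of `t`, and the identity theorem
extends the formula to every `r`. The transformations are proved by uniqueness of the regular
solution of the hypergeometric equation at `0`; Pfaff's transformation then gives the Legendre form.

On the Fourier side `exp(z ⟨e, ξ⟩)` is expanded in powers of `z`. The spherical factor of each
moment is the same for all radial weights and is obtained from the Gaussian, whose transform is
known. The resulting Gauss series is continued to `|Re z| < 1` and evaluated at `z = i|x|`, where it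
meets the Mellin side. -/

namespace Complex

/-! ### Growth and decay of the Gamma function in vertical strips. -/

/-- `x ↦ |Γ(x + iy)| / Γ(x)` is monotone on `(0, ∞)`. -/
lemma norm_Gamma_mul_Gamma_re_add_le {z : ℂ} (hz : 0 < z.re) {δ : ℝ} (hδ : 0 ≤ δ) :
    ‖Gamma z‖ * Real.Gamma (z.re + δ) ≤ Real.Gamma z.re * ‖Gamma (z + δ)‖ := by
  rcases hδ.eq_or_lt with rfl | hδ
  · simp [mul_comm]
  have hδ' : 0 < ((δ : ℂ)).re := by simpa
  have h1 := Gamma_mul_Gamma_eq_betaIntegral hz hδ'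
  have h2 := Gamma_mul_Gamma_eq_betaIntegral (s := (z.re : ℂ)) (by simpa using hz) hδ'
  -- Under the integral `|x ^ (z - 1)| = x ^ (re z - 1)`, and the other factor is already
  -- nonnegative, so dropping the imaginary part of `z` can only enlarge the beta integral.
  have hB : ‖betaIntegral z δ‖ ≤ ‖betaIntegral z.re δ‖ := by
    have hr : betaIntegral z.re δ =
        ((∫ x in (0 : ℝ)..1, x ^ (z.re - 1) * (1 - x) ^ (δ - 1) : ℝ) : ℂ) := by
      rw [betaIntegral, ← intervalIntegral.integral_ofReal]
      refine intervalIntegral.integral_congr fun x hx => ?_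
      rw [Set.uIcc_of_le zero_le_one] at hx
      have h1x : 0 ≤ 1 - x := by linarith [hx.2]
      simp only [ofReal_mul]
      rw [ofReal_cpow hx.1, ofReal_cpow h1x]
      push_cast
      rfl
    rw [hr, norm_real]
    refine le_trans ?_ (le_abs_self _)
    rw [betaIntegral]
    refine (intervalIntegral.norm_integral_le_integral_norm zero_le_one).trans (le_of_eq ?_)
    refine intervalIntegral.integral_congr_ae ?_
    have h01 : ∀ᵐ x : ℝ, x ≠ 1 := by simp [ae_iff]
    filter_upwards [h01] with x hx1 hx
    rw [Set.uIoc_of_le zero_le_one] at hx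
    have hlt : 0 < 1 - x := sub_pos.2 (lt_of_le_of_ne hx.2 hx1)
    rw [norm_mul, norm_cpow_eq_rpow_re_of_pos hx.1]
    have : (1 - (x : ℂ)) = ((1 - x : ℝ) : ℂ) := by push_cast; rfl
    rw [this, norm_cpow_eq_rpow_re_of_pos hlt]
    simp
  have hG := Real.Gamma_pos_of_pos hδ
  have hgz := Real.Gamma_pos_of_pos hz
  have hgzd := Real.Gamma_pos_of_pos (add_pos hz hδ)
  have e1 : ‖Gamma z‖ * Real.Gamma δ = ‖Gamma (z + δ)‖ * ‖betaIntegral z δ‖ := by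
    rw [← norm_mul, ← h1, norm_mul, Gamma_ofReal, norm_real, Real.norm_of_nonneg hG.le]
  have e2 : Real.Gamma z.re * Real.Gamma δ = Real.Gamma (z.re + δ) * ‖betaIntegral z.re δ‖ := by
    have := congrArg norm h2
    rwa [← ofReal_add, Gamma_ofReal, Gamma_ofReal, Gamma_ofReal, norm_mul, norm_mul, norm_real,
      norm_real, norm_real, Real.norm_of_nonneg hG.le, Real.norm_of_nonneg hgz.le,
      Real.norm_of_nonneg hgzd.le] at this
  refine le_of_mul_le_mul_right ?_ hG
  calc ‖Gamma z‖ * Real.Gamma (z.re + δ) * Real.Gamma δ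
      = ‖Gamma (z + δ)‖ * ‖betaIntegral z δ‖ * Real.Gamma (z.re + δ) := by rw [← e1]; ring
    _ ≤ ‖Gamma (z + δ)‖ * ‖betaIntegral z.re δ‖ * Real.Gamma (z.re + δ) := by gcongr
    _ = Real.Gamma z.re * ‖Gamma (z + δ)‖ * Real.Gamma δ := by
      linear_combination (-‖Gamma (z + δ)‖) * e2

lemma norm_Gamma_le_Gamma_re {z : ℂ} (hz : 0 < z.re) : ‖Gamma z‖ ≤ Real.Gamma z.re := by
  rw [Gamma_eq_integral hz, Real.Gamma_eq_integral hz]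
  refine (norm_integral_le_integral_norm _).trans (le_of_eq ?_)
  refine setIntegral_congr_fun measurableSet_Ioi fun x (hx : 0 < x) => ?_
  simp [norm_cpow_eq_rpow_re_of_pos hx, norm_exp]

/-- At real part `1 / 2` the reflection `w ↦ 1 - w` is complex conjugation, so the reflection
formula gives the modulus exactly. The exponential decay rate of `Γ` comes from here. -/
lemma norm_Gamma_half_add_mul_I (y : ℝ) :
    ‖Gamma (1 / 2 + y * I)‖ = √(Real.pi / Real.cosh (Real.pi * y)) := by
  have h := Gamma_mul_Gamma_one_sub (1 / 2 + y * I)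
  have hc : (1 : ℂ) - (1 / 2 + y * I) = (starRingEnd ℂ) (1 / 2 + y * I) := by
    simp only [map_add, map_mul, conj_I, conj_ofReal, map_div₀, map_one, map_ofNat]; ring
  have hs : sin (Real.pi * (1 / 2 + y * I)) = (Real.cosh (Real.pi * y) : ℂ) := by
    have : (Real.pi : ℂ) * (1 / 2 + y * I) = (Real.pi * y : ℝ) * I + Real.pi / 2 := by
      push_cast; ring
    rw [this, sin_add_pi_div_two, cos_mul_I, ofReal_cosh]
  rw [hc, Gamma_conj, mul_conj, hs, ← ofReal_div, ofReal_inj, normSq_eq_norm_sq] at h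
  rw [← h, Real.sqrt_sq (norm_nonneg _)]

lemma norm_sin_pi_mul_le (z : ℂ) : ‖sin (Real.pi * z)‖ ≤ Real.cosh (Real.pi * z.im) := by
  rw [sin, Real.cosh_eq, norm_div, norm_mul, norm_I, mul_one, norm_ofNat]
  refine div_le_div_of_nonneg_right ?_ zero_le_two
  refine (norm_sub_le _ _).trans (le_of_eq ?_)
  rw [norm_exp, norm_exp]
  simp

/-- `|Γ(x + iy)| ≥ Γ(x) / √(cosh πy)` for `x ≥ 1/2`. -/
lemma Gamma_re_le_norm_Gamma_mul_sqrt_cosh {z : ℂ} (hz : 1 / 2 ≤ z.re) :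
    Real.Gamma z.re ≤ ‖Gamma z‖ * √(Real.cosh (Real.pi * z.im)) := by
  -- Monotonicity carries the exact value at real part `1 / 2` over to `z`.
  have h := norm_Gamma_mul_Gamma_re_add_le (z := 1 / 2 + z.im * I) (δ := z.re - 1 / 2)
    (by simp) (by linarith)
  have e1 : (1 / 2 + z.im * I : ℂ) + ((z.re - 1 / 2 : ℝ) : ℂ) = z := by
    apply Complex.ext <;> simp
  have e2 : (1 / 2 + z.im * I : ℂ).re = 1 / 2 := by simp
  rw [e1, e2, add_sub_cancel, norm_Gamma_half_add_mul_I, Real.Gamma_one_half_eq,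
    Real.sqrt_div Real.pi_pos.le, div_mul_eq_mul_div,
    div_le_iff₀ (Real.sqrt_pos.2 (Real.cosh_pos _)), mul_assoc] at h
  exact le_of_mul_le_mul_left h (Real.sqrt_pos.2 Real.pi_pos)

/-- `|Γ(x + iy)| ≤ Γ(x + 2) / (x² + y²)` for `x > 0`. -/
lemma norm_Gamma_mul_le {z : ℂ} (hz : 0 < z.re) :
    ‖Gamma z‖ * (z.re ^ 2 + z.im ^ 2) ≤ Real.Gamma (z.re + 2) := by
  have hz0 : z ≠ 0 := fun h => by simp [h] at hz
  have hz1 : z + 1 ≠ 0 := fun h => by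
    have := congrArg re h; simp at this; linarith
  have h : Gamma (z + 2) = (z + 1) * (z * Gamma z) := by
    rw [← Gamma_add_one z hz0, ← Gamma_add_one _ hz1]; congr 1; ring
  have h2 := norm_Gamma_le_Gamma_re (z := z + 2) (by simp; linarith)
  rw [h, norm_mul, norm_mul] at h2
  have e : (z + 2).re = z.re + 2 := by simp
  rw [e] at h2
  have hn : ‖z‖ ≤ ‖z + 1‖ := by
    rw [norm_def, norm_def]
    apply Real.sqrt_le_sqrt
    simp only [normSq_apply, add_re, one_re, add_im, one_im]
    nlinarith
  have hsq : z.re ^ 2 + z.im ^ 2 = ‖z‖ * ‖z‖ := by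
    rw [norm_mul_self_eq_normSq, normSq_apply]; ring
  calc _ = ‖z‖ * (‖z‖ * ‖Gamma z‖) := by rw [hsq]; ring
    _ ≤ ‖z + 1‖ * (‖z‖ * ‖Gamma z‖) := by gcongr
    _ ≤ _ := h2

/-- Each unit shift multiplies by a factor of modulus at least `|im z| ≥ 1`. -/
lemma norm_Gamma_le_norm_Gamma_add_nat {z : ℂ} (hz : 1 ≤ |z.im|) (m : ℕ) :
    ‖Gamma z‖ ≤ ‖Gamma (z + m)‖ := by
  induction m with
  | zero => simp
  | succ m ih =>
    have h1 : 1 ≤ ‖z + m‖ := by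
      refine hz.trans ?_
      simpa using abs_im_le_norm (z + m)
    have h0 : z + m ≠ 0 := norm_pos_iff.1 (by linarith)
    have : z + ((m + 1 : ℕ) : ℂ) = z + m + 1 := by push_cast; ring
    rw [this, Gamma_add_one _ h0, norm_mul]
    nlinarith [norm_nonneg (Gamma (z + m))]

lemma norm_Gamma_add_nat_le {z : ℂ} (hz : 1 ≤ |z.im|) (m : ℕ) :
    ‖Gamma (z + m)‖ ≤ (‖z‖ + m) ^ m * ‖Gamma z‖ := by
  -- `M` stays fixed during the induction so that all factors share one bound.
  have key : ∀ M : ℝ, ∀ k : ℕ, (k : ℝ) ≤ M → ‖Gamma (z + k)‖ ≤ (‖z‖ + M) ^ k * ‖Gamma z‖ := by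
    intro M k
    induction k with
    | zero => simp
    | succ k ih =>
      intro hk
      have hk' : (k : ℝ) ≤ M := le_trans (by simp) hk
      have h0 : z + k ≠ 0 := fun h => by
        have := congrArg im h
        simp at this
        simp [this] at hz
        linarith
      have : z + ((k + 1 : ℕ) : ℂ) = z + k + 1 := by push_cast; ring
      rw [this, Gamma_add_one _ h0, norm_mul, pow_succ', mul_assoc]
      have hzk : ‖z + k‖ ≤ ‖z‖ + M := (norm_add_le _ _).trans (by simpa using hk')
      exact mul_le_mul hzk (ih hk') (norm_nonneg _) ((norm_nonneg _).trans hzk)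
  exact key m m le_rfl

/-- On vertical strips, Gamma functions are comparable up to polynomial factors. -/
lemma exists_norm_Gamma_le_mul_norm_Gamma (a b : ℝ) :
    ∃ C : ℝ, ∃ k : ℕ, 0 < C ∧ ∀ z w : ℂ, z.re ∈ Set.Icc a b → w.re ∈ Set.Icc a b →
      z.im = w.im → 1 ≤ |z.im| → ‖Gamma z‖ ≤ C * |z.im| ^ k * ‖Gamma w‖ := by
  -- `m` moves `z` to real part at least `1`, and `M` moves `w` to the right of `z + m`. There
  -- monotonicity compares the two, and `w` is moved back at the price of a polynomial factor.
  obtain ⟨m, hm⟩ := exists_nat_ge (1 - a)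
  obtain ⟨M, hM⟩ := exists_nat_ge (b + m - a)
  have hcont : ContinuousOn Real.Gamma (Set.Icc 1 (b + M + m)) := fun x hx =>
    (Real.differentiableAt_Gamma fun j => by
      have := hx.1; have : (0 : ℝ) ≤ j := j.cast_nonneg; linarith).continuousAt.continuousWithinAt
  obtain ⟨U, hU⟩ := (isCompact_Icc (a := (1 : ℝ)) (b := b + M + m)).exists_bound_of_continuousOn hcont
  have hcont' : ContinuousOn (fun x => (Real.Gamma x)⁻¹) (Set.Icc 1 (b + M + m)) :=
    hcont.inv₀ fun x hx => (Real.Gamma_pos_of_pos (by linarith [hx.1])).ne'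
  obtain ⟨L, hL⟩ := (isCompact_Icc (a := (1 : ℝ)) (b := b + M + m)).exists_bound_of_continuousOn hcont'
  refine ⟨(|U| + 1) * (|L| + 1) * (|a| + |b| + 1 + M) ^ M, M, by positivity, ?_⟩
  intro z w hz hw him hy
  have hw' : 1 ≤ |w.im| := him ▸ hy
  have hm0 : (0 : ℝ) ≤ m := m.cast_nonneg
  have hM0 : (0 : ℝ) ≤ M := M.cast_nonneg
  have hre : 0 < (z + m).re := by simp; linarith [hz.1]
  have hδ : 0 ≤ w.re + M - (z.re + m) := by linarith [hw.1, hz.2]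
  have h := norm_Gamma_mul_Gamma_re_add_le hre hδ
  have e1 : (z + m) + ((w.re + M - (z.re + m) : ℝ) : ℂ) = w + M := by
    apply Complex.ext <;> simp [him]
  have e2 : (z + m).re = z.re + m := by simp
  rw [e1, e2, add_sub_cancel] at h
  have hzm : z.re + m ∈ Set.Icc 1 (b + M + m) := ⟨by linarith [hz.1], by linarith [hz.2]⟩
  have hwM : w.re + M ∈ Set.Icc 1 (b + M + m) := ⟨by linarith [hz.1, hz.2], by linarith [hw.2]⟩
  have hUz : Real.Gamma (z.re + m) ≤ |U| + 1 := by
    linarith [le_abs_self U, (le_abs_self _).trans (hU _ hzm)]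
  have hLw : (Real.Gamma (w.re + M))⁻¹ ≤ |L| + 1 := by
    linarith [le_abs_self L, (le_abs_self _).trans (hL _ hwM)]
  have hg : 0 < Real.Gamma (w.re + M) := Real.Gamma_pos_of_pos (by linarith [hwM.1])
  have hnw : ‖w‖ + M ≤ (|a| + |b| + 1 + M) * |w.im| := by
    have h1 : ‖w‖ ≤ |w.re| + |w.im| := norm_le_abs_re_add_abs_im w
    have h2 : |w.re| ≤ |a| + |b| := by
      rw [abs_le]
      constructor
      · linarith [hw.1, neg_abs_le a, abs_nonneg b]
      · linarith [hw.2, le_abs_self b, abs_nonneg a]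
    nlinarith [mul_nonneg (add_nonneg (add_nonneg (abs_nonneg a) (abs_nonneg b)) hM0)
      (sub_nonneg.2 hw')]
  calc ‖Gamma z‖ ≤ ‖Gamma (z + m)‖ := norm_Gamma_le_norm_Gamma_add_nat hy m
    _ ≤ Real.Gamma (z.re + m) * ‖Gamma (w + M)‖ * (Real.Gamma (w.re + M))⁻¹ := by
      rw [← div_eq_mul_inv, le_div_iff₀ hg]; exact h
    _ ≤ (|U| + 1) * ((‖w‖ + M) ^ M * ‖Gamma w‖) * (|L| + 1) := by
      gcongr
      exact norm_Gamma_add_nat_le hw' M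
    _ ≤ (|U| + 1) * (((|a| + |b| + 1 + M) * |w.im|) ^ M * ‖Gamma w‖) * (|L| + 1) := by
      gcongr
    _ = _ := by rw [him, mul_pow]; ring

/-- Powers are dominated by exponentials. -/
lemma exists_pow_le_mul_exp (k : ℕ) {c : ℝ} (hc : 0 < c) :
    ∃ C : ℝ, 0 < C ∧ ∀ t : ℝ, 0 ≤ t → t ^ k ≤ C * Real.exp (c * t) := by
  refine ⟨k.factorial / c ^ k, by positivity, fun t ht => ?_⟩
  have h := Real.pow_div_factorial_le_exp (c * t) (by positivity) k
  rw [div_le_iff₀ (by positivity), mul_pow] at h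
  rw [div_mul_eq_mul_div, le_div_iff₀ (by positivity)]
  linarith

/-- Exponential decay of the Gamma function on vertical strips. -/
lemma exists_norm_Gamma_le_exp (a b : ℝ) {c : ℝ} (hc : c < Real.pi / 2) :
    ∃ C : ℝ, 0 < C ∧ ∀ z : ℂ, z.re ∈ Set.Icc a b → 1 ≤ |z.im| →
      ‖Gamma z‖ ≤ C * Real.exp (-c * |z.im|) := by
  obtain ⟨C, k, hC, h⟩ := exists_norm_Gamma_le_mul_norm_Gamma (min a (1 / 2)) (max b (1 / 2))
  obtain ⟨D, hD, h'⟩ := exists_pow_le_mul_exp k (sub_pos.2 hc)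
  refine ⟨C * D * √(2 * Real.pi), by positivity, fun z hz hy => ?_⟩
  -- The strip was widened to contain the line `Re = 1 / 2`, where the modulus is known; the
  -- polynomial factor uses up the gap `π / 2 - c`.
  have hb := h z (1 / 2 + z.im * I) ⟨(min_le_left _ _).trans hz.1, hz.2.trans (le_max_left _ _)⟩
    (by simp) (by simp) hy
  rw [norm_Gamma_half_add_mul_I] at hb
  have hs : √(Real.pi / Real.cosh (Real.pi * z.im)) ≤
      √(2 * Real.pi) * Real.exp (-(Real.pi / 2) * |z.im|) := by
    rw [Real.sqrt_le_left (by positivity), mul_pow, Real.sq_sqrt (by positivity), ← Real.exp_nat_mul,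
      div_le_iff₀ (Real.cosh_pos _), ← Real.cosh_abs, abs_mul, abs_of_pos Real.pi_pos, Real.cosh_eq]
    have e : Real.exp ((2 : ℕ) * (-(Real.pi / 2) * |z.im|)) * Real.exp (Real.pi * |z.im|) = 1 := by
      rw [← Real.exp_add, ← Real.exp_zero]; congr 1; push_cast; ring
    have : 0 ≤ Real.exp ((2 : ℕ) * (-(Real.pi / 2) * |z.im|)) * Real.exp (-(Real.pi * |z.im|)) := by
      positivity
    nlinarith [Real.pi_pos]
  calc ‖Gamma z‖ ≤ C * (D * Real.exp ((Real.pi / 2 - c) * |z.im|)) *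
        (√(2 * Real.pi) * Real.exp (-(Real.pi / 2) * |z.im|)) := by
        refine hb.trans ?_
        gcongr
        exact h' _ (abs_nonneg _)
    _ = C * D * √(2 * Real.pi) *
        (Real.exp ((Real.pi / 2 - c) * |z.im|) * Real.exp (-(Real.pi / 2) * |z.im|)) := by ring
    _ = _ := by rw [← Real.exp_add]; congr 2; ring

end Complex

/-! ### Decay of the Mellin transform and integrability on vertical lines. -/

/-- Exponential decay of `eigenMellin` on vertical strips. -/
lemma exists_norm_eigenMellin_le (n : ℕ) {s : ℝ} (ν : ℝ) (hs0 : 0 < s) (hs1 : s ≤ 1) (a b : ℝ) :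
    ∃ C : ℝ, 0 < C ∧ ∀ z : ℂ, z.re ∈ Set.Icc a b → 2 ≤ |z.im| →
      ‖eigenMellin n s ν z‖ ≤ C * Real.exp (-(1 / 2) * |z.im|) := by
  -- `3 / 2` is a convenient rate below `π / 2`. The argument has imaginary part `-im z / (2s)` with
  -- `s ≤ 1`, so this factor decays at rate `3 / 4`; the polynomial growth of the other two is
  -- absorbed at rate `1 / 4`, which leaves `1 / 2`.
  obtain ⟨C1, hC1, h1⟩ := Complex.exists_norm_Gamma_le_exp (ν + (n - b) / (2 * s))
    (ν + (n - a) / (2 * s)) (c := 3 / 2) (by linarith [Real.pi_gt_d2])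
  obtain ⟨C2, k, hC2, h2⟩ := Complex.exists_norm_Gamma_le_mul_norm_Gamma
    (min (a / 2) ((n - b) / 2)) (max (b / 2) ((n - a) / 2))
  obtain ⟨D, hD, hD'⟩ := Complex.exists_pow_le_mul_exp k (c := 1 / 2) (by norm_num)
  refine ⟨2 ^ b * C1 * (C2 * D), by positivity, fun z hz hy => ?_⟩
  have hg1 : ‖Complex.Gamma (ν + (n - z) / (2 * s))‖ ≤ C1 * Real.exp (-(3 / 4) * |z.im|) := by
    have e : (ν + (n - z) / (2 * s) : ℂ) = ((ν + (n - z.re) / (2 * s) : ℝ) : ℂ) +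
        ((-z.im / (2 * s) : ℝ) : ℂ) * Complex.I := by
      conv_lhs => rw [← Complex.re_add_im z]
      push_cast; field_simp; ring
    have him : |(-z.im / (2 * s))| = |z.im| / (2 * s) := by
      rw [abs_div, abs_neg, abs_of_pos (by positivity : 0 < 2 * s)]
    have hle : |z.im| / 2 ≤ |z.im| / (2 * s) := by gcongr; linarith
    rw [e]
    refine (h1 _ ?_ ?_).trans ?_
    · simp only [Complex.add_re, Complex.ofReal_re, Complex.re_ofReal_mul, Complex.I_re, mul_zero,
        add_zero]
      constructor
      · gcongr; exact hz.2
      · gcongr; exact hz.1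
    · simp only [Complex.add_im, Complex.ofReal_im, Complex.im_ofReal_mul, Complex.I_im, mul_one,
        zero_add]
      rw [him]; linarith
    · simp only [Complex.add_im, Complex.ofReal_im, Complex.im_ofReal_mul, Complex.I_im, mul_one,
        zero_add]
      rw [him]
      gcongr ?_ * Real.exp ?_
      linarith
  have hg2 : ‖Complex.Gamma (z / 2)‖ / ‖Complex.Gamma ((n - z) / 2)‖ ≤
      C2 * (D * Real.exp (1 / 4 * |z.im|)) := by
    -- Conjugation keeps the modulus and gives the denominator the same imaginary part as `z / 2`,
    -- so the exponential factors cancel in the quotient.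
    have e : ‖Complex.Gamma ((n - z) / 2)‖ =
        ‖Complex.Gamma ((starRingEnd ℂ) ((n - z) / 2))‖ := by
      rw [Complex.Gamma_conj, RCLike.norm_conj]
    rw [e]
    have hz1 : (z / 2).im = z.im / 2 := by simp
    have hz2 : (z / 2).re = z.re / 2 := by simp
    have hw1 : ((starRingEnd ℂ) ((n - z) / 2)).im = z.im / 2 := by
      rw [Complex.conj_im]; simp [neg_div]
    have hw2 : ((starRingEnd ℂ) ((n - z) / 2)).re = (n - z.re) / 2 := by
      rw [Complex.conj_re]; simp
    have hab : |z.im / 2| = |z.im| / 2 := by rw [abs_div, abs_two]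
    have hb := h2 (z / 2) ((starRingEnd ℂ) ((n - z) / 2))
      (by
        rw [hz2]
        exact ⟨(min_le_left _ _).trans (by linarith [hz.1]), le_trans (by linarith [hz.2])
          (le_max_left _ _)⟩)
      (by
        rw [hw2]
        exact ⟨(min_le_right _ _).trans (by linarith [hz.2]), le_trans (by linarith [hz.1])
          (le_max_right _ _)⟩)
      (by rw [hz1, hw1]) (by rw [hz1, hab]; linarith)
    refine div_le_of_le_mul₀ (norm_nonneg _) (by positivity) (hb.trans ?_)
    gcongr
    rw [hz1, hab]
    refine (hD' _ (by positivity)).trans (le_of_eq ?_)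
    congr 2; ring
  have hp : ‖(2 : ℂ) ^ z‖ ≤ 2 ^ b := by
    have := Complex.norm_cpow_eq_rpow_re_of_pos (x := 2) two_pos z
    rw [Complex.ofReal_ofNat] at this
    rw [this]
    exact Real.rpow_le_rpow_of_exponent_le one_le_two hz.2
  rw [eigenMellin, norm_div, norm_mul, norm_mul, mul_div_assoc]
  calc _ ≤ 2 ^ b * (C1 * Real.exp (-(3 / 4) * |z.im|)) * (C2 * (D * Real.exp (1 / 4 * |z.im|))) := by
        gcongr
    _ = 2 ^ b * C1 * (C2 * D) * (Real.exp (-(3 / 4) * |z.im|) * Real.exp (1 / 4 * |z.im|)) := by ring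
    _ = _ := by rw [← Real.exp_add]; congr 2; ring

lemma integrable_exp_neg_mul_abs {κ : ℝ} (hκ : 0 < κ) :
    Integrable fun y : ℝ => Real.exp (-κ * |y|) := by
  rw [← integrableOn_univ, ← Set.Iic_union_Ioi (a := (0 : ℝ)), integrableOn_union]
  constructor
  · refine (integrableOn_exp_mul_Iic hκ 0).congr_fun (fun y (hy : y ≤ 0) => ?_) measurableSet_Iic
    simp only [abs_of_nonpos hy, neg_mul_neg]
  · refine (integrableOn_exp_mul_Ioi (neg_lt_zero.2 hκ) 0).congr_fun (fun y (hy : 0 < y) => ?_)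
      measurableSet_Ioi
    simp only [abs_of_pos hy]

lemma integrable_of_norm_le_exp_neg_abs {φ : ℝ → ℂ} (hφ : Continuous φ) {C Y κ : ℝ} (hκ : 0 < κ)
    (h : ∀ y, Y ≤ |y| → ‖φ y‖ ≤ C * Real.exp (-κ * |y|)) : Integrable φ := by
  obtain ⟨B, hB⟩ := (isCompact_Icc (a := -Y) (b := Y)).exists_bound_of_continuousOn
    hφ.continuousOn
  refine Integrable.mono' ((integrable_exp_neg_mul_abs hκ).const_mul (|C| + |B| * Real.exp (κ * |Y|)))
    hφ.aestronglyMeasurable (ae_of_all _ fun y => ?_)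
  rcases le_total Y |y| with hy | hy
  · refine (h y hy).trans ?_
    gcongr
    nlinarith [le_abs_self C, abs_nonneg B, Real.exp_pos (κ * |Y|)]
  · have h1 : ‖φ y‖ ≤ |B| := (hB y (abs_le.1 hy)).trans (le_abs_self B)
    have h2 : 1 ≤ Real.exp (κ * |Y|) * Real.exp (-κ * |y|) := by
      rw [← Real.exp_add, Real.one_le_exp_iff]
      nlinarith [le_abs_self Y]
    have h3 : 0 ≤ |C| * Real.exp (-κ * |y|) := by positivity
    nlinarith [abs_nonneg B]

lemma integrable_inv_sq_add_sq {w : ℝ} (hw : w ≠ 0) :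
    Integrable fun y : ℝ => (w ^ 2 + y ^ 2)⁻¹ := by
  have := (integrable_inv_one_add_sq.comp_div hw).const_mul (w ^ 2)⁻¹
  refine this.congr (ae_of_all _ fun y => ?_)
  have : w ^ 2 + y ^ 2 ≠ 0 := by positivity
  field_simp

/-! ### Moving a vertical contour across a simple pole. -/

namespace Complex

lemma ofReal_add_mul_I_ne_zero {u : ℝ} (hu : u ≠ 0) (y : ℝ) : (u + y * I : ℂ) ≠ 0 := fun h => by
  have := congrArg re h
  simp at this
  exact hu this

/-- Each inverse alone decays like `1 / |y|`; in the difference the leading terms cancel and leave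
`1 / y²`. -/
lemma integrable_inv_sub_inv_vertical {u v : ℝ} (hu : u ≠ 0) (hv : v ≠ 0) :
    Integrable fun y : ℝ => (u + y * I : ℂ)⁻¹ - (v + y * I : ℂ)⁻¹ := by
  have hn : ∀ w y : ℝ, ‖(w + y * I : ℂ)‖ ^ 2 = w ^ 2 + y ^ 2 := by
    intro w y
    rw [Complex.sq_norm, normSq_add_mul_I]
  refine Integrable.mono' (((integrable_inv_sq_add_sq hu).add (integrable_inv_sq_add_sq hv)).const_mul |v - u|) ?_ (ae_of_all _ fun y => ?_)
  · refine Continuous.aestronglyMeasurable ?_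
    exact ((by fun_prop : Continuous fun y : ℝ => (u + y * I : ℂ)).inv₀
        (ofReal_add_mul_I_ne_zero hu)).sub
      ((by fun_prop : Continuous fun y : ℝ => (v + y * I : ℂ)).inv₀ (ofReal_add_mul_I_ne_zero hv))
  · have hu' := ofReal_add_mul_I_ne_zero hu y
    have hv' := ofReal_add_mul_I_ne_zero hv y
    rw [inv_sub_inv hu' hv', norm_div, norm_mul]
    have e : (v + y * I - (u + y * I) : ℂ) = ((v - u : ℝ) : ℂ) := by push_cast; ring
    rw [e, norm_real, Real.norm_eq_abs, div_eq_mul_inv]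
    gcongr
    simp only [Pi.add_apply]
    rw [← hn, ← hn, mul_inv, ← inv_pow, ← inv_pow]
    nlinarith [sq_nonneg (‖(u + y * I : ℂ)‖⁻¹ - ‖(v + y * I : ℂ)‖⁻¹),
      sq_nonneg (‖(u + y * I : ℂ)‖⁻¹), sq_nonneg (‖(v + y * I : ℂ)‖⁻¹)]

/-- Averaging with `y ↦ -y` leaves only real parts, which are arctangent integrals. The value jumps
by `2π` when `u` crosses `0`: this is the residue of a simple pole. -/
lemma integral_inv_sub_inv_vertical {u v : ℝ} (hu : u ≠ 0) (hv : v ≠ 0) :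
    ∫ y : ℝ, ((u + y * I : ℂ)⁻¹ - (v + y * I : ℂ)⁻¹) =
      ((Real.pi * (|u| / u - |v| / v) : ℝ) : ℂ) := by
  have hi := integrable_inv_sub_inv_vertical hu hv
  have hr : ∀ {w : ℝ}, w ≠ 0 → Integrable (fun y : ℝ => w / (w ^ 2 + y ^ 2)) ∧
      ∫ y : ℝ, w / (w ^ 2 + y ^ 2) = Real.pi * (|w| / w) := by
    intro w hw
    have e : (fun y : ℝ => w / (w ^ 2 + y ^ 2)) = fun y => w⁻¹ * (1 + (y / w) ^ 2)⁻¹ := by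
      ext y
      have : w ^ 2 + y ^ 2 ≠ 0 := by positivity
      field_simp
    rw [e]
    refine ⟨(integrable_inv_one_add_sq.comp_div hw).const_mul _, ?_⟩
    rw [integral_const_mul, Measure.integral_comp_div (fun y : ℝ => (1 + y ^ 2)⁻¹),
      integral_univ_inv_one_add_sq, smul_eq_mul]
    field_simp
  have h2 : ∫ y : ℝ, ((u + y * I : ℂ)⁻¹ - (v + y * I : ℂ)⁻¹) =
      ∫ y : ℝ, ((u + (-y : ℝ) * I : ℂ)⁻¹ - (v + (-y : ℝ) * I : ℂ)⁻¹) :=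
    (integral_neg_eq_self (fun y : ℝ => ((u + y * I : ℂ)⁻¹ - (v + y * I : ℂ)⁻¹)) volume).symm
  have h3 := integral_add hi hi.comp_neg
  rw [← h2, ← two_mul] at h3
  have h4 : ∀ y : ℝ, ((u + y * I : ℂ)⁻¹ - (v + y * I : ℂ)⁻¹) +
      ((u + (-y : ℝ) * I : ℂ)⁻¹ - (v + (-y : ℝ) * I : ℂ)⁻¹) =
      ((2 * (u / (u ^ 2 + y ^ 2) - v / (v ^ 2 + y ^ 2)) : ℝ) : ℂ) := by
    have h5 : ∀ {w : ℝ}, w ≠ 0 → ∀ y : ℝ, (w + y * I : ℂ)⁻¹ + (w + (-y : ℝ) * I : ℂ)⁻¹ =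
        ((2 * (w / (w ^ 2 + y ^ 2)) : ℝ) : ℂ) := by
      intro w hw y
      have n1 := ofReal_add_mul_I_ne_zero hw y
      have n2 := ofReal_add_mul_I_ne_zero hw (-y)
      have n3 : ((w : ℂ) ^ 2 + y ^ 2) ≠ 0 := by
        have : w ^ 2 + y ^ 2 ≠ 0 := by positivity
        exact_mod_cast this
      rw [inv_add_inv n1 n2]
      push_cast
      rw [mul_div_assoc', div_eq_div_iff (mul_ne_zero n1 (by simpa using n2)) n3]
      linear_combination (2 * w * y ^ 2) * I_sq
    intro y
    have := h5 hu y
    have := h5 hv y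
    push_cast at *
    linear_combination h5 hu y - h5 hv y
  rw [integral_congr_ae (ae_of_all _ h4), integral_complex_ofReal, integral_const_mul,
    integral_sub (hr hu).1 (hr hv).1, (hr hu).2, (hr hv).2] at h3
  refine mul_left_cancel₀ (two_ne_zero : (2 : ℂ) ≠ 0) (h3.symm.trans ?_)
  push_cast
  ring

/-- Moving a vertical line of integration across a simple pole. -/
lemma integral_vertical_sub_integral_vertical {f h : ℂ → ℂ} {U : Set ℂ} (hU : IsOpen U)
    {a p b : ℝ} (hap : a < p) (hpb : p < b) (hsub : ∀ z : ℂ, z.re ∈ Set.Icc a b → z ∈ U)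
    (hh : DifferentiableOn ℂ h U) (hf : ∀ z ∈ U, z ≠ p → f z = h z / (z - p)) {C Y κ : ℝ}
    (hκ : 0 < κ) (hdecay : ∀ z : ℂ, z.re ∈ Set.Icc a b → Y ≤ |z.im| →
      ‖f z‖ ≤ C * Real.exp (-κ * |z.im|)) :
    (∫ y : ℝ, f (b + y * I)) - ∫ y : ℝ, f (a + y * I) = 2 * Real.pi * h p := by
  -- The auxiliary pole `q` lies to the right of the strip. It makes `K` absolutely integrable on
  -- vertical lines without a new singularity in the strip. Then `g` is `f - h p * K` with the
  -- singularity at `p` removed: its line integrals agree by Cauchy's theorem, and `K` carries the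
  -- whole jump.
  set q : ℝ := b + 1 with hq
  set K : ℂ → ℂ := fun z => (z - p)⁻¹ - (z - q)⁻¹ with hK
  set g : ℂ → ℂ := fun z => dslope h p z + h p / (z - q) with hg
  have hpU : (p : ℂ) ∈ U := hsub p (by simp [hap.le, hpb.le])
  have hfg : ∀ z ∈ U, z ≠ p → g z = f z - h p * K z := by
    intro z hz hzp
    simp only [hg, hK]
    rw [dslope_of_ne _ hzp, slope_def_field, hf z hz hzp]
    ring
  have hline : ∀ x : ℝ, x ∈ Set.Icc a b → ∀ y : ℝ, (x + y * I : ℂ) ∈ U := fun x hx y =>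
    hsub _ (by simpa using hx)
  have hcont : ∀ x : ℝ, x ∈ Set.Icc a b → x ≠ p → Continuous fun y : ℝ => f (x + y * I) := by
    intro x hx hxp
    have hne : ∀ y : ℝ, (x + y * I : ℂ) - p ≠ 0 := fun y => by
      have := ofReal_add_mul_I_ne_zero (sub_ne_zero.2 hxp) y
      intro h0; apply this; rw [← h0]; push_cast; ring
    have : (fun y : ℝ => f (x + y * I)) = fun y : ℝ => h (x + y * I) / (x + y * I - p) := by
      ext y
      exact hf _ (hline x hx y) (sub_ne_zero.1 (hne y))
    rw [this]
    refine Continuous.div ?_ (by fun_prop) hne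
    exact hh.continuousOn.comp_continuous (by fun_prop) (hline x hx)
  have hfint : ∀ x : ℝ, x ∈ Set.Icc a b → x ≠ p → Integrable fun y : ℝ => f (x + y * I) :=
    fun x hx hxp => integrable_of_norm_le_exp_neg_abs (hcont x hx hxp) (C := C) (Y := Y) hκ
      fun y hy => by simpa using hdecay (x + y * I) (by simpa using hx) (by simpa using hy)
  have hKline : ∀ x : ℝ, (fun y : ℝ => K (x + y * I)) = fun y : ℝ =>
      (((x - p : ℝ) : ℂ) + y * I)⁻¹ - (((x - q : ℝ) : ℂ) + y * I)⁻¹ := by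
    intro x; ext y
    simp only [hK]
    congr 2 <;> push_cast <;> ring
  have hb : b ∈ Set.Icc a b := ⟨(hap.trans hpb).le, le_rfl⟩
  have ha : a ∈ Set.Icc a b := ⟨le_rfl, (hap.trans hpb).le⟩
  have hbp : b - p ≠ 0 := by linarith
  have hbq : b - q ≠ 0 := by rw [hq]; linarith
  have hap' : a - p ≠ 0 := by linarith
  have haq : a - q ≠ 0 := by rw [hq]; linarith
  have hgline : ∀ x : ℝ, x ∈ Set.Icc a b → x ≠ p → (fun y : ℝ => g (x + y * I)) =
      fun y : ℝ => f (x + y * I) - h p * K (x + y * I) := by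
    intro x hx hxp
    ext y
    refine hfg _ (hline x hx y) fun h0 => hxp ?_
    simpa using congrArg re h0
  have hKint : ∀ x : ℝ, x - p ≠ 0 → x - q ≠ 0 →
      Integrable fun y : ℝ => h p * K (x + y * I) := by
    intro x h1 h2
    refine Integrable.const_mul ?_ _
    rw [hKline]
    exact integrable_inv_sub_inv_vertical h1 h2
  have hgint : ∀ x : ℝ, x ∈ Set.Icc a b → x - p ≠ 0 → x - q ≠ 0 →
      Integrable fun y : ℝ => g (x + y * I) := by
    intro x hx h1 h2
    rw [hgline x hx (sub_ne_zero.1 h1)]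
    exact (hfint x hx (sub_ne_zero.1 h1)).sub (hKint x h1 h2)
  have hgval : ∀ x : ℝ, x ∈ Set.Icc a b → x - p ≠ 0 → x - q ≠ 0 →
      ∫ y : ℝ, g (x + y * I) = (∫ y : ℝ, f (x + y * I)) -
        h p * ((Real.pi * (|x - p| / (x - p) - |x - q| / (x - q)) : ℝ) : ℂ) := by
    intro x hx h1 h2
    rw [hgline x hx (sub_ne_zero.1 h1),
      integral_sub (hfint x hx (sub_ne_zero.1 h1)) (hKint x h1 h2), integral_const_mul, hKline,
      integral_inv_sub_inv_vertical h1 h2]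
  have hgdiff : DifferentiableOn ℂ g {z | z.re ∈ Set.Icc a b} := by
    have h1 : DifferentiableOn ℂ (dslope h p) U :=
      (differentiableOn_dslope (hU.mem_nhds hpU)).2 hh
    refine (h1.mono fun z hz => hsub z hz).add ?_
    refine DifferentiableOn.div (by fun_prop) (by fun_prop) fun z hz h0 => ?_
    have := congrArg re h0
    simp only [sub_re, ofReal_re, zero_re] at this
    have := hz.2
    linarith
  have hrect : ∀ T : ℝ, (∫ x : ℝ in a..b, g (x + (-T : ℝ) * I)) - (∫ x : ℝ in a..b, g (x + T * I)) +
      I • (∫ y : ℝ in (-T)..T, g (b + y * I)) - I • (∫ y : ℝ in (-T)..T, g (a + y * I)) = 0 := by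
    intro T
    have := integral_boundary_rect_eq_zero_of_differentiableOn g (a + (-T : ℝ) * I) (b + T * I)
      (hgdiff.mono fun z hz => by
        have := hz.1
        simpa [Set.uIcc_of_le (hap.trans hpb).le] using this)
    simpa using this
  -- `T t` is `t` or `-t`, so that both horizontal sides are treated at once.
  have hhor : ∀ T : ℝ → ℝ, (∀ t, 0 ≤ t → |T t| = t) →
      Filter.Tendsto (fun t : ℝ => ∫ x : ℝ in a..b, g (x + (T t : ℝ) * I)) Filter.atTop (nhds 0) := by
    intro T hT
    have hbd : ∀ t : ℝ, max Y 1 ≤ t → ‖∫ x : ℝ in a..b, g (x + (T t : ℝ) * I)‖ ≤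
        (C * Real.exp (-κ * t) + ‖h p‖ * (2 / t)) * |b - a| := by
      intro t ht
      have ht1 : 1 ≤ t := (le_max_right _ _).trans ht
      have htT : |T t| = t := hT t (by linarith)
      refine intervalIntegral.norm_integral_le_of_norm_le_const fun x hx => ?_
      rw [Set.uIoc_of_le (hap.trans hpb).le] at hx
      have hx' : x ∈ Set.Icc a b := ⟨hx.1.le, hx.2⟩
      have hne : (x + (T t : ℝ) * I : ℂ) ≠ p := fun h0 => by
        have := congrArg im h0
        simp at this
        rw [this] at htT
        simp at htT
        linarith
      rw [hfg _ (hline x hx' _) hne]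
      refine (norm_sub_le _ _).trans (add_le_add ?_ ?_)
      · have := hdecay (x + (T t : ℝ) * I) (by simpa using hx')
          (by simpa [htT] using (le_max_left _ _).trans ht)
        simpa [htT] using this
      · rw [norm_mul]
        gcongr
        have hinv : ∀ w : ℝ, ‖(x + (T t : ℝ) * I - w : ℂ)⁻¹‖ ≤ 1 / t := by
          intro w
          rw [norm_inv, one_div]
          gcongr
          conv_lhs => rw [← htT]
          simpa using abs_im_le_norm (x + (T t : ℝ) * I - w : ℂ)
        refine (norm_sub_le _ _).trans ((add_le_add (hinv p) (hinv q)).trans (le_of_eq ?_))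
        ring
    refine squeeze_zero_norm' (Filter.eventually_atTop.2 ⟨_, hbd⟩) ?_
    have t1 : Filter.Tendsto (fun t : ℝ => Real.exp (-κ * t)) Filter.atTop (nhds 0) := by
      refine Real.tendsto_exp_atBot.comp ?_
      exact Filter.tendsto_id.const_mul_atTop_of_neg (neg_lt_zero.2 hκ)
    have t2 : Filter.Tendsto (fun t : ℝ => 2 / t) Filter.atTop (nhds 0) :=
      tendsto_const_nhds.div_atTop Filter.tendsto_id
    simpa using ((t1.const_mul C).add (t2.const_mul ‖h p‖)).mul_const |b - a|
  have hlim : ∀ x : ℝ, x ∈ Set.Icc a b → x - p ≠ 0 → x - q ≠ 0 →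
      Filter.Tendsto (fun t : ℝ => ∫ y : ℝ in (-t)..t, g (x + y * I)) Filter.atTop
        (nhds (∫ y : ℝ, g (x + y * I))) := fun x hx h1 h2 =>
    intervalIntegral_tendsto_integral (hgint x hx h1 h2) Filter.tendsto_neg_atTop_atBot
      Filter.tendsto_id
  have hfin := (((hhor (fun t => -t) fun t ht => by rw [abs_neg, abs_of_nonneg ht]).sub
    (hhor (fun t => t) fun t ht => abs_of_nonneg ht)).add
      ((hlim b hb hbp hbq).const_smul I)).sub ((hlim a ha hap' haq).const_smul I)
  have hz := tendsto_nhds_unique (hfin.congr fun t => hrect t) tendsto_const_nhds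
  -- The signs give `2π` for the integral of `K` on `Re z = b` and `0` on `Re z = a`.
  rw [hgval b hb hbp hbq, hgval a ha hap' haq, abs_of_pos (by linarith : 0 < b - p),
    abs_of_neg (by linarith : b - q < 0), abs_of_neg (by linarith : a - p < 0),
    abs_of_neg (by linarith : a - q < 0), div_self hbp, neg_div, neg_div, neg_div, div_self hbq,
    div_self hap', div_self haq] at hz
  simp only [smul_eq_mul] at hz
  push_cast at hz
  linear_combination (-I) * hz + ((∫ y : ℝ, f (b + y * I)) - (∫ y : ℝ, f (a + y * I)) -
    2 * Real.pi * h p) * I_sq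

end Complex

/-! ### Ratio tests for series of Gamma quotients. -/

/-- Log-convexity between `Y` and `Y + 1` gives `δ ≤ 1`, and one use of the functional equation
reaches `δ ≤ 2`. The base `Y + 1` serves both ranges. -/
lemma Real.Gamma_add_le_rpow_mul_Gamma {Y δ : ℝ} (hY : 0 < Y) (h0 : 0 ≤ δ) (h2 : δ ≤ 2) :
    Real.Gamma (Y + δ) ≤ (Y + 1) ^ δ * Real.Gamma Y := by
  have key : ∀ ε : ℝ, 0 ≤ ε → ε ≤ 1 → Real.Gamma (Y + ε) ≤ Y ^ ε * Real.Gamma Y := by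
    intro ε h0 h1
    rcases h0.eq_or_lt with rfl | h0
    · simp
    rcases h1.eq_or_lt with rfl | h1
    · rw [Real.Gamma_add_one hY.ne', Real.rpow_one]
    have h := Real.Gamma_mul_add_mul_le_rpow_Gamma_mul_rpow_Gamma hY (by linarith : 0 < Y + 1)
      (sub_pos.2 h1) h0 (by ring)
    have e : (1 - ε) * Y + ε * (Y + 1) = Y + ε := by ring
    have hG := Real.Gamma_pos_of_pos hY
    rw [e, Real.Gamma_add_one hY.ne', Real.mul_rpow hY.le hG.le] at h
    calc _ ≤ _ := h
      _ = Y ^ ε * (Real.Gamma Y ^ (1 - ε) * Real.Gamma Y ^ ε) := by ring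
      _ = _ := by rw [← Real.rpow_add hG]; simp
  have hG := Real.Gamma_pos_of_pos hY
  rcases le_total δ 1 with h1 | h1
  · refine (key δ h0 h1).trans ?_
    gcongr
    linarith
  · have e : Y + δ = Y + (δ - 1) + 1 := by ring
    rw [e, Real.Gamma_add_one (by linarith)]
    calc (Y + (δ - 1)) * Real.Gamma (Y + (δ - 1))
        ≤ (Y + 1) * ((Y + 1) ^ (δ - 1) * Real.Gamma Y) := by
          gcongr
          · linarith
          · refine (key _ (by linarith) (by linarith)).trans ?_
            gcongr
            linarith
      _ = (Y + 1) ^ δ * Real.Gamma Y := by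
          have : (Y + 1) ^ δ = (Y + 1) ^ (δ - 1) * (Y + 1) := by
            rw [← Real.rpow_add_one (by positivity)]; congr 1; ring
          rw [this]; ring

lemma eventually_add_mul_nat_pos (A : ℝ) {δ : ℝ} (hδ : 0 < δ) :
    ∀ᶠ N : ℕ in Filter.atTop, 0 < A + δ * N := by
  have : Filter.Tendsto (fun N : ℕ => A + δ * (N : ℝ)) Filter.atTop Filter.atTop :=
    Filter.tendsto_atTop_add_const_left _ _ (tendsto_natCast_atTop_atTop.const_mul_atTop hδ)
  exact this.eventually_gt_atTop 0

lemma tendsto_add_mul_nat_div_nat (A δ : ℝ) :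
    Filter.Tendsto (fun N : ℕ => (A + δ * N) / N) Filter.atTop (nhds δ) := by
  have h := (tendsto_const_div_atTop_nhds_zero_nat A).add_const δ
  rw [zero_add] at h
  refine h.congr' ?_
  filter_upwards [Filter.eventually_gt_atTop 0] with N hN
  have : (N : ℝ) ≠ 0 := by positivity
  field_simp

lemma summable_of_ratio_bound_tendsto {t ρ : ℕ → ℝ} {ℓ : ℝ} (hℓ : ℓ < 1)
    (ht : ∀ᶠ N in Filter.atTop, 0 ≤ t N)
    (h : ∀ᶠ N in Filter.atTop, t (N + 1) ≤ ρ N * t N)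
    (hρ : Filter.Tendsto ρ Filter.atTop (nhds ℓ)) : Summable t := by
  obtain ⟨q, hq, hq1⟩ := exists_between hℓ
  refine summable_of_ratio_norm_eventually_le hq1 ?_
  filter_upwards [h, ht, (Filter.tendsto_add_atTop_nat 1).eventually ht,
    hρ.eventually_le_const hq] with N h1 h2 h3 h4
  rw [Real.norm_of_nonneg h2, Real.norm_of_nonneg h3]
  exact h1.trans (by gcongr)

/-- The ratio of consecutive terms is bounded by a quantity asymptotic to `δ ^ δ * N ^ (δ - 2) * X`,
which tends to `0` for `δ < 2` and to `4 * X` for `δ = 2`. It is used with `δ = 1 / s` and `X = (r /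
2) ^ 2`, so the critical case needs `r < 1`. -/
lemma summable_Gamma_div_Gamma_mul_Gamma {A B D δ X : ℝ} (hX : 0 ≤ X) (hδ0 : 0 < δ)
    (hδ : δ < 2 ∨ δ = 2 ∧ 4 * X < 1) :
    Summable fun N : ℕ => Real.Gamma (A + δ * N) / (Real.Gamma (B + N) * Real.Gamma (D + N)) *
      X ^ N := by
  have hδ2 : δ ≤ 2 := hδ.elim le_of_lt fun h => h.1.le
  have hpos : ∀ E : ℝ, ∀ᶠ N : ℕ in Filter.atTop, 0 < E + N := fun E => by
    simpa using eventually_add_mul_nat_pos E one_pos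
  set ρ : ℕ → ℝ := fun N => ((A + 1 + δ * N) / N) ^ δ * (N : ℝ) ^ (δ - 2) *
    (((B + 1 * N) / N)⁻¹ * ((D + 1 * N) / N)⁻¹) * X with hρ
  have hlim : ∀ L : ℝ, Filter.Tendsto (fun N : ℕ => (N : ℝ) ^ (δ - 2)) Filter.atTop (nhds L) →
      Filter.Tendsto ρ Filter.atTop (nhds (δ ^ δ * L * (1⁻¹ * 1⁻¹) * X)) := fun L hL =>
    ((((tendsto_add_mul_nat_div_nat (A + 1) δ).rpow_const (Or.inl hδ0.ne')).mul hL).mul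
      (((tendsto_add_mul_nat_div_nat B 1).inv₀ one_ne_zero).mul
        ((tendsto_add_mul_nat_div_nat D 1).inv₀ one_ne_zero))).mul_const X
  obtain ⟨ℓ, hℓ1, hℓ⟩ : ∃ ℓ, ℓ < 1 ∧ Filter.Tendsto ρ Filter.atTop (nhds ℓ) := by
    rcases hδ with h | ⟨rfl, h⟩
    · refine ⟨_, ?_, hlim 0 ?_⟩
      · simp
      · have := (tendsto_rpow_neg_atTop (sub_pos.2 h)).comp tendsto_natCast_atTop_atTop
        simpa [Function.comp_def] using this
    · refine ⟨_, ?_, hlim 1 ?_⟩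
      · norm_num; linarith
      · simp
  refine summable_of_ratio_bound_tendsto hℓ1 ?_ ?_ hℓ
  · filter_upwards [eventually_add_mul_nat_pos A hδ0, hpos B, hpos D] with N h1 h2 h3
    have := Real.Gamma_pos_of_pos h1
    have := Real.Gamma_pos_of_pos h2
    have := Real.Gamma_pos_of_pos h3
    positivity
  · filter_upwards [eventually_add_mul_nat_pos A hδ0, hpos B, hpos D,
      Filter.eventually_gt_atTop 0] with N h1 h2 h3 h4
    have g1 := Real.Gamma_pos_of_pos h1
    have g2 := Real.Gamma_pos_of_pos h2
    have g3 := Real.Gamma_pos_of_pos h3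
    have hN : (0 : ℝ) < N := by exact_mod_cast h4
    have e1 : A + δ * ((N + 1 : ℕ) : ℝ) = A + δ * N + δ := by push_cast; ring
    have e2 : B + ((N + 1 : ℕ) : ℝ) = B + N + 1 := by push_cast; ring
    have e3 : D + ((N + 1 : ℕ) : ℝ) = D + N + 1 := by push_cast; ring
    rw [e1, e2, e3, Real.Gamma_add_one h2.ne', Real.Gamma_add_one h3.ne']
    have hle := Real.Gamma_add_le_rpow_mul_Gamma h1 hδ0.le hδ2
    have hr : ρ N = (A + 1 + δ * N) ^ δ / ((B + N) * (D + N)) * X := by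
      simp only [hρ]
      rw [Real.div_rpow (by linarith) hN.le, Real.rpow_sub hN, Real.rpow_two, one_mul]
      have := Real.rpow_pos_of_pos hN δ
      field_simp
    rw [hr]
    calc _ ≤ (A + δ * N + 1) ^ δ * Real.Gamma (A + δ * N) /
          ((B + N) * Real.Gamma (B + N) * ((D + N) * Real.Gamma (D + N))) * X ^ (N + 1) := by
          gcongr
      _ = _ := by
          rw [pow_succ, show A + δ * N + 1 = A + 1 + δ * N by ring]
          field_simp

/-- Here the ratio is bounded by a multiple of `N ^ (2 * δ - 1)` asymptotically, so it tends to `0`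
whatever `X` is. -/
lemma summable_Gamma_mul_Gamma_div_Gamma {A B D δ X : ℝ} (hX : 0 ≤ X) (hδ0 : 0 < δ)
    (hδ : δ < 1 / 2) :
    Summable fun N : ℕ => Real.Gamma (A + δ * N) * Real.Gamma (D + δ * N) / Real.Gamma (B + N) *
      X ^ N := by
  have hpos : ∀ᶠ N : ℕ in Filter.atTop, 0 < B + N := by
    simpa using eventually_add_mul_nat_pos B one_pos
  set ρ : ℕ → ℝ := fun N => ((A + 1 + δ * N) / N) ^ δ * ((D + 1 + δ * N) / N) ^ δ *
    (N : ℝ) ^ (2 * δ - 1) * ((B + 1 * N) / N)⁻¹ * X with hρ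
  have hL : Filter.Tendsto (fun N : ℕ => (N : ℝ) ^ (2 * δ - 1)) Filter.atTop (nhds 0) := by
    have := (tendsto_rpow_neg_atTop (by linarith : 0 < 1 - 2 * δ)).comp tendsto_natCast_atTop_atTop
    simpa [Function.comp_def] using this
  have hlim : Filter.Tendsto ρ Filter.atTop (nhds (δ ^ δ * δ ^ δ * 0 * 1⁻¹ * X)) :=
    (((((tendsto_add_mul_nat_div_nat (A + 1) δ).rpow_const (Or.inl hδ0.ne')).mul
      ((tendsto_add_mul_nat_div_nat (D + 1) δ).rpow_const (Or.inl hδ0.ne'))).mul hL).mul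
      ((tendsto_add_mul_nat_div_nat B 1).inv₀ one_ne_zero)).mul_const X
  refine summable_of_ratio_bound_tendsto (by simp) ?_ ?_ hlim
  · filter_upwards [eventually_add_mul_nat_pos A hδ0, hpos, eventually_add_mul_nat_pos D hδ0]
      with N h1 h2 h3
    have := Real.Gamma_pos_of_pos h1
    have := Real.Gamma_pos_of_pos h2
    have := Real.Gamma_pos_of_pos h3
    positivity
  · filter_upwards [eventually_add_mul_nat_pos A hδ0, hpos, eventually_add_mul_nat_pos D hδ0,
      Filter.eventually_gt_atTop 0] with N h1 h2 h3 h4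
    have g1 := Real.Gamma_pos_of_pos h1
    have g2 := Real.Gamma_pos_of_pos h2
    have g3 := Real.Gamma_pos_of_pos h3
    have g3' := Real.Gamma_pos_of_pos (by linarith : 0 < D + δ * N + δ)
    have hN : (0 : ℝ) < N := by exact_mod_cast h4
    have e1 : A + δ * ((N + 1 : ℕ) : ℝ) = A + δ * N + δ := by push_cast; ring
    have e2 : B + ((N + 1 : ℕ) : ℝ) = B + N + 1 := by push_cast; ring
    have e3 : D + δ * ((N + 1 : ℕ) : ℝ) = D + δ * N + δ := by push_cast; ring
    rw [e1, e2, e3, Real.Gamma_add_one h2.ne']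
    have hle := Real.Gamma_add_le_rpow_mul_Gamma h1 hδ0.le (by linarith)
    have hle' := Real.Gamma_add_le_rpow_mul_Gamma h3 hδ0.le (by linarith)
    have hr : ρ N = (A + 1 + δ * N) ^ δ * (D + 1 + δ * N) ^ δ / (B + N) * X := by
      simp only [hρ]
      rw [Real.div_rpow (by linarith) hN.le, Real.div_rpow (by linarith) hN.le, Real.rpow_sub hN,
        two_mul, Real.rpow_add hN, Real.rpow_one, one_mul]
      have := Real.rpow_pos_of_pos hN δ
      field_simp
    rw [hr]
    calc _ ≤ (A + δ * N + 1) ^ δ * Real.Gamma (A + δ * N) *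
          ((D + δ * N + 1) ^ δ * Real.Gamma (D + δ * N)) /
          ((B + N) * Real.Gamma (B + N)) * X ^ (N + 1) := by
          gcongr
      _ = _ := by
          rw [pow_succ, show A + δ * N + 1 = A + 1 + δ * N by ring,
            show D + δ * N + 1 = D + 1 + δ * N by ring]
          field_simp

/-! ### Poles of Γ, holomorphy in the strip, and the residues at `z = -2j`. -/

namespace Complex

/-- The product isolates the poles of `Γ w` that a shift by `j` removes. -/
lemma Gamma_eq_Gamma_add_nat_div_prod (w : ℂ) (j : ℕ) (h : ∀ i < j, w + i ≠ 0) :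
    Gamma w = Gamma (w + j) / ∏ i ∈ Finset.range j, (w + i) := by
  induction j with
  | zero => simp
  | succ j ih =>
    have e : w + ((j + 1 : ℕ) : ℂ) = w + j + 1 := by push_cast; ring
    have h0 := h j (Nat.lt_succ_self j)
    rw [ih fun i hi => h i (hi.trans (Nat.lt_succ_self j)), e, Gamma_add_one _ h0,
      Finset.prod_range_succ, mul_comm (w + (j : ℂ)) (Gamma _), mul_div_mul_right _ _ h0]

/-- The inverse of this product is the residue of `Γ` at `-j`. -/
lemma prod_range_neg_add_nat (j : ℕ) :
    ∏ i ∈ Finset.range j, (-(j : ℂ) + i) = (-1) ^ j * (j.factorial : ℂ) := by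
  rw [← Finset.prod_range_reflect, ← Finset.prod_range_add_one_eq_factorial, Nat.cast_prod,
    ← Finset.card_range j, ← Finset.prod_const, Finset.card_range, ← Finset.prod_mul_distrib]
  refine Finset.prod_congr rfl fun i hi => ?_
  have hi := Finset.mem_range.1 hi
  have : ((j - 1 - i : ℕ) : ℂ) = j - 1 - i := by
    rw [Nat.cast_sub (by omega), Nat.cast_sub (by omega)]; simp
  rw [this]
  push_cast
  ring

lemma differentiableAt_Gamma_of_re_pos {z : ℂ} (hz : 0 < z.re) : DifferentiableAt ℂ Gamma z :=
  differentiableAt_Gamma _ fun m h => by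
    rw [h] at hz
    simp at hz
    have : (0 : ℝ) ≤ m := m.cast_nonneg
    linarith

end Complex

section Strip

variable {n : ℕ} {s ν r : ℝ}

lemma exists_norm_cpow_mul_eigenMellin_le (n : ℕ) (ν : ℝ) (hs0 : 0 < s) (hs1 : s ≤ 1)
    (hr : 0 < r) (a b : ℝ) :
    ∃ C : ℝ, 0 < C ∧ ∀ z : ℂ, z.re ∈ Set.Icc a b → 2 ≤ |z.im| →
      ‖(r : ℂ) ^ (-z) * eigenMellin n s ν z‖ ≤ C * Real.exp (-(1 / 2) * |z.im|) := by
  obtain ⟨C, hC, h⟩ := exists_norm_eigenMellin_le n ν hs0 hs1 a b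
  refine ⟨Real.exp (|Real.log r| * (|a| + |b|)) * C, by positivity, fun z hz hy => ?_⟩
  rw [norm_mul, mul_assoc]
  refine mul_le_mul ?_ (h z hz hy) (norm_nonneg _) (Real.exp_pos _).le
  rw [Complex.norm_cpow_eq_rpow_re_of_pos hr, Real.rpow_def_of_pos hr]
  refine Real.exp_le_exp.2 ((le_abs_self _).trans ?_)
  rw [abs_mul]
  gcongr
  rw [Complex.neg_re, abs_neg, abs_le]
  constructor
  · linarith [hz.1, neg_abs_le a, abs_nonneg b]
  · linarith [hz.2, le_abs_self b, abs_nonneg a]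

lemma re_gammaArg (hs0 : 0 < s) (z : ℂ) :
    (ν + (n - z) / (2 * s) : ℂ).re = (2 * s * ν + n - z.re) / (2 * s) := by
  have : (ν + (n - z) / (2 * s) : ℂ) = ν + (n - z) / ((2 * s : ℝ) : ℂ) := by push_cast; rfl
  rw [this, Complex.add_re, Complex.div_ofReal_re]
  simp
  field_simp
  ring

lemma differentiable_inv_Gamma_comp (n : ℕ) :
    Differentiable ℂ fun z : ℂ => (Complex.Gamma ((n - z) / 2))⁻¹ :=
  Complex.differentiable_one_div_Gamma.comp (by fun_prop : Differentiable ℂ fun z : ℂ => (n - z) / 2)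

lemma differentiableAt_eigenMellin (hs0 : 0 < s) {z : ℂ} (h0 : 0 < z.re)
    (h1 : z.re < 2 * s * ν + n) : DifferentiableAt ℂ (eigenMellin n s ν) z := by
  have e : eigenMellin n s ν = fun z : ℂ => 2 ^ z * Complex.Gamma (ν + (n - z) / (2 * s)) *
      Complex.Gamma (z / 2) * (Complex.Gamma ((n - z) / 2))⁻¹ := by
    ext z; rw [eigenMellin, div_eq_mul_inv]
  rw [e]
  have d1 : DifferentiableAt ℂ (fun z : ℂ => Complex.Gamma (ν + (n - z) / (2 * s))) z := by
    refine DifferentiableAt.comp z (Complex.differentiableAt_Gamma_of_re_pos ?_) (by fun_prop)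
    rw [re_gammaArg hs0]
    exact div_pos (by linarith) (by positivity)
  have d2 : DifferentiableAt ℂ (fun z : ℂ => Complex.Gamma (z / 2)) z := by
    refine DifferentiableAt.comp z (Complex.differentiableAt_Gamma_of_re_pos ?_) (by fun_prop)
    simpa using h0
  have d3 : DifferentiableAt ℂ (fun z : ℂ => (Complex.Gamma ((n - z) / 2))⁻¹) z :=
    (differentiable_inv_Gamma_comp n).differentiableAt
  have d4 : DifferentiableAt ℂ (fun z : ℂ => (2 : ℂ) ^ z) z :=
    differentiableAt_id.const_cpow (Or.inl two_ne_zero)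
  exact ((d4.mul d1).mul d2).mul d3

lemma continuous_eigenMellin_vertical (hs0 : 0 < s) {σ : ℝ} (h0 : 0 < σ)
    (h1 : σ < 2 * s * ν + n) : Continuous fun y : ℝ => eigenMellin n s ν (σ + y * Complex.I) :=
  continuous_iff_continuousAt.2 fun y =>
    (differentiableAt_eigenMellin hs0 (by simpa) (by simpa)).continuousAt.comp'
      (f := fun y : ℝ => (σ + y * Complex.I : ℂ)) (by fun_prop)

lemma verticalIntegrable_eigenMellin (hs0 : 0 < s) (hs1 : s ≤ 1) {σ : ℝ} (h0 : 0 < σ)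
    (h1 : σ < 2 * s * ν + n) : Complex.VerticalIntegrable (eigenMellin n s ν) σ := by
  obtain ⟨C, -, h⟩ := exists_norm_eigenMellin_le n ν hs0 hs1 σ σ
  exact integrable_of_norm_le_exp_neg_abs (continuous_eigenMellin_vertical hs0 h0 h1)
    (C := C) (Y := 2) (by norm_num : (0 : ℝ) < 1 / 2) fun y hy => by
      simpa using h (σ + y * Complex.I) (by simp) (by simpa using hy)

/-- The contribution of the pole of `Γ(z/2)` at `z = -2j`. -/
lemma integral_eigenMellin_sub_left (hs0 : 0 < s) (hs1 : s ≤ 1) (hr : 0 < r)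
    (j : ℕ) {b : ℝ} (hb1 : -(2 * j : ℝ) < b)
    (hb2 : b < 2 * s * ν + n) (hb3 : j = 0 ∨ b < -(2 * j : ℝ) + 2) :
    (∫ y : ℝ, (r : ℂ) ^ (-(b + y * Complex.I)) * eigenMellin n s ν (b + y * Complex.I)) -
      (∫ y : ℝ, (r : ℂ) ^ (-(((-(2 * j + 1) : ℝ) : ℂ) + y * Complex.I)) *
        eigenMellin n s ν (((-(2 * j + 1) : ℝ) : ℂ) + y * Complex.I)) =
      2 * Real.pi * (2 * foxWrightTerm ((ν + n / (2 * s) : ℝ) : ℂ) ((1 / s : ℝ) : ℂ) (n / 2) 1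
        (-((r : ℂ) ^ 2 / 4)) j) := by
  -- `Γ(z/2)` is split with `j + 1` linear factors. The last one, `z/2 + j = (z + 2j)/2`, is left
  -- out: it supplies the simple pole and the factor `2`.
  set h : ℂ → ℂ := fun z => (r : ℂ) ^ (-z) * (2 ^ z * Complex.Gamma (ν + (n - z) / (2 * s)) *
    (2 * Complex.Gamma (z / 2 + (j + 1 : ℕ)) / ∏ i ∈ Finset.range j, (z / 2 + i)) *
    (Complex.Gamma ((n - z) / 2))⁻¹) with hh
  -- `U` ends on the left at the next pole of `Γ(z/2)`. On the right it stops before the first pole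
  -- of the other Gamma factor, and for `j > 0` also before the pole `-2j + 2`.
  set U : Set ℂ := {z | -(2 * j + 2 : ℝ) < z.re ∧ z.re < 2 * s * ν + n ∧
    (j = 0 ∨ z.re < -(2 * j : ℝ) + 2)} with hU
  have hrC : (r : ℂ) ≠ 0 := by exact_mod_cast hr.ne'
  have hUo : IsOpen U := by
    refine (isOpen_lt continuous_const Complex.continuous_re).inter
      ((isOpen_lt Complex.continuous_re continuous_const).inter ?_)
    exact isOpen_const.union (isOpen_lt Complex.continuous_re continuous_const)
  have hfac : ∀ z ∈ U, ∀ i < j, z / 2 + i ≠ 0 := by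
    intro z hz i hi h0
    have h1 := congrArg Complex.re h0
    simp at h1
    rcases hz.2.2 with h2 | h2
    · omega
    · have : (i : ℝ) + 1 ≤ j := by exact_mod_cast hi
      linarith
  have hdiff : DifferentiableOn ℂ h U := by
    intro z hz
    refine DifferentiableAt.differentiableWithinAt ?_
    have d0 : DifferentiableAt ℂ (fun z : ℂ => (r : ℂ) ^ (-z)) z :=
      differentiableAt_id.neg.const_cpow (Or.inl hrC)
    have d1 : DifferentiableAt ℂ (fun z : ℂ => Complex.Gamma (ν + (n - z) / (2 * s))) z := by
      refine DifferentiableAt.comp z (Complex.differentiableAt_Gamma_of_re_pos ?_) (by fun_prop)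
      rw [re_gammaArg hs0]
      exact div_pos (by linarith [hz.2.1]) (by positivity)
    have d2 : DifferentiableAt ℂ (fun z : ℂ => Complex.Gamma (z / 2 + (j + 1 : ℕ))) z := by
      refine DifferentiableAt.comp z (Complex.differentiableAt_Gamma_of_re_pos ?_) (by fun_prop)
      have := hz.1
      simp
      linarith
    have d3 : DifferentiableAt ℂ (fun z : ℂ => (Complex.Gamma ((n - z) / 2))⁻¹) z :=
      (differentiable_inv_Gamma_comp n).differentiableAt
    have d4 : DifferentiableAt ℂ (fun z : ℂ => (2 : ℂ) ^ z) z :=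
      differentiableAt_id.const_cpow (Or.inl two_ne_zero)
    have d5 : DifferentiableAt ℂ (fun z : ℂ => ∏ i ∈ Finset.range j, (z / 2 + i)) z := by
      fun_prop
    exact d0.mul (((d4.mul d1).mul ((d2.const_mul 2).div d5
      (Finset.prod_ne_zero_iff.2 fun i hi => hfac z hz i (Finset.mem_range.1 hi)))).mul d3)
  have hfh : ∀ z ∈ U, z ≠ ((-(2 * j) : ℝ) : ℂ) →
      (r : ℂ) ^ (-z) * eigenMellin n s ν z = h z / (z - ((-(2 * j) : ℝ) : ℂ)) := by
    intro z hz hne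
    have hne' : z - ((-(2 * j) : ℝ) : ℂ) ≠ 0 := sub_ne_zero.2 hne
    have hj0 : z / 2 + j ≠ 0 := fun h0 => hne' (by push_cast; linear_combination 2 * h0)
    have hprod : ∏ i ∈ Finset.range j, (z / 2 + i) ≠ 0 :=
      Finset.prod_ne_zero_iff.2 fun i hi => hfac z hz i (Finset.mem_range.1 hi)
    have hG := Complex.Gamma_eq_Gamma_add_nat_div_prod (z / 2) (j + 1) fun i hi => by
      rcases Nat.lt_succ_iff_lt_or_eq.1 hi with hi | rfl
      · exact hfac z hz i hi
      · exact hj0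
    rw [Finset.prod_range_succ] at hG
    have e : z - ((-(2 * j) : ℝ) : ℂ) = 2 * (z / 2 + j) := by push_cast; ring
    rw [e, eigenMellin, hG]
    simp only [hh]
    field_simp
  obtain ⟨C, hC, hdec⟩ := exists_norm_cpow_mul_eigenMellin_le n ν hs0 hs1 hr (-(2 * j + 1)) b
  have key := Complex.integral_vertical_sub_integral_vertical hUo (a := -(2 * j + 1))
    (p := -(2 * j)) (b := b) (by linarith) hb1
    (fun z hz => ⟨by linarith [hz.1], by linarith [hz.2], hb3.imp id fun h => by linarith [hz.2]⟩)
    hdiff hfh (by norm_num : (0 : ℝ) < 1 / 2) hdec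
  rw [key]
  congr 1
  simp only [hh, foxWrightTerm]
  have e1 : (-((-(2 * j) : ℝ) : ℂ)) = ((2 * j : ℕ) : ℂ) := by push_cast; ring
  have e2 : ((-(2 * j) : ℝ) : ℂ) = -((2 * j : ℕ) : ℂ) := by push_cast; ring
  have e3 : ((-(2 * j) : ℝ) : ℂ) / 2 = -(j : ℂ) := by push_cast; ring
  have hsC : (s : ℂ) ≠ 0 := by exact_mod_cast hs0.ne'
  have e4 : (ν + (n - ((-(2 * j) : ℝ) : ℂ)) / (2 * s) : ℂ) =
      ((ν + n / (2 * s) : ℝ) : ℂ) + ((1 / s : ℝ) : ℂ) * j := by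
    push_cast; field_simp; ring
  have e5 : ((n - ((-(2 * j) : ℝ) : ℂ)) / 2 : ℂ) = n / 2 + 1 * j := by push_cast; ring
  have e6 : (-(j : ℂ) + ((j + 1 : ℕ) : ℂ)) = 1 := by push_cast; ring
  rw [e4, e5, e3, e6, Complex.prod_range_neg_add_nat, Complex.Gamma_one, e1, e2, Complex.cpow_neg,
    Complex.cpow_natCast, Complex.cpow_natCast, neg_pow ((r : ℂ) ^ 2 / 4), div_pow, pow_mul, pow_mul]
  have hm : ((-1 : ℂ) ^ j) * (-1) ^ j = 1 := by rw [← mul_pow]; simp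
  have hm0 : ((-1 : ℂ) ^ j) ≠ 0 := by simp
  have hf0 : (j.factorial : ℂ) ≠ 0 := by exact_mod_cast j.factorial_ne_zero
  have hm2 : ((-1 : ℂ) ^ j)⁻¹ = (-1) ^ j := by
    rw [← inv_pow]; norm_num
  rw [div_eq_mul_inv (2 * 1 : ℂ), mul_inv, hm2]
  norm_num
  ring

end Strip

/-! ### Bounds half-way between poles, and the residue series on the left. -/

namespace Complex

/-- On such lines the real part of `sin (π z)` is `± cosh (π im z)`. -/
lemma cosh_le_norm_sin_pi_mul {z : ℂ} (h : Real.cos (Real.pi * z.re) = 0) :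
    Real.cosh (Real.pi * z.im) ≤ ‖sin (Real.pi * z)‖ := by
  have h1 : |Real.sin (Real.pi * z.re)| = 1 := by
    have := Real.sin_sq_add_cos_sq (Real.pi * z.re)
    rw [h] at this
    rw [← Real.sqrt_sq_eq_abs, Real.sqrt_eq_one]
    linarith
  have h2 : (sin (Real.pi * z)).re = Real.sin (Real.pi * z.re) * Real.cosh (Real.pi * z.im) := by
    rw [sin_eq]
    have e1 : (Real.pi * z : ℂ).re = Real.pi * z.re := by simp
    have e2 : (Real.pi * z : ℂ).im = Real.pi * z.im := by simp
    rw [e1, e2, ← ofReal_sin, ← ofReal_cosh, ← ofReal_cos, ← ofReal_sinh]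
    simp only [add_re, mul_re, ofReal_re, ofReal_im, I_re, I_im, mul_im]
    ring
  have h3 := abs_re_le_norm (sin (Real.pi * z))
  rwa [h2, abs_mul, h1, one_mul, abs_of_pos (Real.cosh_pos _)] at h3

lemma cos_pi_mul_nat_add_half (N : ℕ) : Real.cos (Real.pi * (N + 1 / 2)) = 0 :=
  Real.cos_eq_zero_iff.2 ⟨N, by push_cast; ring⟩

/-- Upper bound for `Γ` on the vertical lines half-way between its poles. -/
lemma norm_Gamma_mul_sqrt_cosh_le {w : ℂ} (h : Real.cos (Real.pi * w.re) = 0)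
    (hw : w.re ≤ 1 / 2) :
    ‖Gamma w‖ * √(Real.cosh (Real.pi * w.im)) ≤ Real.pi / Real.Gamma (1 - w.re) := by
  have hG : 0 < Real.Gamma (1 - w.re) := Real.Gamma_pos_of_pos (by linarith)
  have hc := Real.cosh_pos (Real.pi * w.im)
  -- In the reflection formula, lower bounds for `Γ(1 - w)` and for the sine become an upper bound
  -- for `Γ w`.
  have h1 := Gamma_re_le_norm_Gamma_mul_sqrt_cosh (z := 1 - w) (by simp; linarith)
  have h2 := cosh_le_norm_sin_pi_mul h
  have h3 := congrArg norm (Gamma_mul_Gamma_one_sub w)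
  rw [norm_mul, norm_div, norm_real, Real.norm_of_nonneg Real.pi_pos.le] at h3
  have h4 : ‖Gamma w‖ * ‖Gamma (1 - w)‖ * Real.cosh (Real.pi * w.im) ≤ Real.pi := by
    rw [h3, div_mul_eq_mul_div, div_le_iff₀ (hc.trans_le h2)]
    exact mul_le_mul_of_nonneg_left h2 Real.pi_pos.le
  simp only [sub_re, one_re, sub_im, one_im, zero_sub, mul_neg, Real.cosh_neg] at h1
  rw [le_div_iff₀ hG]
  calc _ ≤ ‖Gamma w‖ * √(Real.cosh (Real.pi * w.im)) *
        (‖Gamma (1 - w)‖ * √(Real.cosh (Real.pi * w.im))) := by gcongr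
    _ = ‖Gamma w‖ * ‖Gamma (1 - w)‖ * (√(Real.cosh (Real.pi * w.im)) ^ 2) := by ring
    _ ≤ _ := by rwa [Real.sq_sqrt hc.le]

end Complex

section Left

variable {n : ℕ} {s ν r : ℝ}

/-- On `Re z = -(2N + 1)` the point `z / 2` is half-way between poles. The upper bound for `Γ(z/2)`
and the lower bound for `Γ((n - z)/2)` contain the same root of `cosh (π y / 2)`, which cancels. The
third Gamma factor, with its argument raised by `2`, pays for an integrable weight in `y`. The bound
is the general term of a series that converges for `s > 1/2`, and for `s = 1/2` when `r < 1`. -/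
lemma norm_integral_eigenMellin_left_le (hn : 1 ≤ n) (hs0 : 0 < s) (hr : 0 < r)
    (hν : 0 < ν + n / (2 * s)) (N : ℕ) :
    ‖∫ y : ℝ, (r : ℂ) ^ (-(((-(2 * N + 1) : ℝ) : ℂ) + y * Complex.I)) *
        eigenMellin n s ν (((-(2 * N + 1) : ℝ) : ℂ) + y * Complex.I)‖ ≤
      Real.pi * (r / 2) * (∫ y : ℝ, ((ν + n / (2 * s)) ^ 2 + (y / (2 * s)) ^ 2)⁻¹) *
        (Real.Gamma (ν + n / (2 * s) + 1 / (2 * s) + 2 + 1 / s * N) /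
          (Real.Gamma (3 / 2 + N) * Real.Gamma ((n + 1) / 2 + N)) * ((r / 2) ^ 2) ^ N) := by
  set X0 := ν + n / (2 * s) with hX0
  have hint : Integrable fun y : ℝ => (X0 ^ 2 + (y / (2 * s)) ^ 2)⁻¹ :=
    (integrable_inv_sq_add_sq hν.ne').comp_div (by positivity : 2 * s ≠ 0)
  have hG1 : 0 < Real.Gamma (3 / 2 + N) := Real.Gamma_pos_of_pos (by positivity)
  have hG2 : 0 < Real.Gamma ((n + 1) / 2 + N) := Real.Gamma_pos_of_pos (by positivity)
  have hn' : (1 : ℝ) ≤ n := by exact_mod_cast hn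
  set t : ℝ := Real.pi * (r / 2) * (Real.Gamma (X0 + 1 / (2 * s) + 2 + 1 / s * N) /
          (Real.Gamma (3 / 2 + N) * Real.Gamma ((n + 1) / 2 + N)) * ((r / 2) ^ 2) ^ N) with ht
  have hbound : ∀ y : ℝ, ‖(r : ℂ) ^ (-(((-(2 * N + 1) : ℝ) : ℂ) + y * Complex.I)) *
        eigenMellin n s ν (((-(2 * N + 1) : ℝ) : ℂ) + y * Complex.I)‖ ≤
      t * (X0 ^ 2 + (y / (2 * s)) ^ 2)⁻¹ := by
    intro y
    set z : ℂ := ((-(2 * N + 1) : ℝ) : ℂ) + y * Complex.I with hz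
    have hzre : z.re = -(2 * N + 1) := by simp [hz]
    have hzim : z.im = y := by simp [hz]
    have b1 : ‖(r : ℂ) ^ (-z)‖ * ‖(2 : ℂ) ^ z‖ = (r / 2) * ((r / 2) ^ 2) ^ N := by
      have h2 := Complex.norm_cpow_eq_rpow_re_of_pos (x := 2) two_pos z
      rw [Complex.ofReal_ofNat] at h2
      rw [h2, Complex.norm_cpow_eq_rpow_re_of_pos hr, Complex.neg_re, hzre, neg_neg,
        Real.rpow_neg two_pos.le, ← div_eq_mul_inv, ← Real.div_rpow hr.le two_pos.le, ← pow_mul,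
        ← pow_succ', ← Real.rpow_natCast]
      congr 1
      push_cast
      ring
    have b2 : ‖Complex.Gamma (z / 2)‖ * √(Real.cosh (Real.pi * (y / 2))) ≤
        Real.pi / Real.Gamma (3 / 2 + N) := by
      have e1 : (z / 2).re = -(N + 1 / 2) := by simp [hzre]; ring
      have e2 : (z / 2).im = y / 2 := by simp [hzim]
      have := Complex.norm_Gamma_mul_sqrt_cosh_le (w := z / 2)
        (by rw [e1, mul_neg, Real.cos_neg, Complex.cos_pi_mul_nat_add_half])
        (by rw [e1]; linarith [(N.cast_nonneg : (0 : ℝ) ≤ N)])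
      rw [e1, e2] at this
      convert this using 3
      ring
    have b3 : Real.Gamma ((n + 1) / 2 + N) ≤
        ‖Complex.Gamma ((n - z) / 2)‖ * √(Real.cosh (Real.pi * (y / 2))) := by
      have e1 : ((n - z) / 2).re = (n + 1) / 2 + N := by simp [hzre]; ring
      have e2 : ((n - z) / 2).im = -(y / 2) := by simp [hzim, neg_div]
      have := Complex.Gamma_re_le_norm_Gamma_mul_sqrt_cosh (z := (n - z) / 2)
        (by rw [e1]; linarith [(N.cast_nonneg : (0 : ℝ) ≤ N)])
      rwa [e1, e2, mul_neg, Real.cosh_neg] at this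
    have b4 : ‖Complex.Gamma (z / 2)‖ / ‖Complex.Gamma ((n - z) / 2)‖ ≤
        Real.pi / (Real.Gamma (3 / 2 + N) * Real.Gamma ((n + 1) / 2 + N)) := by
      have hc : 0 < √(Real.cosh (Real.pi * (y / 2))) := Real.sqrt_pos.2 (Real.cosh_pos _)
      have hp : 0 < ‖Complex.Gamma ((n - z) / 2)‖ := by
        by_contra h0
        have : ‖Complex.Gamma ((n - z) / 2)‖ = 0 := le_antisymm (not_lt.1 h0) (norm_nonneg _)
        rw [this, zero_mul] at b3
        linarith
      rw [← mul_div_mul_right _ _ hc.ne', ← div_div Real.pi]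
      exact div_le_div₀ (by positivity) b2 hG2 b3
    have b5 : ‖Complex.Gamma (ν + (n - z) / (2 * s))‖ ≤
        Real.Gamma (X0 + 1 / (2 * s) + 2 + 1 / s * N) * (X0 ^ 2 + (y / (2 * s)) ^ 2)⁻¹ := by
      have e0 : (ν + (n - z) / (2 * s) : ℂ) = ν + (n - z) / ((2 * s : ℝ) : ℂ) := by push_cast; rfl
      have e1 : (ν + (n - z) / (2 * s) : ℂ).re = X0 + 1 / (2 * s) + 1 / s * N := by
        rw [e0, Complex.add_re, Complex.div_ofReal_re]
        simp [hzre, hX0]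
        field_simp
        ring
      have e2 : (ν + (n - z) / (2 * s) : ℂ).im = -(y / (2 * s)) := by
        rw [e0, Complex.add_im, Complex.div_ofReal_im]
        simp [hzim, neg_div]
      have hpos : 0 < X0 + 1 / (2 * s) + 1 / s * N := by positivity
      have := Complex.norm_Gamma_mul_le (z := ν + (n - z) / (2 * s)) (by rw [e1]; exact hpos)
      rw [e1, e2, neg_sq] at this
      rw [← div_eq_mul_inv, le_div_iff₀ (by positivity)]
      -- The real part grows with `N`; replacing it by its lower bound `X0` in the weight gives one
      -- integral for all `N`.
      refine le_trans ?_ (this.trans (le_of_eq ?_))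
      · gcongr
        have : 0 ≤ 1 / (2 * s) + 1 / s * N := by positivity
        linarith
      · congr 1; ring
    calc ‖(r : ℂ) ^ (-z) * eigenMellin n s ν z‖
        = (‖(r : ℂ) ^ (-z)‖ * ‖(2 : ℂ) ^ z‖) * ‖Complex.Gamma (ν + (n - z) / (2 * s))‖ *
          (‖Complex.Gamma (z / 2)‖ / ‖Complex.Gamma ((n - z) / 2)‖) := by
          rw [eigenMellin]; simp only [norm_mul, norm_div]; ring
      _ ≤ ((r / 2) * ((r / 2) ^ 2) ^ N) *
          (Real.Gamma (X0 + 1 / (2 * s) + 2 + 1 / s * N) * (X0 ^ 2 + (y / (2 * s)) ^ 2)⁻¹) *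
          (Real.pi / (Real.Gamma (3 / 2 + N) * Real.Gamma ((n + 1) / 2 + N))) := by
          rw [b1]; gcongr
      _ = _ := by rw [ht]; ring
  refine (norm_integral_le_of_norm_le (hint.const_mul t) (ae_of_all _ hbound)).trans (le_of_eq ?_)
  rw [integral_const_mul, ht]
  ring

/-- The inverse Mellin transform as the sum of the residues at `z = 0, -2, -4, …`. -/
lemma hasSum_mellinInv_eigenMellin_left (hn : 1 ≤ n) (hs0 : 0 < s) (hs1 : s ≤ 1) (hr : 0 < r)
    (hsr : 1 / 2 < s ∨ s = 1 / 2 ∧ r < 1) {σ : ℝ} (h0 : 0 < σ) (h1 : σ < 2 * s * ν + n) :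
    HasSum (fun j => 2 * foxWrightTerm ((ν + n / (2 * s) : ℝ) : ℂ) ((1 / s : ℝ) : ℂ) (n / 2) 1
        (-((r : ℂ) ^ 2 / 4)) j) (mellinInv σ (eigenMellin n s ν) r) := by
  have hX0 : 0 < ν + n / (2 * s) := by
    have : ν + n / (2 * s) = (2 * s * ν + n) / (2 * s) := by field_simp
    rw [this]
    exact div_pos (h0.trans h1) (by positivity)
  have hX : (0 : ℝ) ≤ (r / 2) ^ 2 := by positivity
  have hδ : 1 / s < 2 ∨ 1 / s = 2 ∧ 4 * (r / 2) ^ 2 < 1 := by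
    rcases hsr with h | ⟨rfl, h⟩
    · left
      rw [div_lt_iff₀ hs0]
      linarith
    · right
      refine ⟨by norm_num, ?_⟩
      nlinarith
  set c : ℕ → ℂ := fun j => 2 * foxWrightTerm ((ν + n / (2 * s) : ℝ) : ℂ) ((1 / s : ℝ) : ℂ)
    (n / 2) 1 (-((r : ℂ) ^ 2 / 4)) j with hc
  set F : ℝ → ℂ := fun b => ∫ y : ℝ, (r : ℂ) ^ (-(b + y * Complex.I)) *
    eigenMellin n s ν (b + y * Complex.I) with hF
  have hsum : Summable c := by
    have h := (summable_Gamma_div_Gamma_mul_Gamma (A := ν + n / (2 * s)) (B := n / 2) (D := 1)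
      hX (by positivity : 0 < 1 / s) hδ).mul_left 2
    -- The factorial is `Γ(1 + j)`, whence `D = 1`.
    refine Summable.of_norm_bounded h fun j => le_of_eq ?_
    have e1 : (((ν + n / (2 * s) : ℝ) : ℂ) + ((1 / s : ℝ) : ℂ) * j) =
      ((ν + n / (2 * s) + 1 / s * j : ℝ) : ℂ) := by push_cast; ring
    have e2 : ((n : ℂ) / 2 + 1 * j) = ((n / 2 + j : ℝ) : ℂ) := by push_cast; ring
    have hn' : (1 : ℝ) ≤ n := by exact_mod_cast hn
    have e3 : Real.Gamma (1 + (j : ℝ)) = j.factorial := by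
      rw [add_comm, Real.Gamma_nat_eq_factorial]
    simp only [hc, foxWrightTerm]
    rw [e1, e2, Complex.Gamma_ofReal, Complex.Gamma_ofReal, norm_mul, norm_mul, norm_div, norm_div,
      Complex.norm_real, Complex.norm_real, norm_pow, norm_neg, norm_div, norm_pow,
      Complex.norm_real, e3, Real.norm_of_nonneg hr.le,
      Real.norm_of_nonneg (Real.Gamma_pos_of_pos (by positivity)).le,
      Real.norm_of_nonneg (Real.Gamma_pos_of_pos (by positivity)).le, Complex.norm_natCast]
    rw [show (r / 2) ^ 2 = r ^ 2 / 4 by ring]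
    norm_num
    field_simp
  -- The step from `-(2N + 1)` to `-(2N + 3)` crosses only the pole at `-2(N + 1)`.
  have hstep : ∀ N : ℕ, F σ = 2 * Real.pi * (∑ j ∈ Finset.range (N + 1), c j) +
      F (-(2 * N + 1)) := by
    intro N
    induction N with
    | zero =>
      have := integral_eigenMellin_sub_left hs0 hs1 hr 0 (by simpa using h0) h1 (Or.inl rfl)
      simp only [zero_add, Finset.sum_range_one, hF]
      rw [← this]
      simp
    | succ N ih =>
      have := integral_eigenMellin_sub_left (n := n) (s := s) (ν := ν) hs0 hs1 hr (N + 1)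
        (b := -(2 * N + 1)) (by push_cast; linarith)
        (by linarith [(N.cast_nonneg : (0 : ℝ) ≤ N)]) (Or.inr (by push_cast; linarith))
      rw [Finset.sum_range_succ, mul_add, ih]
      simp only [hF, hc] at this ⊢
      rw [← this]
      push_cast
      ring
  have hrem : Filter.Tendsto (fun N : ℕ => F (-(2 * N + 1))) Filter.atTop (nhds 0) := by
    refine squeeze_zero_norm (fun N => norm_integral_eigenMellin_left_le hn hs0 hr hX0 N) ?_
    have := (summable_Gamma_div_Gamma_mul_Gamma
      (A := ν + n / (2 * s) + 1 / (2 * s) + 2) (B := 3 / 2) (D := (n + 1) / 2)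
      hX (by positivity : 0 < 1 / s) hδ).tendsto_atTop_zero.const_mul
      (Real.pi * (r / 2) * (∫ y : ℝ, ((ν + n / (2 * s)) ^ 2 + (y / (2 * s)) ^ 2)⁻¹))
    rwa [mul_zero] at this
  have hlim : Filter.Tendsto (fun N : ℕ => 2 * Real.pi * (∑ j ∈ Finset.range (N + 1), c j))
      Filter.atTop (nhds (F σ - 0)) :=
    (tendsto_const_nhds.sub hrem).congr fun N => by rw [hstep N]; ring
  have hlim2 := (hsum.hasSum.tendsto_sum_nat.comp (Filter.tendsto_add_atTop_nat 1)).const_mul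
    (2 * Real.pi : ℂ)
  have heq := tendsto_nhds_unique hlim hlim2
  have hval : mellinInv σ (eigenMellin n s ν) r = ∑' j, c j := by
    have hpi : (Real.pi : ℂ) ≠ 0 := by exact_mod_cast Real.pi_ne_zero
    have : mellinInv σ (eigenMellin n s ν) r = ((1 / (2 * Real.pi) : ℝ) : ℂ) * F σ := by
      rw [mellinInv, Complex.real_smul]
      rfl
    rw [this, ← sub_zero (F σ), heq]
    push_cast
    field_simp
  rw [hval]
  exact hsum.hasSum

end Left

/-! ### The residue series on the right. -/

section Right

variable {n : ℕ} {s ν r : ℝ}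

/-- The contribution of the pole of `Γ(ν + (n - z)/(2s))` at `z = 2sν + n + 2sj`. -/
lemma integral_eigenMellin_sub_right (hs0 : 0 < s) (hs1 : s ≤ 1) (hr : 0 < r)
    (j : ℕ) {a : ℝ} (ha0 : 0 < a) (ha1 : a < 2 * s * ν + n + 2 * s * j)
    (ha2 : j = 0 ∨ 2 * s * ν + n + 2 * s * j - 2 * s < a) :
    (∫ y : ℝ, (r : ℂ) ^ (-(((2 * s * ν + n + 2 * s * (j + 1 / 2) : ℝ) : ℂ) + y * Complex.I)) *
        eigenMellin n s ν (((2 * s * ν + n + 2 * s * (j + 1 / 2) : ℝ) : ℂ) + y * Complex.I)) -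
      (∫ y : ℝ, (r : ℂ) ^ (-(a + y * Complex.I)) * eigenMellin n s ν (a + y * Complex.I)) =
      -(2 * Real.pi * (((2 * s * (2 / r) ^ (2 * s * ν + n) : ℝ) : ℂ) *
        foxWrightTerm ((s * ν + n / 2 : ℝ) : ℂ) (s : ℂ) ((-(s * ν) : ℝ) : ℂ) ((-s : ℝ) : ℂ)
          ((-(2 / r) ^ (2 * s) : ℝ) : ℂ) j)) := by
  set p : ℝ := 2 * s * ν + n + 2 * s * j with hp
  -- The vanishing factor is `ν + (n - z)/(2s) + j = -(z - p)/(2s)`, hence the coefficient `-(2s)`.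
  -- Its sign is undone later, because the line now moves to the right.
  set h : ℂ → ℂ := fun z => (r : ℂ) ^ (-z) * (2 ^ z *
    (-(2 * s) * Complex.Gamma (ν + (n - z) / (2 * s) + (j + 1 : ℕ)) /
      ∏ i ∈ Finset.range j, (ν + (n - z) / (2 * s) + i)) * Complex.Gamma (z / 2) *
    (Complex.Gamma ((n - z) / 2))⁻¹) with hh
  set U : Set ℂ := {z | 0 < z.re ∧ z.re < p + 2 * s ∧ (j = 0 ∨ p - 2 * s < z.re)} with hU
  have hrC : (r : ℂ) ≠ 0 := by exact_mod_cast hr.ne'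
  have hsC : (s : ℂ) ≠ 0 := by exact_mod_cast hs0.ne'
  have hUo : IsOpen U := by
    refine (isOpen_lt continuous_const Complex.continuous_re).inter
      ((isOpen_lt Complex.continuous_re continuous_const).inter ?_)
    exact isOpen_const.union (isOpen_lt continuous_const Complex.continuous_re)
  have hfac : ∀ z ∈ U, ∀ i < j, (ν + (n - z) / (2 * s) : ℂ) + i ≠ 0 := by
    intro z hz i hi h0
    have h1 := congrArg Complex.re h0
    rw [Complex.add_re, re_gammaArg hs0, Complex.natCast_re, Complex.zero_re,
      div_add' _ _ _ (by positivity), div_eq_zero_iff] at h1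
    rcases hz.2.2 with h2 | h2
    · omega
    · have h3 : (i : ℝ) + 1 ≤ j := by exact_mod_cast hi
      rcases h1 with h1 | h1
      · rw [hp] at h2
        nlinarith
      · linarith
  have hdiff : DifferentiableOn ℂ h U := by
    intro z hz
    refine DifferentiableAt.differentiableWithinAt ?_
    have d0 : DifferentiableAt ℂ (fun z : ℂ => (r : ℂ) ^ (-z)) z :=
      differentiableAt_id.neg.const_cpow (Or.inl hrC)
    have d1 : DifferentiableAt ℂ (fun z : ℂ => Complex.Gamma (z / 2)) z := by
      refine DifferentiableAt.comp z (Complex.differentiableAt_Gamma_of_re_pos ?_) (by fun_prop)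
      simpa using hz.1
    have d2 : DifferentiableAt ℂ
        (fun z : ℂ => Complex.Gamma (ν + (n - z) / (2 * s) + (j + 1 : ℕ))) z := by
      refine DifferentiableAt.comp z (Complex.differentiableAt_Gamma_of_re_pos ?_) (by fun_prop)
      rw [Complex.add_re, re_gammaArg hs0, Complex.natCast_re, div_add' _ _ _ (by positivity)]
      have := hz.2.1
      rw [hp] at this
      refine div_pos ?_ (by positivity)
      push_cast
      linarith
    have d4 : DifferentiableAt ℂ (fun z : ℂ => (2 : ℂ) ^ z) z :=
      differentiableAt_id.const_cpow (Or.inl two_ne_zero)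
    have d5 : DifferentiableAt ℂ
        (fun z : ℂ => ∏ i ∈ Finset.range j, (ν + (n - z) / (2 * s) + i : ℂ)) z := by
      fun_prop
    exact d0.mul (((d4.mul ((d2.const_mul _).div d5
      (Finset.prod_ne_zero_iff.2 fun i hi => hfac z hz i (Finset.mem_range.1 hi)))).mul d1).mul
      (differentiable_inv_Gamma_comp n).differentiableAt)
  have hfh : ∀ z ∈ U, z ≠ (p : ℂ) →
      (r : ℂ) ^ (-z) * eigenMellin n s ν z = h z / (z - p) := by
    intro z hz hne
    have hne' : z - p ≠ 0 := sub_ne_zero.2 hne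
    have e : (ν + (n - z) / (2 * s) + j : ℂ) = -(z - p) / (2 * s) := by
      rw [hp]; push_cast; field_simp; ring
    have hj0 : (ν + (n - z) / (2 * s) + j : ℂ) ≠ 0 := by
      rw [e]
      exact div_ne_zero (neg_ne_zero.2 hne') (mul_ne_zero two_ne_zero hsC)
    have hprod : ∏ i ∈ Finset.range j, (ν + (n - z) / (2 * s) + i : ℂ) ≠ 0 :=
      Finset.prod_ne_zero_iff.2 fun i hi => hfac z hz i (Finset.mem_range.1 hi)
    have hG := Complex.Gamma_eq_Gamma_add_nat_div_prod (ν + (n - z) / (2 * s)) (j + 1)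
      fun i hi => by
        rcases Nat.lt_succ_iff_lt_or_eq.1 hi with hi | rfl
        · exact hfac z hz i hi
        · exact hj0
    rw [Finset.prod_range_succ, e] at hG
    rw [eigenMellin, hG]
    simp only [hh]
    set P := ∏ i ∈ Finset.range j, (ν + (n - z) / (2 * s) + i : ℂ)
    set G := Complex.Gamma (ν + (n - z) / (2 * s) + (j + 1 : ℕ))
    rw [div_eq_mul_inv _ (Complex.Gamma ((n - z) / 2))]
    have e2 : G / (P * (-(z - p) / (2 * s))) = -(2 * s) * G / P / (z - p) := by
      field_simp
    rw [e2]
    ring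
  obtain ⟨C, hC, hdec⟩ := exists_norm_cpow_mul_eigenMellin_le n ν hs0 hs1 hr a
    (2 * s * ν + n + 2 * s * (j + 1 / 2))
  have key := Complex.integral_vertical_sub_integral_vertical hUo (a := a)
    (p := p) (b := 2 * s * ν + n + 2 * s * (j + 1 / 2)) ha1 (by rw [hp]; linarith)
    (fun z hz => ⟨by linarith [hz.1], by rw [hp]; linarith [hz.2],
      ha2.imp id fun h => by linarith [hz.1]⟩)
    hdiff hfh (by norm_num : (0 : ℝ) < 1 / 2) hdec
  rw [key, ← mul_neg]
  congr 1
  simp only [hh, foxWrightTerm]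
  have e1 : (r : ℂ) ^ (-(p : ℂ)) * 2 ^ (p : ℂ) =
      (((2 / r) ^ (2 * s * ν + n) * ((2 / r) ^ (2 * s)) ^ j : ℝ) : ℂ) := by
    rw [← Real.rpow_natCast, ← Real.rpow_mul (by positivity), ← Real.rpow_add (by positivity), ← hp,
      Real.div_rpow two_pos.le hr.le, div_eq_mul_inv, ← Real.rpow_neg hr.le, Complex.ofReal_mul,
      Complex.ofReal_cpow two_pos.le, Complex.ofReal_cpow hr.le]
    push_cast
    ring
  have e2 : (ν + (n - (p : ℂ)) / (2 * s) : ℂ) = -j := by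
    rw [hp]; push_cast; field_simp; ring
  have e3 : ((p : ℂ) / 2) = ((s * ν + n / 2 : ℝ) : ℂ) + s * j := by rw [hp]; push_cast; ring
  have e4 : ((n - (p : ℂ)) / 2) = ((-(s * ν) : ℝ) : ℂ) + ((-s : ℝ) : ℂ) * j := by
    rw [hp]; push_cast; ring
  have e5 : (-(j : ℂ) + ((j + 1 : ℕ) : ℂ)) = 1 := by push_cast; ring
  have hm2 : ((-1 : ℂ) ^ j)⁻¹ = (-1) ^ j := by
    rw [← inv_pow]; norm_num
  rw [e2, e3, e4, e5, Complex.prod_range_neg_add_nat, Complex.Gamma_one]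
  calc _ = ((r : ℂ) ^ (-(p : ℂ)) * 2 ^ (p : ℂ)) * (-(2 * s) * 1 / ((-1) ^ j * (j.factorial : ℂ))) *
        Complex.Gamma (((s * ν + n / 2 : ℝ) : ℂ) + s * j) *
        (Complex.Gamma (((-(s * ν) : ℝ) : ℂ) + ((-s : ℝ) : ℂ) * j))⁻¹ := by ring
    _ = _ := by
      have e6 : ((-(2 / r) ^ (2 * s) : ℝ) : ℂ) ^ j =
          (-1) ^ j * (((2 / r) ^ (2 * s)) ^ j : ℝ) := by
        rw [Complex.ofReal_neg, neg_pow, Complex.ofReal_pow]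
      rw [e1, e6, div_eq_mul_inv (-(2 * s) * 1 : ℂ), mul_inv, hm2]
      push_cast
      ring

/-- The reason is `cosh² x ≤ cosh (2x)`. With `v = y/(2s)`, the growth `cosh (π y / 2)` in the bound
for `1/Γ((n - z)/2)` is then compensated by the decay of `Γ(ν + (n - z)/(2s))`. -/
lemma cosh_mul_le_sqrt_cosh (hs0 : 0 < s) (hs : s ≤ 1 / 2) (v : ℝ) :
    Real.cosh (Real.pi * (s * v)) ≤ √(Real.cosh (Real.pi * v)) := by
  have h1 : Real.cosh (Real.pi * (s * v)) ≤ Real.cosh (Real.pi * v / 2) := by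
    rw [Real.cosh_le_cosh, abs_mul, abs_mul, abs_div, abs_mul, abs_of_pos hs0, abs_two]
    have : 0 ≤ |Real.pi| * |v| := by positivity
    nlinarith
  refine h1.trans (Real.le_sqrt_of_sq_le ?_)
  have h2 := Real.cosh_two_mul (Real.pi * v / 2)
  have h3 := Real.cosh_sq (Real.pi * v / 2)
  rw [mul_div_cancel₀ _ two_ne_zero] at h2
  have h4 := Real.one_le_cosh (Real.pi * v)
  linarith

/-- By reflection `1/Γ(w) = Γ(1 - w) sin(π w) / π`. At a pole `Γ w` is `0` by convention, and so is
its inverse. -/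
lemma norm_inv_Gamma_le {w : ℂ} (hw : w.re < 1) :
    ‖Complex.Gamma w‖⁻¹ ≤
      Real.Gamma (1 - w.re) * Real.cosh (Real.pi * w.im) / Real.pi := by
  have h1 : 0 < (1 - w).re := by simpa using hw
  have hp : 0 ≤ Real.Gamma (1 - w.re) * Real.cosh (Real.pi * w.im) / Real.pi := by
    have := Real.Gamma_pos_of_pos (sub_pos.2 hw)
    have := Real.cosh_pos (Real.pi * w.im)
    positivity
  rcases eq_or_ne (Complex.Gamma w) 0 with h0 | h0
  · simpa [h0] using hp
  have h3 := congrArg norm (Complex.Gamma_mul_Gamma_one_sub w)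
  rw [norm_mul, norm_div, Complex.norm_real, Real.norm_of_nonneg Real.pi_pos.le] at h3
  have h4 := Complex.norm_Gamma_le_Gamma_re h1
  have h5 := Complex.norm_sin_pi_mul_le w
  have hg : 0 < ‖Complex.Gamma (1 - w)‖ := norm_pos_iff.2 (Complex.Gamma_ne_zero_of_re_pos h1)
  have hs : 0 < ‖Complex.sin (Real.pi * w)‖ := by
    rw [norm_pos_iff]
    intro h6
    rw [h6, norm_zero, div_zero] at h3
    exact (mul_pos (norm_pos_iff.2 h0) hg).ne' h3
  rw [eq_div_iff hs.ne'] at h3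
  rw [inv_le_iff_one_le_mul₀ (norm_pos_iff.2 h0), div_mul_eq_mul_div, le_div_iff₀ Real.pi_pos,
    one_mul]
  calc Real.pi = ‖Complex.Gamma (1 - w)‖ * ‖Complex.sin (Real.pi * w)‖ * ‖Complex.Gamma w‖ :=
        h3.symm.trans (by ring)
    _ ≤ _ := by
        gcongr
        simpa using h4

/-- The argument of the first Gamma factor now has real part `-(N + 1/2)`, half-way between poles,
and the integrable weight comes from `Γ(z/2)`. Condition `hN`, true for large `N`, says that `1 - Re
((n - z)/2)` is positive, as the reflected bound for the denominator requires. -/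
lemma norm_integral_eigenMellin_right_le (hs0 : 0 < s) (hs : s < 1 / 2) (hr : 0 < r)
    (hν : 0 < 2 * s * ν + n) {N : ℕ} (hN : 0 < s * ν + 1 + s / 2 + s * N) :
    ‖∫ y : ℝ, (r : ℂ) ^ (-(((2 * s * ν + n + 2 * s * (N + 1 / 2) : ℝ) : ℂ) + y * Complex.I)) *
        eigenMellin n s ν (((2 * s * ν + n + 2 * s * (N + 1 / 2) : ℝ) : ℂ) + y * Complex.I)‖ ≤
      (2 / r) ^ (2 * s * ν + n + s) *
        (∫ y : ℝ, ((s * ν + n / 2) ^ 2 + (y / 2) ^ 2)⁻¹) *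
        (Real.Gamma (s * ν + n / 2 + s / 2 + 2 + s * N) * Real.Gamma (s * ν + 1 + s / 2 + s * N) /
          Real.Gamma (3 / 2 + N) * ((2 / r) ^ (2 * s)) ^ N) := by
  set X0 := s * ν + n / 2 with hX0
  have hX0pos : 0 < X0 := by rw [hX0]; linarith
  have hint : Integrable fun y : ℝ => (X0 ^ 2 + (y / 2) ^ 2)⁻¹ :=
    (integrable_inv_sq_add_sq hX0pos.ne').comp_div two_ne_zero
  have hG1 : 0 < Real.Gamma (3 / 2 + N) := Real.Gamma_pos_of_pos (by positivity)
  have hN0 : (0 : ℝ) ≤ N := N.cast_nonneg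
  set t : ℝ := (2 / r) ^ (2 * s * ν + n + s) *
    (Real.Gamma (X0 + s / 2 + 2 + s * N) * Real.Gamma (s * ν + 1 + s / 2 + s * N) /
          Real.Gamma (3 / 2 + N) * ((2 / r) ^ (2 * s)) ^ N) with ht
  have hbound : ∀ y : ℝ,
      ‖(r : ℂ) ^ (-(((2 * s * ν + n + 2 * s * (N + 1 / 2) : ℝ) : ℂ) + y * Complex.I)) *
        eigenMellin n s ν (((2 * s * ν + n + 2 * s * (N + 1 / 2) : ℝ) : ℂ) + y * Complex.I)‖ ≤
      t * (X0 ^ 2 + (y / 2) ^ 2)⁻¹ := by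
    intro y
    set z : ℂ := ((2 * s * ν + n + 2 * s * (N + 1 / 2) : ℝ) : ℂ) + y * Complex.I with hz
    have hzre : z.re = 2 * s * ν + n + 2 * s * (N + 1 / 2) := by
      simp only [hz, Complex.add_re, Complex.ofReal_re, Complex.re_ofReal_mul, Complex.I_re,
        mul_zero, add_zero]
    have hzim : z.im = y := by
      simp only [hz, Complex.add_im, Complex.ofReal_im, Complex.im_ofReal_mul, Complex.I_im,
        mul_one, zero_add]
    have b1 : ‖(r : ℂ) ^ (-z)‖ * ‖(2 : ℂ) ^ z‖ =
        (2 / r) ^ (2 * s * ν + n + s) * ((2 / r) ^ (2 * s)) ^ N := by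
      have h2 := Complex.norm_cpow_eq_rpow_re_of_pos (x := 2) two_pos z
      rw [Complex.ofReal_ofNat] at h2
      rw [h2, Complex.norm_cpow_eq_rpow_re_of_pos hr, Complex.neg_re,
        Real.rpow_neg hr.le, mul_comm, ← div_eq_mul_inv, ← Real.div_rpow two_pos.le hr.le,
        ← Real.rpow_natCast, ← Real.rpow_mul (by positivity), ← Real.rpow_add (by positivity), hzre]
      congr 1
      ring
    have hc : 0 < √(Real.cosh (Real.pi * (y / (2 * s)))) := Real.sqrt_pos.2 (Real.cosh_pos _)
    have b2 : ‖Complex.Gamma (ν + (n - z) / (2 * s))‖ ≤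
        Real.pi / Real.Gamma (3 / 2 + N) / √(Real.cosh (Real.pi * (y / (2 * s)))) := by
      have e1 : (ν + (n - z) / (2 * s) : ℂ).re = -(N + 1 / 2) := by
        rw [re_gammaArg hs0, hzre]; field_simp; ring
      have e2 : (ν + (n - z) / (2 * s) : ℂ).im = -(y / (2 * s)) := by
        have e0 : (ν + (n - z) / (2 * s) : ℂ) = ν + (n - z) / ((2 * s : ℝ) : ℂ) := by
          push_cast; rfl
        rw [e0, Complex.add_im, Complex.div_ofReal_im]
        simp [hzim, neg_div]
      have := Complex.norm_Gamma_mul_sqrt_cosh_le (w := ν + (n - z) / (2 * s))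
        (by rw [e1, mul_neg, Real.cos_neg, Complex.cos_pi_mul_nat_add_half])
        (by rw [e1]; linarith)
      rw [e1, e2, mul_neg, Real.cosh_neg] at this
      rw [le_div_iff₀ hc]
      rwa [show (1 : ℝ) - -(N + 1 / 2) = 3 / 2 + N by ring] at this
    have b3 : ‖Complex.Gamma ((n - z) / 2)‖⁻¹ ≤
        Real.Gamma (s * ν + 1 + s / 2 + s * N) * √(Real.cosh (Real.pi * (y / (2 * s)))) /
          Real.pi := by
      have e1 : 1 - ((n - z) / 2).re = s * ν + 1 + s / 2 + s * N := by simp [hzre]; ring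
      have e2 : ((n - z) / 2).im = -(s * (y / (2 * s))) := by
        simp [hzim]; field_simp
      have := norm_inv_Gamma_le (w := (n - z) / 2) (by linarith)
      rw [e1, e2, mul_neg, Real.cosh_neg] at this
      refine this.trans ?_
      have hg := Real.Gamma_pos_of_pos hN
      gcongr
      exact cosh_mul_le_sqrt_cosh hs0 hs.le _
    have b5 : ‖Complex.Gamma (z / 2)‖ ≤
        Real.Gamma (X0 + s / 2 + 2 + s * N) * (X0 ^ 2 + (y / 2) ^ 2)⁻¹ := by
      have e1 : (z / 2).re = X0 + s / 2 + s * N := by simp [hzre, hX0]; ring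
      have e2 : (z / 2).im = y / 2 := by simp [hzim]
      have hpos : 0 < X0 + s / 2 + s * N := by positivity
      have := Complex.norm_Gamma_mul_le (z := z / 2) (by rw [e1]; exact hpos)
      rw [e1, e2] at this
      rw [← div_eq_mul_inv, le_div_iff₀ (by positivity)]
      refine le_trans ?_ (this.trans (le_of_eq ?_))
      · gcongr
        have : 0 ≤ s / 2 + s * N := by positivity
        linarith
      · congr 1; ring
    have hg := Real.Gamma_pos_of_pos hN
    calc ‖(r : ℂ) ^ (-z) * eigenMellin n s ν z‖
        = (‖(r : ℂ) ^ (-z)‖ * ‖(2 : ℂ) ^ z‖) * ‖Complex.Gamma (ν + (n - z) / (2 * s))‖ *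
          ‖Complex.Gamma (z / 2)‖ * ‖Complex.Gamma ((n - z) / 2)‖⁻¹ := by
          rw [eigenMellin]; simp only [norm_mul, norm_div]; ring
      _ ≤ ((2 / r) ^ (2 * s * ν + n + s) * ((2 / r) ^ (2 * s)) ^ N) *
          (Real.pi / Real.Gamma (3 / 2 + N) / √(Real.cosh (Real.pi * (y / (2 * s))))) *
          (Real.Gamma (X0 + s / 2 + 2 + s * N) * (X0 ^ 2 + (y / 2) ^ 2)⁻¹) *
          (Real.Gamma (s * ν + 1 + s / 2 + s * N) * √(Real.cosh (Real.pi * (y / (2 * s)))) /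
          Real.pi) := by
          have hg' : 0 < Real.Gamma (X0 + s / 2 + 2 + s * N) :=
            Real.Gamma_pos_of_pos (by positivity)
          rw [b1]; gcongr
      _ = _ := by
        rw [ht]
        have := Real.pi_pos
        field_simp
  refine (norm_integral_le_of_norm_le (hint.const_mul t) (ae_of_all _ hbound)).trans (le_of_eq ?_)
  rw [integral_const_mul, ht]
  ring

/-- Reflection moves the denominator, whose argument tends to `-∞`, into the numerator as `Γ(1 + sν
+ sj)`. The bound is needed only for large `j`. -/
lemma summable_foxWrightTerm_right (hs0 : 0 < s) (hs : s < 1 / 2)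
    (hν : 0 < 2 * s * ν + n) {X : ℝ} (hX : 0 ≤ X) :
    Summable (foxWrightTerm ((s * ν + n / 2 : ℝ) : ℂ) (s : ℂ) ((-(s * ν) : ℝ) : ℂ)
      ((-s : ℝ) : ℂ) ((-X : ℝ) : ℂ)) := by
  have h := (summable_Gamma_mul_Gamma_div_Gamma (A := s * ν + n / 2) (B := 1) (D := 1 + s * ν)
      hX hs0 hs).mul_left (1 / Real.pi)
  refine Summable.of_norm_bounded_eventually_nat h ?_
  filter_upwards [eventually_add_mul_nat_pos (1 + s * ν) hs0] with j hj
  have e1 : (((s * ν + n / 2 : ℝ) : ℂ) + s * j) = ((s * ν + n / 2 + s * j : ℝ) : ℂ) := by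
    push_cast; ring
  have e2 : (((-(s * ν) : ℝ) : ℂ) + ((-s : ℝ) : ℂ) * j) = ((-(s * ν) - s * j : ℝ) : ℂ) := by
    push_cast; ring
  have e3 : Real.Gamma (1 + (j : ℝ)) = j.factorial := by
    rw [add_comm, Real.Gamma_nat_eq_factorial]
  have hpos : 0 < s * ν + n / 2 + s * j := by
    have : 0 ≤ s * j := by positivity
    linarith
  have hg := Real.Gamma_pos_of_pos hpos
  have hb := norm_inv_Gamma_le (w := ((-(s * ν) - s * j : ℝ) : ℂ))
    (by rw [Complex.ofReal_re]; linarith)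
  rw [Complex.ofReal_re, Complex.ofReal_im, mul_zero, Real.cosh_zero, mul_one] at hb
  rw [foxWrightTerm, e1, e2, Complex.Gamma_ofReal (s * ν + n / 2 + s * j), norm_mul, norm_div,
    norm_div, norm_pow, Complex.norm_real, Complex.norm_real, Complex.norm_natCast,
    Real.norm_of_nonneg hg.le, norm_neg, Real.norm_of_nonneg hX, e3, div_eq_mul_inv (Real.Gamma _)]
  calc _ ≤ Real.Gamma (s * ν + n / 2 + s * j) * (Real.Gamma (1 - (-(s * ν) - s * j)) / Real.pi) *
        (X ^ j / j.factorial) := by gcongr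
    _ = _ := by
      rw [show 1 - (-(s * ν) - s * (j : ℝ)) = 1 + s * ν + s * j by ring]
      ring

/-- The inverse Mellin transform as the sum of the residues at `z = 2sν + n + 2sj`. -/
lemma mellinInv_eigenMellin_right (hs0 : 0 < s) (hs : s < 1 / 2) (hr : 0 < r)
    {σ : ℝ} (h0 : 0 < σ) (h1 : σ < 2 * s * ν + n) :
    mellinInv σ (eigenMellin n s ν) r =
      ((2 * s * (2 / r) ^ (2 * s * ν + n) : ℝ) : ℂ) *
        foxWright ((s * ν + n / 2 : ℝ) : ℂ) (s : ℂ) ((-(s * ν) : ℝ) : ℂ) ((-s : ℝ) : ℂ)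
          ((-(2 / r) ^ (2 * s) : ℝ) : ℂ) := by
  have hs1 : s ≤ 1 := by linarith
  have hν : 0 < 2 * s * ν + n := h0.trans h1
  have hX : (0 : ℝ) ≤ (2 / r) ^ (2 * s) := by positivity
  set c : ℕ → ℂ := fun j => ((2 * s * (2 / r) ^ (2 * s * ν + n) : ℝ) : ℂ) *
    foxWrightTerm ((s * ν + n / 2 : ℝ) : ℂ) (s : ℂ) ((-(s * ν) : ℝ) : ℂ) ((-s : ℝ) : ℂ)
      ((-(2 / r) ^ (2 * s) : ℝ) : ℂ) j with hc
  set F : ℝ → ℂ := fun b => ∫ y : ℝ, (r : ℂ) ^ (-(b + y * Complex.I)) *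
    eigenMellin n s ν (b + y * Complex.I) with hF
  have hsum : Summable c := (summable_foxWrightTerm_right hs0 hs hν hX).mul_left _
  have hstep : ∀ N : ℕ, F σ = 2 * Real.pi * (∑ j ∈ Finset.range (N + 1), c j) +
      F (2 * s * ν + n + 2 * s * (N + 1 / 2)) := by
    intro N
    induction N with
    | zero =>
      have := integral_eigenMellin_sub_right hs0 hs1 hr 0 h0 (by simpa using h1) (Or.inl rfl)
      simp only [zero_add, Finset.sum_range_one, hF, hc]
      linear_combination -this
    | succ N ih =>
      have hN0 : 0 ≤ s * N := by positivity
      have := integral_eigenMellin_sub_right (n := n) (s := s) (ν := ν) hs0 hs1 hr (N + 1)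
        (a := 2 * s * ν + n + 2 * s * (N + 1 / 2)) (by linarith) (by push_cast; linarith)
        (Or.inr (by push_cast; linarith))
      rw [Finset.sum_range_succ, mul_add, ih]
      simp only [hF, hc] at this ⊢
      linear_combination -this
  have hrem : Filter.Tendsto (fun N : ℕ => F (2 * s * ν + n + 2 * s * (N + 1 / 2))) Filter.atTop
      (nhds 0) := by
    have hz := (summable_Gamma_mul_Gamma_div_Gamma (A := s * ν + n / 2 + s / 2 + 2)
      (B := 3 / 2) (D := s * ν + 1 + s / 2) hX hs0 hs).tendsto_atTop_zero.const_mul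
      ((2 / r) ^ (2 * s * ν + n + s) * (∫ y : ℝ, ((s * ν + n / 2) ^ 2 + (y / 2) ^ 2)⁻¹))
    rw [mul_zero] at hz
    refine squeeze_zero_norm' ?_ hz
    filter_upwards [eventually_add_mul_nat_pos (s * ν + 1 + s / 2) hs0] with N hN
    exact norm_integral_eigenMellin_right_le hs0 hs hr hν hN
  have hlim : Filter.Tendsto (fun N : ℕ => 2 * Real.pi * (∑ j ∈ Finset.range (N + 1), c j))
      Filter.atTop (nhds (F σ - 0)) :=
    (tendsto_const_nhds.sub hrem).congr fun N => by rw [hstep N]; ring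
  have hlim2 := (hsum.hasSum.tendsto_sum_nat.comp (Filter.tendsto_add_atTop_nat 1)).const_mul
    (2 * Real.pi : ℂ)
  have heq := tendsto_nhds_unique hlim hlim2
  have hpi : (Real.pi : ℂ) ≠ 0 := by exact_mod_cast Real.pi_ne_zero
  have hval : mellinInv σ (eigenMellin n s ν) r = ((1 / (2 * Real.pi) : ℝ) : ℂ) * F σ := by
    rw [mellinInv, Complex.real_smul]
    rfl
  have hcs : ∑' j, c j = ((2 * s * (2 / r) ^ (2 * s * ν + n) : ℝ) : ℂ) *
      foxWright ((s * ν + n / 2 : ℝ) : ℂ) (s : ℂ) ((-(s * ν) : ℝ) : ℂ) ((-s : ℝ) : ℂ)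
        ((-(2 / r) ^ (2 * s) : ℝ) : ℂ) := by
    rw [foxWright, ← tsum_mul_left]
  rw [hval, ← sub_zero (F σ), heq, ← hcs, ← mul_assoc]
  have : ((1 / (2 * Real.pi) : ℝ) : ℂ) * (2 * Real.pi) = 1 := by
    push_cast
    field_simp
  rw [this, one_mul]

end Right

/-! ### The hypergeometric equation and its regular solution at the origin. -/

section Hypergeometric

lemma coeff_eq_zero_of_hasSum_zero {R : ℝ} (hR : 0 < R) {a : ℕ → ℂ}
    (h : ∀ z ∈ Metric.ball (0 : ℂ) R, HasSum (fun k => a k * z ^ k) 0) (k : ℕ) : a k = 0 := by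
  have hp : HasFPowerSeriesOnBall (fun _ : ℂ => (0 : ℂ))
      (FormalMultilinearSeries.ofScalars ℂ a) 0 (ENNReal.ofReal R) := by
    refine ⟨?_, by simpa using hR, ?_⟩
    · refine ENNReal.le_of_forall_nnreal_lt fun ρ hρ => ?_
      have hρR : (ρ : ℝ) < R := by
        rw [ENNReal.ofReal, ENNReal.coe_lt_coe] at hρ
        have := NNReal.coe_lt_coe.2 hρ
        rwa [Real.coe_toNNReal _ hR.le] at this
      have hs := (h (ρ : ℝ) (by simpa using hρR)).summable.norm
      refine FormalMultilinearSeries.le_radius_of_summable_norm _ ?_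
      refine hs.congr fun k => ?_
      rw [FormalMultilinearSeries.ofScalars_norm]
      simp
    · intro y hy
      have hy' : y ∈ Metric.ball (0 : ℂ) R := by
        rw [← Metric.eball_ofReal]; exact hy
      simpa [FormalMultilinearSeries.ofScalars_apply_eq, mul_comm] using h y hy'
  have := hp.hasFPowerSeriesAt.eq_zero
  have h2 := congrFun this k
  rw [FormalMultilinearSeries.zero_apply, FormalMultilinearSeries.ofScalars_eq_zero] at h2
  exact h2

lemma hasSum_shift {a : ℕ → ℂ} {z s : ℂ} (h : HasSum (fun k => a k * z ^ k) s) :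
    HasSum (fun k : ℕ => (if k = 0 then 0 else a (k - 1)) * z ^ k) (z * s) := by
  rw [← hasSum_nat_add_iff' 1]
  simp only [Nat.succ_ne_zero, Finset.sum_range_one, if_true, zero_mul, sub_zero, if_false,
    Nat.add_sub_cancel]
  refine (h.mul_left z).congr_fun ?_
  intro k
  ring

/-- The Taylor coefficients of the hypergeometric differential operator applied to `g`. -/
lemma hasSum_hypergeometric_operator {R : ℝ} {g g1 g2 : ℂ → ℂ}
    (hg : ∀ z ∈ Metric.ball (0 : ℂ) R, HasDerivAt g (g1 z) z)
    (hg1 : ∀ z ∈ Metric.ball (0 : ℂ) R, HasDerivAt g1 (g2 z) z) (α β c : ℂ) :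
    ∃ a : ℕ → ℂ, ∀ z ∈ Metric.ball (0 : ℂ) R, HasSum (fun k => a k * z ^ k) (g z) ∧
      HasSum (fun k : ℕ => ((k + 1) * (k + c) * a (k + 1) - (k + α) * (k + β) * a k) * z ^ k)
        (z * (1 - z) * g2 z + (c - (α + β + 1) * z) * g1 z - α * β * g z) := by
  refine ⟨fun k => (k.factorial : ℂ)⁻¹ * iteratedDeriv k g 0, fun z hz => ?_⟩
  have d0 : DifferentiableOn ℂ g (Metric.ball 0 R) := fun w hw =>
    (hg w hw).differentiableAt.differentiableWithinAt
  have e1 : Set.EqOn (deriv g) g1 (Metric.ball 0 R) := fun w hw => (hg w hw).deriv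
  have e2 : Set.EqOn (deriv (deriv g)) g2 (Metric.ball 0 R) := fun w hw => by
    have : deriv g =ᶠ[nhds w] g1 := Filter.eventuallyEq_of_mem (Metric.isOpen_ball.mem_nhds hw) e1
    rw [this.deriv_eq]
    exact (hg1 w hw).deriv
  have d1 : DifferentiableOn ℂ (deriv g) (Metric.ball 0 R) := d0.deriv Metric.isOpen_ball
  have d2 : DifferentiableOn ℂ (deriv (deriv g)) (Metric.ball 0 R) := d1.deriv Metric.isOpen_ball
  have t0 := Complex.hasSum_taylorSeries_on_ball d0 hz
  have t1 := Complex.hasSum_taylorSeries_on_ball d1 hz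
  have t2 := Complex.hasSum_taylorSeries_on_ball d2 hz
  rw [e1 hz] at t1
  rw [e2 hz] at t2
  simp only [sub_zero, smul_eq_mul] at t0 t1 t2
  set a : ℕ → ℂ := fun k => (k.factorial : ℂ)⁻¹ * iteratedDeriv k g 0 with ha
  have hfs : ∀ k : ℕ, ((k + 1).factorial : ℂ)⁻¹ * (k + 1) = (k.factorial : ℂ)⁻¹ := by
    intro k
    have h1 : (k.factorial : ℂ) ≠ 0 := by exact_mod_cast k.factorial_ne_zero
    have h2 : ((k : ℂ) + 1) ≠ 0 := by exact_mod_cast k.succ_ne_zero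
    rw [Nat.factorial_succ]
    push_cast
    field_simp
  have s0 : HasSum (fun k => a k * z ^ k) (g z) := by
    refine t0.congr_fun ?_
    intro k; simp only [ha]; ring
  have s1 : HasSum (fun k : ℕ => ((k + 1) * a (k + 1)) * z ^ k) (g1 z) := by
    refine t1.congr_fun ?_
    intro k
    simp only [ha, iteratedDeriv_succ']
    rw [← hfs k]; ring
  have s2 : HasSum (fun k : ℕ => ((k + 1) * (k + 2) * a (k + 2)) * z ^ k) (g2 z) := by
    refine t2.congr_fun ?_
    intro k
    simp only [ha, iteratedDeriv_succ']
    have := hfs (k + 1)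
    rw [← hfs k, ← this]; push_cast; ring
  refine ⟨s0, ?_⟩
  have u1 := hasSum_shift s1
  have u2 := hasSum_shift s2
  have u3 := hasSum_shift u2
  have key := (((u2.sub u3).add (s1.mul_left c)).sub (u1.mul_left (α + β + 1))).sub
    (s0.mul_left (α * β))
  have hval : z * (1 - z) * g2 z + (c - (α + β + 1) * z) * g1 z - α * β * g z =
      z * g2 z - z * (z * g2 z) + c * g1 z - (α + β + 1) * (z * g1 z) - α * β * g z := by ring
  rw [hval]
  refine key.congr_fun ?_
  intro k
  match k with
  | 0 => simp
  | 1 => simp; ring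
  | k + 2 => simp; ring

/-- The hypergeometric differential equation determines the Taylor coefficients at `0` up to a
factor. -/
lemma coeff_eq_ordinaryHypergeometricCoefficient {a : ℕ → ℂ} {α β c : ℂ}
    (hc : ∀ k : ℕ, (k : ℂ) ≠ -c) (h0 : a 0 = 1)
    (h : ∀ k : ℕ, (k + 1) * (k + c) * a (k + 1) - (k + α) * (k + β) * a k = 0) (k : ℕ) :
    a k = ordinaryHypergeometricCoefficient α β c k := by
  induction k with
  | zero => simp [ordinaryHypergeometricCoefficient, h0]
  | succ k ih =>
    have hk : ((k : ℂ) + c) ≠ 0 := fun h' => hc k (eq_neg_of_add_eq_zero_left h')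
    have hk1 : ((k : ℂ) + 1) ≠ 0 := by exact_mod_cast k.succ_ne_zero
    have h1 : a (k + 1) = (k + α) * (k + β) / ((k + 1) * (k + c)) * a k := by
      rw [div_mul_eq_mul_div, eq_div_iff (mul_ne_zero hk1 hk)]
      linear_combination h k
    rw [h1, ih]
    simp only [ordinaryHypergeometricCoefficient, ascPochhammer_succ_eval, Nat.factorial_succ,
      mul_inv]
    push_cast
    rw [add_comm c (k : ℂ)]
    field_simp
    ring

/-- The radius is infinite if the series terminates and `1` otherwise. -/
lemma one_le_radius_ordinaryHypergeometricSeries (α β : ℂ) {c : ℂ} (hc : ∀ k : ℕ, (k : ℂ) ≠ -c) :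
    1 ≤ (ordinaryHypergeometricSeries ℂ α β c).radius := by
  by_cases h1 : ∃ k : ℕ, (k : ℂ) = -α
  · obtain ⟨k, hk⟩ := h1
    obtain rfl : α = -k := by rw [hk, neg_neg]
    rw [ordinaryHypergeometric_radius_top_of_neg_nat₁]
    exact le_top
  by_cases h2 : ∃ k : ℕ, (k : ℂ) = -β
  · obtain ⟨k, hk⟩ := h2
    obtain rfl : β = -k := by rw [hk, neg_neg]
    rw [ordinaryHypergeometric_radius_top_of_neg_nat₂]
    exact le_top
  rw [ordinaryHypergeometricSeries_radius_eq_one]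
  exact fun k => ⟨fun h => h1 ⟨k, h⟩, fun h => h2 ⟨k, h⟩, hc k⟩

lemma hasFPowerSeriesOnBall_ordinaryHypergeometric (α β : ℂ) {c : ℂ}
    (hc : ∀ k : ℕ, (k : ℂ) ≠ -c) :
    HasFPowerSeriesOnBall (ordinaryHypergeometric α β c : ℂ → ℂ)
      (ordinaryHypergeometricSeries ℂ α β c) 0 1 :=
  ((ordinaryHypergeometricSeries ℂ α β c).hasFPowerSeriesOnBall (zero_lt_one.trans_le
    (one_le_radius_ordinaryHypergeometricSeries α β hc))).mono zero_lt_one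
    (one_le_radius_ordinaryHypergeometricSeries α β hc)

lemma hasSum_ordinaryHypergeometric (α β : ℂ) {c : ℂ} (hc : ∀ k : ℕ, (k : ℂ) ≠ -c) {z : ℂ}
    (hz : z ∈ Metric.ball (0 : ℂ) 1) :
    HasSum (fun k => ordinaryHypergeometricCoefficient α β c k * z ^ k)
      (ordinaryHypergeometric α β c z) := by
  have hz' : z ∈ Metric.eball (0 : ℂ) 1 := by
    rw [← ENNReal.ofReal_one, Metric.eball_ofReal]; exact hz
  have := (hasFPowerSeriesOnBall_ordinaryHypergeometric α β hc).hasSum hz'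
  simpa [ordinaryHypergeometricSeries, FormalMultilinearSeries.ofScalars_apply_eq, mul_comm]
    using this

lemma differentiableOn_ordinaryHypergeometric (α β : ℂ) {c : ℂ} (hc : ∀ k : ℕ, (k : ℂ) ≠ -c) :
    DifferentiableOn ℂ (ordinaryHypergeometric α β c : ℂ → ℂ) (Metric.ball 0 1) := by
  have := (hasFPowerSeriesOnBall_ordinaryHypergeometric α β hc).differentiableOn
  rwa [← ENNReal.ofReal_one, Metric.eball_ofReal] at this

/-- The hypergeometric differential equation. -/
lemma ordinaryHypergeometric_ode (α β : ℂ) {c : ℂ} (hc : ∀ k : ℕ, (k : ℂ) ≠ -c) :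
    ∃ W1 W2 : ℂ → ℂ, ∀ z ∈ Metric.ball (0 : ℂ) 1,
      HasDerivAt (ordinaryHypergeometric α β c) (W1 z) z ∧ HasDerivAt W1 (W2 z) z ∧
      z * (1 - z) * W2 z + (c - (α + β + 1) * z) * W1 z -
        α * β * ordinaryHypergeometric α β c z = 0 := by
  have d0 := differentiableOn_ordinaryHypergeometric α β hc
  have d1 := d0.deriv Metric.isOpen_ball
  have hd0 : ∀ z ∈ Metric.ball (0 : ℂ) 1, HasDerivAt (ordinaryHypergeometric α β c : ℂ → ℂ)
      (deriv (ordinaryHypergeometric α β c : ℂ → ℂ) z) z := fun z hz =>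
    (d0.differentiableAt (Metric.isOpen_ball.mem_nhds hz)).hasDerivAt
  have hd1 : ∀ z ∈ Metric.ball (0 : ℂ) 1, HasDerivAt (deriv (ordinaryHypergeometric α β c : ℂ → ℂ))
      (deriv (deriv (ordinaryHypergeometric α β c : ℂ → ℂ)) z) z := fun z hz =>
    (d1.differentiableAt (Metric.isOpen_ball.mem_nhds hz)).hasDerivAt
  refine ⟨_, _, fun z hz => ⟨hd0 z hz, hd1 z hz, ?_⟩⟩
  obtain ⟨a, ha⟩ := hasSum_hypergeometric_operator hd0 hd1 α β c
  have hcoef : ∀ k, a k = ordinaryHypergeometricCoefficient α β c k := fun k => by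
    refine sub_eq_zero.1 (coeff_eq_zero_of_hasSum_zero one_pos (a := fun k =>
      a k - ordinaryHypergeometricCoefficient α β c k) (fun w hw => ?_) k)
    have := (ha w hw).1.sub (hasSum_ordinaryHypergeometric α β hc hw)
    rw [sub_self] at this
    simpa only [sub_mul] using this
  refine (ha z hz).2.unique ?_
  have hz0 : ∀ k : ℕ, (((k : ℂ) + 1) * (k + c) * a (k + 1) - (k + α) * (k + β) * a k) = 0 := by
    intro k
    have hk : ((k : ℂ) + c) ≠ 0 := fun h' => hc k (eq_neg_of_add_eq_zero_left h')
    have hk1 : ((k : ℂ) + 1) ≠ 0 := by exact_mod_cast k.succ_ne_zero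
    rw [hcoef, hcoef]
    simp only [ordinaryHypergeometricCoefficient, ascPochhammer_succ_eval, Nat.factorial_succ,
      mul_inv]
    push_cast
    rw [add_comm c (k : ℂ)]
    field_simp
    ring
  simp only [hz0, zero_mul]
  exact hasSum_zero

/-- A solution of the hypergeometric differential equation that is regular at `0` is the
hypergeometric series. -/
lemma eq_ordinaryHypergeometric_of_ode {R : ℝ} (hR : R ≤ 1) {α β c : ℂ}
    (hc : ∀ k : ℕ, (k : ℂ) ≠ -c) {g g1 g2 : ℂ → ℂ}
    (hg : ∀ z ∈ Metric.ball (0 : ℂ) R, HasDerivAt g (g1 z) z)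
    (hg1 : ∀ z ∈ Metric.ball (0 : ℂ) R, HasDerivAt g1 (g2 z) z)
    (hode : ∀ z ∈ Metric.ball (0 : ℂ) R,
      z * (1 - z) * g2 z + (c - (α + β + 1) * z) * g1 z - α * β * g z = 0)
    (h0 : g 0 = 1) {z : ℂ} (hz : z ∈ Metric.ball (0 : ℂ) R) :
    g z = ordinaryHypergeometric α β c z := by
  have hRpos : 0 < R := (norm_nonneg z).trans_lt (by simpa using hz)
  obtain ⟨a, ha⟩ := hasSum_hypergeometric_operator hg hg1 α β c
  have hrec := coeff_eq_zero_of_hasSum_zero hRpos fun w hw => by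
    simpa only [hode w hw] using (ha w hw).2
  have ha0 : a 0 = 1 := by
    have h1 := (ha 0 (by simpa)).1
    have h2 := hasSum_single (f := fun k => a k * (0 : ℂ) ^ k) 0 fun k hk => by simp [hk]
    have := h1.unique h2
    simpa [h0] using this.symm
  have hcoef := coeff_eq_ordinaryHypergeometricCoefficient hc ha0 hrec
  refine (ha z hz).1.unique ?_
  simp only [hcoef]
  exact hasSum_ordinaryHypergeometric α β hc (Metric.ball_subset_ball hR hz)

/-- Transformations of the hypergeometric function that respect the differential equation. -/
lemma mul_ordinaryHypergeometric_comp_eq {R : ℝ} (hR : R ≤ 1) {α β c α' β' c' : ℂ}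
    (hc : ∀ k : ℕ, (k : ℂ) ≠ -c) (hc' : ∀ k : ℕ, (k : ℂ) ≠ -c') {P p p' Z Z1 Z2 : ℂ → ℂ}
    (hP : ∀ y ∈ Metric.ball (0 : ℂ) R, HasDerivAt P (p y * P y) y)
    (hp : ∀ y ∈ Metric.ball (0 : ℂ) R, HasDerivAt p (p' y) y)
    (hZ : ∀ y ∈ Metric.ball (0 : ℂ) R, HasDerivAt Z (Z1 y) y)
    (hZ1 : ∀ y ∈ Metric.ball (0 : ℂ) R, HasDerivAt Z1 (Z2 y) y)
    (hmap : ∀ y ∈ Metric.ball (0 : ℂ) R, Z y ∈ Metric.ball (0 : ℂ) 1)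
    (hode : ∀ y ∈ Metric.ball (0 : ℂ) R, ∀ w w1 w2 : ℂ,
      Z y * (1 - Z y) * w2 + (c - (α + β + 1) * Z y) * w1 - α * β * w = 0 →
      y * (1 - y) * (Z1 y ^ 2 * w2 + (2 * p y * Z1 y + Z2 y) * w1 + (p y ^ 2 + p' y) * w) +
        (c' - (α' + β' + 1) * y) * (Z1 y * w1 + p y * w) - α' * β' * w = 0)
    (hP0 : P 0 = 1) (hZ0 : Z 0 = 0) {y : ℂ} (hy : y ∈ Metric.ball (0 : ℂ) R) :
    P y * ordinaryHypergeometric α β c (Z y) = ordinaryHypergeometric α' β' c' y := by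
  obtain ⟨W1, W2, hW⟩ := ordinaryHypergeometric_ode α β hc
  set W : ℂ → ℂ := ordinaryHypergeometric α β c with hWdef
  -- As `p` is the logarithmic derivative of `P`, the factor `P` comes out of both derivatives. What
  -- remains is the algebraic implication `hode` in the values of `W` and its two derivatives at `Z
  -- y`.
  refine eq_ordinaryHypergeometric_of_ode hR hc' (g := fun y => P y * W (Z y))
    (g1 := fun y => P y * (Z1 y * W1 (Z y) + p y * W (Z y)))
    (g2 := fun y => P y * (Z1 y ^ 2 * W2 (Z y) + (2 * p y * Z1 y + Z2 y) * W1 (Z y) +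
      (p y ^ 2 + p' y) * W (Z y))) ?_ ?_ ?_ ?_ hy
  · intro y hy
    have h1 := (hW _ (hmap y hy)).1.comp y (hZ y hy)
    refine ((hP y hy).mul h1).congr_deriv ?_
    simp only [Function.comp_apply]
    ring
  · intro y hy
    have h1 := (hW _ (hmap y hy)).1.comp y (hZ y hy)
    have h2 := (hW _ (hmap y hy)).2.1.comp y (hZ y hy)
    refine ((hP y hy).mul (((hZ1 y hy).mul h2).add ((hp y hy).mul h1))).congr_deriv ?_
    simp only [Function.comp_apply, Pi.add_apply, Pi.mul_apply]
    ring
  · intro y hy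
    linear_combination P y * hode y hy _ _ _ (hW _ (hmap y hy)).2.2
  · simp only [hP0, hZ0, hWdef, ordinaryHypergeometric_zero, one_mul]

end Hypergeometric

/-! ### Quadratic and Pfaff transformations, the continuation, and the Legendre form. -/

section Hypergeometric

lemma one_add_mem_slitPlane {z : ℂ} (hz : ‖z‖ < 1) : 1 + z ∈ Complex.slitPlane := by
  refine Or.inl ?_
  have := Complex.abs_re_le_norm z
  have := neg_abs_le z.re
  simp
  linarith

lemma one_sub_mem_slitPlane {z : ℂ} (hz : ‖z‖ < 1) : 1 - z ∈ Complex.slitPlane := by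
  rw [sub_eq_add_neg]
  exact one_add_mem_slitPlane (by rwa [norm_neg])

/-- A quadratic transformation of the hypergeometric function. -/
lemma ordinaryHypergeometric_quadratic (a : ℂ) {c : ℂ} (hc : ∀ k : ℕ, (k : ℂ) ≠ -c) {q : ℂ}
    (hq : ‖q‖ < 1 / 8) :
    (1 + q) ^ (-(2 * a)) * ordinaryHypergeometric a (a + 1 / 2) c (4 * q / (1 + q) ^ 2) =
      ordinaryHypergeometric (2 * a) (2 * a - c + 1) c q := by
  have hne : ∀ y ∈ Metric.ball (0 : ℂ) (1 / 8), 1 + y ≠ 0 := fun y hy =>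
    Complex.slitPlane_ne_zero (one_add_mem_slitPlane (by
      have : ‖y‖ < 1 / 8 := by simpa using hy
      linarith))
  have hd : ∀ y : ℂ, HasDerivAt (fun y : ℂ => 1 + y) 1 y := fun y =>
    (hasDerivAt_id y).const_add 1
  -- On this disc `‖1 + y‖ ≥ 7/8`, which keeps `4y/(1 + y)²` inside the unit disc; the identity
  -- theorem later removes the restriction.
  refine mul_ordinaryHypergeometric_comp_eq (R := 1 / 8) (by norm_num) hc hc
    (P := fun y => (1 + y) ^ (-(2 * a))) (p := fun y => -(2 * a) / (1 + y))
    (p' := fun y => 2 * a / (1 + y) ^ 2) (Z := fun y => 4 * y / (1 + y) ^ 2)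
    (Z1 := fun y => 4 * (1 - y) / (1 + y) ^ 3) (Z2 := fun y => (8 * y - 16) / (1 + y) ^ 4)
    ?_ ?_ ?_ ?_ ?_ ?_ (by simp) (by simp) (by simpa using hq)
  · intro y hy
    have h1 : 1 + y ∈ Complex.slitPlane := one_add_mem_slitPlane (by
      have : ‖y‖ < 1 / 8 := by simpa using hy
      linarith)
    refine ((hd y).cpow_const h1).congr_deriv ?_
    rw [Complex.cpow_sub _ _ (hne y hy), Complex.cpow_one]
    field_simp
  · intro y hy
    have := hne y hy
    refine ((hasDerivAt_const y (-(2 * a))).div (hd y) this).congr_deriv ?_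
    field_simp
    ring
  · intro y hy
    have := hne y hy
    refine (((hasDerivAt_id y).const_mul 4).div ((hd y).pow 2) (pow_ne_zero 2 this)).congr_deriv ?_
    simp only [id, Pi.pow_apply]
    field_simp
    push_cast
    ring
  · intro y hy
    have := hne y hy
    refine ((((hasDerivAt_id y).const_sub 1).const_mul 4).div ((hd y).pow 3)
      (pow_ne_zero 3 this)).congr_deriv ?_
    simp only [id, Pi.pow_apply]
    field_simp
    push_cast
    ring
  · intro y hy
    have hy' : ‖y‖ < 1 / 8 := by simpa using hy
    have h1 : 7 / 8 ≤ ‖1 + y‖ := by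
      have := norm_sub_norm_le (1 : ℂ) (-y)
      rw [norm_one, norm_neg, sub_neg_eq_add] at this
      linarith
    rw [mem_ball_zero_iff, norm_div, norm_mul, norm_pow, div_lt_one (by positivity)]
    have : ‖(4 : ℂ)‖ = 4 := by simp
    rw [this]
    nlinarith
  · intro y hy w w1 w2 h
    have := hne y hy
    -- The transformed equation is the original one times `4(1 - y)/(1 + y)²`.
    have e : 4 * (1 - y) / (1 + y) ^ 2 * (4 * y / (1 + y) ^ 2 * (1 - 4 * y / (1 + y) ^ 2) * w2 +
      (c - (a + (a + 1 / 2) + 1) * (4 * y / (1 + y) ^ 2)) * w1 - a * (a + 1 / 2) * w) = 0 := by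
      rw [h, mul_zero]
    rw [← e]
    field_simp
    ring

/-- Pfaff's transformation of the hypergeometric function, near `0`. -/
lemma ordinaryHypergeometric_pfaff_of_norm_lt (a b : ℂ) {c : ℂ} (hc : ∀ k : ℕ, (k : ℂ) ≠ -c)
    {y : ℂ} (hy : ‖y‖ < 1 / 4) :
    (1 - y) ^ (-b) * ordinaryHypergeometric a b c (y / (y - 1)) =
      ordinaryHypergeometric (c - a) b c y := by
  have hsl : ∀ y ∈ Metric.ball (0 : ℂ) (1 / 4), 1 - y ∈ Complex.slitPlane := fun y hy => by
    have : ‖y‖ < 1 / 4 := by simpa using hy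
    exact one_sub_mem_slitPlane (by linarith)
  have hne : ∀ y ∈ Metric.ball (0 : ℂ) (1 / 4), 1 - y ≠ 0 := fun y hy =>
    Complex.slitPlane_ne_zero (hsl y hy)
  have hd : ∀ y : ℂ, HasDerivAt (fun y : ℂ => 1 - y) (-1) y := fun y =>
    (hasDerivAt_id y).const_sub 1
  have key := mul_ordinaryHypergeometric_comp_eq (R := 1 / 4) (α := a) (β := b) (α' := c - a)
    (β' := b) (by norm_num) hc hc
    (P := fun y => (1 - y) ^ (-b)) (p := fun y => b / (1 - y))
    (p' := fun y => b / (1 - y) ^ 2) (Z := fun y => -y / (1 - y))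
    (Z1 := fun y => -1 / (1 - y) ^ 2) (Z2 := fun y => -2 / (1 - y) ^ 3)
    ?_ ?_ ?_ ?_ ?_ ?_ (by simp) (by simp) (y := y) (by simpa using hy)
  · rw [← key]
    have e : -y / (1 - y) = y / (y - 1) := by rw [← neg_sub y 1, neg_div_neg_eq]
    simp only [e]
  · intro y hy
    refine ((hd y).cpow_const (hsl y hy)).congr_deriv ?_
    rw [Complex.cpow_sub _ _ (hne y hy), Complex.cpow_one]
    have := hne y hy
    field_simp
  · intro y hy
    have := hne y hy
    refine ((hasDerivAt_const y b).div (hd y) this).congr_deriv ?_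
    field_simp
    ring
  · intro y hy
    have := hne y hy
    refine ((hasDerivAt_id y).neg.div (hd y) this).congr_deriv ?_
    simp only [id, Pi.neg_apply]
    field_simp
    ring
  · intro y hy
    have := hne y hy
    refine ((hasDerivAt_const y (-1 : ℂ)).div ((hd y).pow 2) (pow_ne_zero 2 this)).congr_deriv ?_
    simp only [Pi.pow_apply]
    field_simp
    push_cast
    ring
  · intro y hy
    have hy' : ‖y‖ < 1 / 4 := by simpa using hy
    have h1 : 3 / 4 ≤ ‖1 - y‖ := by
      have := norm_sub_norm_le (1 : ℂ) y
      rw [norm_one] at this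
      linarith
    rw [mem_ball_zero_iff, norm_div, norm_neg, div_lt_one (by linarith)]
    linarith
  · intro y hy w w1 w2 h
    have := hne y hy
    have e : -1 / (1 - y) * (-y / (1 - y) * (1 - -y / (1 - y)) * w2 +
      (c - (a + b + 1) * (-y / (1 - y))) * w1 - a * b * w) = 0 := by
      rw [h, mul_zero]
    rw [← e]
    field_simp
    ring

/-- Pfaff's transformation of the hypergeometric function. -/
lemma ordinaryHypergeometric_pfaff (a b : ℂ) {c : ℂ} (hc : ∀ k : ℕ, (k : ℂ) ≠ -c)
    {y : ℂ} (hy : ‖y‖ < 1) (hy2 : y.re < 1 / 2) :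
    (1 - y) ^ (-b) * ordinaryHypergeometric a b c (y / (y - 1)) =
      ordinaryHypergeometric (c - a) b c y := by
  -- `Re z < 1/2` means `|z| < |z - 1|`, so both series converge on the convex set `D`, and the
  -- identity theorem spreads the local formula over it.
  set D : Set ℂ := Metric.ball 0 1 ∩ {z | z.re < 1 / 2} with hD
  have hDo : IsOpen D :=
    Metric.isOpen_ball.inter (isOpen_lt Complex.continuous_re continuous_const)
  have hDc : Convex ℝ D := (convex_ball _ _).inter (convex_halfSpace_re_lt _)
  have h0D : (0 : ℂ) ∈ D := by simp [hD]
  have hsl : ∀ z ∈ D, 1 - z ∈ Complex.slitPlane := fun z hz => by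
    have : z.re < 1 / 2 := hz.2
    refine Or.inl ?_
    simp
    linarith
  have hmaps : ∀ z ∈ D, z / (z - 1) ∈ Metric.ball (0 : ℂ) 1 := fun z hz => by
    have h1 : z - 1 ≠ 0 := by
      rw [← neg_ne_zero, neg_sub]
      exact Complex.slitPlane_ne_zero (hsl z hz)
    have h2 : z.re < 1 / 2 := hz.2
    rw [mem_ball_zero_iff, norm_div, div_lt_one (norm_pos_iff.2 h1)]
    refine lt_of_pow_lt_pow_left₀ 2 (norm_nonneg _) ?_
    rw [Complex.sq_norm, Complex.sq_norm, Complex.normSq_apply, Complex.normSq_apply]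
    simp
    nlinarith
  have hL : AnalyticOnNhd ℂ
      (fun y => (1 - y) ^ (-b) * ordinaryHypergeometric a b c (y / (y - 1))) D := by
    refine DifferentiableOn.analyticOnNhd (fun z hz => ?_) hDo
    refine DifferentiableAt.differentiableWithinAt (DifferentiableAt.mul ?_ ?_)
    · exact (by fun_prop : DifferentiableAt ℂ (fun y : ℂ => 1 - y) z).cpow_const (hsl z hz)
    · have h1 : z - 1 ≠ 0 := by
        rw [← neg_ne_zero, neg_sub]
        exact Complex.slitPlane_ne_zero (hsl z hz)
      refine DifferentiableAt.comp z (g := (ordinaryHypergeometric a b c : ℂ → ℂ))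
        ((differentiableOn_ordinaryHypergeometric a b hc).differentiableAt
          (Metric.isOpen_ball.mem_nhds (hmaps z hz))) ?_
      exact DifferentiableAt.div (by fun_prop) (by fun_prop) h1
  have hR : AnalyticOnNhd ℂ (ordinaryHypergeometric (c - a) b c : ℂ → ℂ) D :=
    ((differentiableOn_ordinaryHypergeometric (c - a) b hc).analyticOnNhd
      Metric.isOpen_ball).mono Set.inter_subset_left
  refine hL.eqOn_of_preconnected_of_eventuallyEq hR hDc.isPreconnected h0D ?_
    (show y ∈ D from ⟨by simpa using hy, hy2⟩)
  filter_upwards [Metric.ball_mem_nhds (0 : ℂ) (by norm_num : (0 : ℝ) < 1 / 4)] with w hw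
  exact ordinaryHypergeometric_pfaff_of_norm_lt a b hc (by simpa using hw)

/-- The analytic continuation of `₂F₁(a, a + 1/2; c; ·)` to the cut plane. -/
noncomputable def quadraticContinuation (a c w : ℂ) : ℂ :=
  ((1 + (1 - w) ^ (1 / 2 : ℂ)) / 2) ^ (-(2 * a)) *
    ordinaryHypergeometric (2 * a) (2 * a - c + 1) c
      ((1 - (1 - w) ^ (1 / 2 : ℂ)) / (1 + (1 - w) ^ (1 / 2 : ℂ)))

/-- The principal square root halves an argument lying in `(-π, π)`. -/
lemma re_cpow_half_pos {z : ℂ} (hz : z ∈ Complex.slitPlane) : 0 < (z ^ (1 / 2 : ℂ)).re := by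
  have hz0 := Complex.slitPlane_ne_zero hz
  rw [Complex.cpow_def_of_ne_zero hz0, Complex.exp_re]
  refine mul_pos (Real.exp_pos _) (Real.cos_pos_of_mem_Ioo ?_)
  have e : (Complex.log z * (1 / 2)).im = Complex.arg z / 2 := by
    have : Complex.log z * (1 / 2) = Complex.log z * ((1 / 2 : ℝ) : ℂ) := by push_cast; rfl
    rw [this, Complex.im_mul_ofReal, Complex.log_im]; ring
  rw [e]
  have h1 := Complex.neg_pi_lt_arg z
  have h2 := Complex.arg_le_pi z
  have h3 := (Complex.mem_slitPlane_iff_arg.1 hz).1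
  have h4 := lt_of_le_of_ne h2 h3
  constructor <;> linarith

lemma norm_one_sub_div_one_add_lt {t : ℂ} (ht : 0 < t.re) : ‖(1 - t) / (1 + t)‖ < 1 := by
  have h1 : 1 + t ≠ 0 := fun h => by
    have := congrArg Complex.re h
    simp at this
    linarith
  rw [norm_div, div_lt_one (norm_pos_iff.2 h1)]
  refine lt_of_pow_lt_pow_left₀ 2 (norm_nonneg _) ?_
  rw [Complex.sq_norm, Complex.sq_norm, Complex.normSq_apply, Complex.normSq_apply]
  simp
  nlinarith

/-- With `t = √(1 - w)` and `q = (1 - t)/(1 + t)` one has `w = 4q/(1 + q)²` and `1 + q = 2/(1 + t)`,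
so near `0` this is the quadratic transformation read backwards. Off the cut `Re t > 0`, and the
Cayley transform sends `t` to a point `q` of the unit disc. -/
lemma isGaussContinuation_quadraticContinuation (a : ℂ) {c : ℂ} (hc : ∀ k : ℕ, (k : ℂ) ≠ -c) :
    IsGaussContinuation a (a + 1 / 2) c (quadraticContinuation a c) := by
  have hopen : IsOpen cutPlane :=
    Complex.isOpen_slitPlane.preimage (by fun_prop : Continuous fun z : ℂ => 1 - z)
  have hball : Metric.ball (0 : ℂ) 1 ⊆ cutPlane := fun z hz => by
    exact one_sub_mem_slitPlane (by simpa using hz)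
  have ht : ∀ w ∈ cutPlane, 0 < ((1 - w) ^ (1 / 2 : ℂ)).re := fun w hw => re_cpow_half_pos hw
  have hdt : ∀ w ∈ cutPlane, DifferentiableAt ℂ (fun w : ℂ => (1 - w) ^ (1 / 2 : ℂ)) w :=
    fun w hw => (by fun_prop : DifferentiableAt ℂ (fun w : ℂ => 1 - w) w).cpow_const hw
  have hdq : ∀ w ∈ cutPlane, DifferentiableAt ℂ
      (fun w : ℂ => (1 - (1 - w) ^ (1 / 2 : ℂ)) / (1 + (1 - w) ^ (1 / 2 : ℂ))) w := by
    intro w hw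
    refine ((hdt w hw).const_sub 1).div ((hdt w hw).const_add 1) fun h => ?_
    have := congrArg Complex.re h
    rw [Complex.add_re, Complex.one_re, Complex.zero_re] at this
    linarith [ht w hw]
  have han : AnalyticOnNhd ℂ (quadraticContinuation a c) cutPlane := by
    refine DifferentiableOn.analyticOnNhd (fun w hw => ?_) hopen
    refine DifferentiableAt.differentiableWithinAt (DifferentiableAt.mul ?_ ?_)
    · refine (((hdt w hw).const_add 1).div_const 2).cpow_const (Or.inl ?_)
      have : ((1 + (1 - w) ^ (1 / 2 : ℂ)) / 2).re = (1 + ((1 - w) ^ (1 / 2 : ℂ)).re) / 2 := by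
        simp
      rw [this]
      linarith [ht w hw]
    · refine DifferentiableAt.comp w
        (g := (ordinaryHypergeometric (2 * a) (2 * a - c + 1) c : ℂ → ℂ))
        ((differentiableOn_ordinaryHypergeometric _ _ hc).differentiableAt
          (Metric.isOpen_ball.mem_nhds ?_)) (hdq w hw)
      rw [mem_ball_zero_iff]
      exact norm_one_sub_div_one_add_lt (ht w hw)
  refine ⟨han, ?_⟩
  have hF : AnalyticOnNhd ℂ (ordinaryHypergeometric a (a + 1 / 2) c : ℂ → ℂ) (Metric.ball 0 1) :=
    (differentiableOn_ordinaryHypergeometric _ _ hc).analyticOnNhd Metric.isOpen_ball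
  refine (han.mono hball).eqOn_of_preconnected_of_eventuallyEq hF
    (convex_ball (0 : ℂ) 1).isPreconnected (Metric.mem_ball_self one_pos) ?_
  have h0 : (0 : ℂ) ∈ cutPlane := hball (Metric.mem_ball_self one_pos)
  have htend := (hdq 0 h0).continuousAt.tendsto
  have hsmall := htend.eventually (Metric.ball_mem_nhds _ (by norm_num : (0 : ℝ) < 1 / 8))
  filter_upwards [hsmall, hopen.mem_nhds h0] with w hw hwc
  simp only [sub_zero, Complex.one_cpow, sub_self, zero_div] at hw
  set t := (1 - w) ^ (1 / 2 : ℂ) with htdef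
  set q := (1 - t) / (1 + t) with hq
  have htre : 0 < t.re := ht w hwc
  have h1t : 1 + t ≠ 0 := fun h => by
    have := congrArg Complex.re h
    simp at this
    linarith
  have ht2 : t ^ 2 = 1 - w := by
    rw [htdef, ← Complex.cpow_nat_mul]
    norm_num
  have h1q : 1 + q = ((1 + t) / 2)⁻¹ := by
    rw [hq]; field_simp; ring
  have hqw : 4 * q / (1 + q) ^ 2 = w := by
    rw [h1q, hq]
    field_simp
    linear_combination (-4) * ht2
  have hquad := ordinaryHypergeometric_quadratic a hc (q := q) (by simpa using hw)
  have hre : 0 < ((1 + t) / 2).re := by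
    simp
    linarith
  have harg : ((1 + t) / 2).arg ≠ Real.pi :=
    (Complex.mem_slitPlane_iff_arg.1 (Or.inl hre)).1
  have hne : ((1 + t) / 2) ^ (-(2 * a)) ≠ 0 := by
    rw [Ne, Complex.cpow_eq_zero_iff]
    rintro ⟨h, -⟩
    rw [h] at hre
    simp at hre
  rw [quadraticContinuation, ← htdef, ← hq, ← hquad, hqw, h1q, Complex.inv_cpow _ _ harg,
    ← mul_assoc, mul_inv_cancel₀ hne, one_mul]

lemma ofReal_ascPochhammer_eval (a : ℝ) (k : ℕ) :
    (((ascPochhammer ℝ k).eval a : ℝ) : ℂ) = (ascPochhammer ℂ k).eval (a : ℂ) := by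
  induction k with
  | zero => simp
  | succ k ih => simp [ascPochhammer_succ_eval, ih]

lemma ofReal_ordinaryHypergeometric (a b c x : ℝ) :
    ((ordinaryHypergeometric a b c x : ℝ) : ℂ) =
      ordinaryHypergeometric (a : ℂ) (b : ℂ) (c : ℂ) (x : ℂ) := by
  rw [ordinaryHypergeometric_eq_tsum, ordinaryHypergeometric_eq_tsum, Complex.ofReal_tsum]
  refine tsum_congr fun k => ?_
  simp only [smul_eq_mul]
  push_cast
  simp only [ofReal_ascPochhammer_eval]

lemma natCast_ne_neg_ofReal {c : ℝ} (hc : 0 < c) (k : ℕ) : (k : ℂ) ≠ -(c : ℂ) := fun h => by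
  have := congrArg Complex.re h
  simp at this
  have : (0 : ℝ) ≤ k := k.cast_nonneg
  linarith

/-- `₂F₁(a, a + 1/2; c; -r²)` in terms of the hypergeometric series of a Legendre function. -/
lemma gaussHypergeometric_neg_sq {a c r : ℝ} (hc : 0 < c) (hr : 0 < r) :
    gaussHypergeometric a (a + 1 / 2) c (-(r : ℂ) ^ 2) =
      (((1 / √(r ^ 2 + 1)) ^ (2 * a) * ((1 + 1 / √(r ^ 2 + 1)) / 2) ^ (1 - c) *
        ordinaryHypergeometric (c - 2 * a) (2 * a - c + 1) c ((1 - 1 / √(r ^ 2 + 1)) / 2) : ℝ) :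
          ℂ) := by
  have hcc := natCast_ne_neg_ofReal hc
  set t := √(r ^ 2 + 1) with ht
  have ht1 : 1 < t := Real.lt_sqrt_of_sq_lt (by nlinarith)
  have ht0 : 0 < t := by linarith
  have hw : -(r : ℂ) ^ 2 ∈ cutPlane := by
    refine Or.inl ?_
    have : (1 - -(r : ℂ) ^ 2) = ((1 + r ^ 2 : ℝ) : ℂ) := by push_cast; ring
    rw [this, Complex.ofReal_re]
    positivity
  have hroot : (1 - -(r : ℂ) ^ 2) ^ (1 / 2 : ℂ) = (t : ℂ) := by
    have : (1 - -(r : ℂ) ^ 2) = ((r ^ 2 + 1 : ℝ) : ℂ) := by push_cast; ring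
    rw [this, ht, Real.sqrt_eq_rpow, Complex.ofReal_cpow (by positivity)]
    norm_num
  rw [gaussHypergeometric_eq (isGaussContinuation_quadraticContinuation a hcc) hw,
    quadraticContinuation, hroot]
  set x := 1 / t with hx
  have hx0 : 0 < x := by positivity
  have hx1 : x < 1 := by rw [hx, div_lt_one ht0]; exact ht1
  -- Pfaff's map `y ↦ y/(y - 1)` sends the Legendre argument `(1 - x)/2` to the quadratic variable.
  have hy : (((1 - x) / 2 : ℝ) : ℂ) / ((((1 - x) / 2 : ℝ) : ℂ) - 1) = (1 - t) / (1 + t) := by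
    have e : ((((1 - x) / 2) / ((1 - x) / 2 - 1) : ℝ)) = (1 - t) / (1 + t) := by
      have h1 : (1 - x) / 2 - 1 ≠ 0 := by linarith
      have h2 : 1 + t ≠ 0 := by linarith
      rw [div_eq_div_iff h1 h2, hx]
      field_simp
      ring
    exact_mod_cast congrArg (fun u : ℝ => (u : ℂ)) e
  have hpf := ordinaryHypergeometric_pfaff (2 * a : ℂ) (2 * a - c + 1) hcc
    (y := (((1 - x) / 2 : ℝ) : ℂ))
    (by rw [Complex.norm_real, Real.norm_of_nonneg (by linarith)]; linarith)
    (by rw [Complex.ofReal_re]; linarith)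
  rw [hy] at hpf
  push_cast [ofReal_ordinaryHypergeometric]
  push_cast at hpf
  rw [← hpf, ← mul_assoc]
  congr 1
  have e1 : ((1 + t) / 2 : ℂ) = (((1 + t) / 2 : ℝ) : ℂ) := by push_cast; rfl
  have e2 : (1 - (1 - (x : ℂ)) / 2) = (((1 + x) / 2 : ℝ) : ℂ) := by push_cast; ring
  have e3 : (-(2 * a - c + 1) : ℂ) = ((-(2 * a - c + 1) : ℝ) : ℂ) := by push_cast; rfl
  have e4 : (-(2 * a) : ℂ) = ((-(2 * a) : ℝ) : ℂ) := by push_cast; rfl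
  rw [e1, e2, e3, e4, ← Complex.ofReal_cpow (by positivity), ← Complex.ofReal_cpow (by positivity),
    ← Complex.ofReal_mul, ← Complex.ofReal_mul]
  congr 1
  have e5 : (1 + t) / 2 = ((1 + x) / 2) / x := by rw [hx]; field_simp; ring
  rw [e5, Real.div_rpow (by positivity) hx0.le, Real.rpow_neg hx0.le]
  have h6 : ((1 + x) / 2) ^ (-(2 * a)) =
      ((1 + x) / 2) ^ (1 - c) * ((1 + x) / 2) ^ (-(2 * a - c + 1)) := by
    rw [← Real.rpow_add (by positivity)]; congr 1; ring
  rw [h6]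
  field_simp

end Hypergeometric

/-- The hypergeometric parameters already agree, as `1 - μ = n/2`; only powers are left to compare.
With `x = 1/√(r² + 1)`, they match through `r² (1 + x)/(1 - x) = ((1 + x)/x)²`. -/
lemma gaussHypergeometric_eq_legendreFun {n : ℕ} (hn : 1 ≤ n) (ν : ℝ) {r : ℝ} (hr : 0 < r) :
    (((2 : ℝ) ^ (-(((n : ℝ) - 2) / 2)) * Real.Gamma (n + ν) / Real.Gamma ((n : ℝ) / 2) : ℝ) : ℂ) *
        gaussHypergeometric ((n + ν) / 2) ((n + ν + 1) / 2) (n / 2) (-(r : ℂ) ^ 2) =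
      ((Real.Gamma (n + ν) * r ^ (-(((n : ℝ) - 2) / 2)) *
        √(r ^ 2 + 1) ^ (-((n : ℝ) / 2 + 1 + ν)) *
        legendreFun (-(((n : ℝ) - 2) / 2)) ((n : ℝ) / 2 + ν) (1 / √(r ^ 2 + 1)) : ℝ) : ℂ) := by
  have hn' : (1 : ℝ) ≤ n := by exact_mod_cast hn
  have h := gaussHypergeometric_neg_sq (a := (n + ν) / 2) (c := n / 2) (by linarith) hr
  have e1 : (((n + ν) / 2 : ℝ) : ℂ) = (n + ν) / 2 := by push_cast; rfl
  have e2 : ((n : ℂ) + ν) / 2 + 1 / 2 = (n + ν + 1) / 2 := by ring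
  have e3 : ((n / 2 : ℝ) : ℂ) = n / 2 := by push_cast; rfl
  rw [e1, e2, e3] at h
  rw [h, ← Complex.ofReal_mul]
  congr 1
  set t := √(r ^ 2 + 1) with ht
  have ht2 : t ^ 2 = r ^ 2 + 1 := Real.sq_sqrt (by positivity)
  have ht1 : 1 < t := Real.lt_sqrt_of_sq_lt (by nlinarith)
  have ht0 : 0 < t := by linarith
  set x := 1 / t with hx
  have hx0 : 0 < x := by positivity
  have hx1 : x < 1 := by rw [hx, div_lt_one ht0]; exact ht1
  have h1x : 0 < 1 - x := by linarith
  set κ := ((n : ℝ) - 2) / 2 with hκ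
  have p1 : (n : ℝ) / 2 - 2 * ((n + ν) / 2) = -(n / 2 + ν) := by ring
  have p2 : 2 * (((n : ℝ) + ν) / 2) - n / 2 + 1 = n / 2 + ν + 1 := by ring
  have p3 : 1 - -κ = (n : ℝ) / 2 := by rw [hκ]; ring
  have p4 : 1 - (n : ℝ) / 2 = -κ := by rw [hκ]; ring
  rw [legendreFun, p1, p2, p3, p4]
  have key : 2 ^ (-κ) * (x ^ (2 * ((n + ν) / 2)) * ((1 + x) / 2) ^ (-κ)) =
      r ^ (-κ) * t ^ (-((n : ℝ) / 2 + 1 + ν)) * ((1 + x) / (1 - x)) ^ (-κ / 2) := by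
    have k1 : r ^ (-κ) * ((1 + x) / (1 - x)) ^ (-κ / 2) = ((1 + x) / x) ^ (-κ) := by
      have k2 : r ^ 2 * ((1 + x) / (1 - x)) = ((1 + x) / x) ^ 2 := by
        have : r ^ 2 = (1 - x ^ 2) / x ^ 2 := by
          rw [hx]; field_simp; linarith
        rw [this]
        field_simp
        ring
      have k3 : ∀ u : ℝ, 0 ≤ u → u ^ (-κ) = (u ^ 2) ^ (-κ / 2) := fun u hu => by
        rw [← Real.rpow_natCast, ← Real.rpow_mul hu]; congr 1; push_cast; ring
      rw [k3 r hr.le, k3 _ (by positivity), ← Real.mul_rpow (by positivity) (by positivity), k2]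
    have k4 : t ^ (-((n : ℝ) / 2 + 1 + ν)) = x ^ ((n : ℝ) / 2 + 1 + ν) := by
      rw [hx, one_div, Real.inv_rpow ht0.le, Real.rpow_neg ht0.le]
    have k5 : x ^ (2 * ((n + ν) / 2)) = x ^ ((n : ℝ) / 2 + 1 + ν) * x ^ κ := by
      rw [← Real.rpow_add hx0]; congr 1; rw [hκ]; ring
    rw [mul_right_comm, k1, k4, k5, Real.div_rpow (by positivity) two_pos.le,
      Real.div_rpow (by positivity) hx0.le, Real.rpow_neg hx0.le]
    field_simp
  linear_combination Real.Gamma (n + ν) / Real.Gamma (n / 2) *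
    ordinaryHypergeometric (-(n / 2 + ν)) (n / 2 + ν + 1) ((n : ℝ) / 2) ((1 - x) / 2) * key

/-! ### Laplace transforms and the identity theorem from the real line. -/

lemma norm_cexp_mul_ofReal_le (z : ℂ) (x : ℝ) {c : ℝ} (hz : |z.re| ≤ c) :
    ‖Complex.exp (z * x)‖ ≤ Real.exp (c * |x|) := by
  rw [Complex.norm_exp, Complex.re_mul_ofReal]
  refine Real.exp_le_exp.2 ((le_abs_self _).trans ?_)
  rw [abs_mul]
  exact mul_le_mul_of_nonneg_right hz (abs_nonneg x)

/-- Two-sided Laplace transforms are holomorphic on strips of absolute convergence. -/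
lemma differentiableOn_integral_cexp_mul {α : Type*} [MeasurableSpace α] {μ : Measure α}
    {X : α → ℝ} {g : α → ℂ} {c : ℝ} (hX : Measurable X) (hg : AEStronglyMeasurable g μ)
    (h : Integrable (fun a => Real.exp (c * |X a|) * ‖g a‖) μ) :
    DifferentiableOn ℂ (fun z : ℂ => ∫ a, Complex.exp (z * X a) * g a ∂μ) {z | |z.re| < c} := by
  intro z₀ hz₀
  have hz₀' : |z₀.re| < c := hz₀
  -- The gap `c - c'` pays for the factor `X a` that differentiation produces.
  set c' := (|z₀.re| + c) / 2 with hc'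
  have h1 : |z₀.re| < c' := by linarith
  have h2 : c' < c := by linarith
  have hS : {z : ℂ | |z.re| < c'} ∈ nhds z₀ :=
    (isOpen_lt (by fun_prop) continuous_const).mem_nhds h1
  have hXm : Measurable fun a => (X a : ℂ) := Complex.measurable_ofReal.comp hX
  have hmeas : ∀ z : ℂ, AEStronglyMeasurable (fun a => Complex.exp (z * X a) * g a) μ := fun z =>
    (Complex.measurable_exp.comp (hXm.const_mul z)).aestronglyMeasurable.mul hg
  refine (hasDerivAt_integral_of_dominated_loc_of_deriv_le (μ := μ)
    (F' := fun z a => X a * (Complex.exp (z * X a) * g a))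
    (bound := fun a => 1 / (c - c') * (Real.exp (c * |X a|) * ‖g a‖)) hS
    (Filter.Eventually.of_forall hmeas) ?_ ?_ ?_ (h.const_mul _)
    ?_).2.differentiableAt.differentiableWithinAt
  · refine h.mono' (hmeas z₀) (Filter.Eventually.of_forall fun a => ?_)
    rw [norm_mul]
    exact mul_le_mul_of_nonneg_right (norm_cexp_mul_ofReal_le _ _ hz₀'.le) (norm_nonneg _)
  · exact hXm.aestronglyMeasurable.mul (hmeas z₀)
  · refine Filter.Eventually.of_forall fun a z hz => ?_
    have hz' : |z.re| < c' := hz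
    rw [norm_mul, norm_mul, Complex.norm_real, Real.norm_eq_abs, ← mul_assoc, ← mul_assoc]
    refine mul_le_mul_of_nonneg_right ?_ (norm_nonneg _)
    have e1 : |X a| ≤ 1 / (c - c') * Real.exp ((c - c') * |X a|) := by
      rw [one_div_mul_eq_div, le_div_iff₀ (by linarith)]
      linarith [Real.add_one_le_exp ((c - c') * |X a|)]
    calc |X a| * ‖Complex.exp (z * X a)‖
        ≤ 1 / (c - c') * Real.exp ((c - c') * |X a|) * Real.exp (c' * |X a|) :=
          mul_le_mul e1 (norm_cexp_mul_ofReal_le _ _ hz'.le) (norm_nonneg _)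
            ((abs_nonneg _).trans e1)
      _ = 1 / (c - c') * Real.exp (c * |X a|) := by
          rw [mul_assoc, ← Real.exp_add]
          ring_nf
  · refine Filter.Eventually.of_forall fun a z _ => ?_
    have := ((hasDerivAt_id z).mul_const (X a : ℂ)).cexp.mul_const (g a)
    refine this.congr_deriv ?_
    simp
    ring

/-- The power series of a two-sided Laplace transform. -/
lemma hasSum_integral_cexp_mul {α : Type*} [MeasurableSpace α] {μ : Measure α}
    {X : α → ℝ} {g : α → ℂ} {c : ℝ} (hX : Measurable X) (hg : AEStronglyMeasurable g μ)
    (h : Integrable (fun a => Real.exp (c * |X a|) * ‖g a‖) μ) {z : ℂ} (hz : ‖z‖ ≤ c) :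
    HasSum (fun k : ℕ => (∫ a, (X a : ℂ) ^ k * g a ∂μ) / (k.factorial : ℂ) * z ^ k)
      (∫ a, Complex.exp (z * X a) * g a ∂μ) := by
  have hXm : Measurable fun a => (X a : ℂ) := Complex.measurable_ofReal.comp hX
  have hexp : ∀ x : ℝ, HasSum (fun k : ℕ => x ^ k / (k.factorial : ℝ)) (Real.exp x) := fun x => by
    rw [Real.exp_eq_exp_ℝ]
    exact NormedSpace.expSeries_div_hasSum_exp x
  have hcexp : ∀ x : ℂ, HasSum (fun k : ℕ => x ^ k / (k.factorial : ℂ)) (Complex.exp x) :=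
    fun x => by
      rw [Complex.exp_eq_exp_ℂ]
      exact NormedSpace.expSeries_div_hasSum_exp x
  have hb : ∀ a, HasSum (fun k : ℕ => (‖z‖ * |X a|) ^ k / (k.factorial : ℝ) * ‖g a‖)
      (Real.exp (‖z‖ * |X a|) * ‖g a‖) := fun a => (hexp _).mul_right _
  have key := hasSum_integral_of_dominated_convergence (μ := μ)
    (F := fun (k : ℕ) a => (z * X a) ^ k / (k.factorial : ℂ) * g a)
    (f := fun a => Complex.exp (z * X a) * g a)
    (fun (k : ℕ) a => (‖z‖ * |X a|) ^ k / (k.factorial : ℝ) * ‖g a‖)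
    (fun k => (((hXm.const_mul z).pow_const k).div_const _).aestronglyMeasurable.mul hg)
    (fun k => Filter.Eventually.of_forall fun a => le_of_eq (by simp))
    (Filter.Eventually.of_forall fun a => (hb a).summable) ?_
    (Filter.Eventually.of_forall fun a => (hcexp _).mul_right _)
  · refine key.congr_fun fun k => ?_
    rw [div_mul_eq_mul_div, mul_div_right_comm, ← integral_div, ← integral_mul_const]
    refine integral_congr_ae (Filter.Eventually.of_forall fun a => ?_)
    simp only [mul_pow]
    ring
  · have e : (fun a => ∑' k : ℕ, (‖z‖ * |X a|) ^ k / (k.factorial : ℝ) * ‖g a‖) =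
        fun a => Real.exp (‖z‖ * |X a|) * ‖g a‖ := funext fun a => (hb a).tsum_eq
    rw [e]
    refine h.mono' ((Real.measurable_exp.comp
      (hX.abs.const_mul _)).aestronglyMeasurable.mul hg.norm)
      (Filter.Eventually.of_forall fun a => ?_)
    rw [Real.norm_of_nonneg (by positivity)]
    gcongr

/-- The identity theorem for functions that agree near a point of the real line. -/
lemma eqOn_of_eventually_ofReal {f g : ℂ → ℂ} {U : Set ℂ} (hU : IsOpen U) (hc : IsPreconnected U)
    (hf : DifferentiableOn ℂ f U) (hg : DifferentiableOn ℂ g U) {t : ℝ} (ht : (t : ℂ) ∈ U)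
    (h : ∀ᶠ x : ℝ in nhds t, f x = g x) : Set.EqOn f g U := by
  refine (hf.analyticOnNhd hU).eqOn_of_preconnected_of_frequently_eq (hg.analyticOnNhd hU) hc ht ?_
  have h1 : Filter.Tendsto (fun x : ℝ => (x : ℂ)) (nhdsWithin t {t}ᶜ)
      (nhdsWithin (t : ℂ) {(t : ℂ)}ᶜ) :=
    tendsto_nhdsWithin_iff.2 ⟨(Complex.continuous_ofReal.tendsto t).mono_left nhdsWithin_le_nhds,
      eventually_nhdsWithin_of_forall fun x hx => by simpa using hx⟩
  exact h1.frequently (h.filter_mono nhdsWithin_le_nhds).frequently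

/-! ### The inverse Mellin transform in the critical case `s = 1/2`. -/

lemma Complex.Gamma_add_natCast {c : ℂ} (hc : 0 < c.re) (k : ℕ) :
    Gamma (c + k) = Gamma c * (ascPochhammer ℂ k).eval c := by
  induction k with
  | zero => simp
  | succ k ih =>
    have h0 : c + k ≠ 0 := fun h => by
      have := congrArg re h
      simp at this
      have : (0 : ℝ) ≤ k := k.cast_nonneg
      linarith
    rw [ascPochhammer_succ_eval, Nat.cast_succ, ← add_assoc, Gamma_add_one _ h0, ih]
    ring

/-- Duplication for Pochhammer symbols: the `2k` factors are sorted by parity, with a `2` taken out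
of each. -/
lemma Complex.Gamma_add_two_mul_natCast {x : ℂ} (hx : 0 < x.re) (k : ℕ) :
    Gamma (x + 2 * k) = Gamma x * 4 ^ k * (ascPochhammer ℂ k).eval (x / 2) *
      (ascPochhammer ℂ k).eval ((x + 1) / 2) := by
  induction k with
  | zero => simp
  | succ k ih =>
    have hk : (0 : ℝ) ≤ k := k.cast_nonneg
    have h0 : x + 2 * k ≠ 0 := fun h => by
      have := congrArg re h
      simp at this
      linarith
    have h1 : x + 2 * k + 1 ≠ 0 := fun h => by
      have := congrArg re h
      simp at this
      linarith
    have e : x + 2 * ((k + 1 : ℕ) : ℂ) = x + 2 * k + 1 + 1 := by push_cast; ring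
    rw [ascPochhammer_succ_eval, ascPochhammer_succ_eval, e, Gamma_add_one _ h1,
      Gamma_add_one _ h0, ih]
    ring

/-- The terms of `₁Ψ₁((x, 2); (c, 1))` are those of a Gauss hypergeometric series. -/
lemma Gamma_div_Gamma_mul_eq_ordinaryHypergeometricCoefficient {x c : ℂ} (hx : 0 < x.re)
    (hc : 0 < c.re) (w : ℂ) (k : ℕ) :
    Complex.Gamma (x + 2 * k) / Complex.Gamma (c + k) * ((w / 4) ^ k / (k.factorial : ℂ)) =
      Complex.Gamma x / Complex.Gamma c *
        (ordinaryHypergeometricCoefficient (x / 2) ((x + 1) / 2) c k * w ^ k) := by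
  rw [Complex.Gamma_add_two_mul_natCast hx, Complex.Gamma_add_natCast hc,
    ordinaryHypergeometricCoefficient, div_pow]
  have h4 : (4 : ℂ) ^ k ≠ 0 := pow_ne_zero _ (by norm_num)
  field_simp

lemma natCast_ne_neg_of_re_pos {c : ℂ} (hc : 0 < c.re) (k : ℕ) : (k : ℂ) ≠ -c := fun h => by
  have := congrArg Complex.re h
  simp at this
  have : (0 : ℝ) ≤ k := k.cast_nonneg
  linarith

lemma hasSum_Gamma_div_Gamma_mul {x c : ℂ} (hx : 0 < x.re) (hc : 0 < c.re) {w : ℂ}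
    (hw : ‖w‖ < 1) :
    HasSum (fun k : ℕ => Complex.Gamma (x + 2 * k) / Complex.Gamma (c + k) *
      ((w / 4) ^ k / (k.factorial : ℂ)))
      (Complex.Gamma x / Complex.Gamma c * quadraticContinuation (x / 2) c w) := by
  have hF := isGaussContinuation_quadraticContinuation (x / 2) (natCast_ne_neg_of_re_pos hc)
  have hw' : w ∈ Metric.ball (0 : ℂ) 1 := by simpa using hw
  rw [hF.2 hw', show x / 2 + 1 / 2 = (x + 1) / 2 by ring]
  refine ((hasSum_ordinaryHypergeometric (x / 2) ((x + 1) / 2)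
    (natCast_ne_neg_of_re_pos hc) hw').mul_left _).congr_fun fun k => ?_
  exact Gamma_div_Gamma_mul_eq_ordinaryHypergeometricCoefficient hx hc w k

lemma gaussHypergeometric_eq_quadraticContinuation {x c w : ℂ} (hc : 0 < c.re)
    (hw : w ∈ cutPlane) :
    gaussHypergeometric (x / 2) ((x + 1) / 2) c w = quadraticContinuation (x / 2) c w := by
  have hF := isGaussContinuation_quadraticContinuation (x / 2) (natCast_ne_neg_of_re_pos hc)
  rw [show x / 2 + 1 / 2 = (x + 1) / 2 by ring] at hF
  exact gaussHypergeometric_eq hF hw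

lemma differentiableAt_quadraticContinuation (x : ℂ) {c w : ℂ} (hc : 0 < c.re)
    (hw : w ∈ cutPlane) : DifferentiableAt ℂ (quadraticContinuation x c) w :=
  ((isGaussContinuation_quadraticContinuation x (natCast_ne_neg_of_re_pos hc)).1 w hw).differentiableAt

/-- The argument of `exp (2t)` is below `1/2 < π/2` in modulus, so its real part is nonnegative. -/
lemma mem_cutPlane_neg_exp {t : ℂ} (ht : |t.im| < 1 / 4) : -Complex.exp (2 * t) ∈ cutPlane := by
  refine Or.inl ?_
  have h1 : 0 ≤ (Complex.exp (2 * t)).re := by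
    rw [Complex.exp_re]
    refine mul_nonneg (Real.exp_pos _).le (Real.cos_nonneg_of_mem_Icc ?_)
    have := abs_lt.1 ht
    have := Real.pi_gt_three
    constructor <;> simp <;> linarith
  simp
  linarith

/-- The right-hand side is a Laplace transform in `y` and makes sense for complex `t`, which opens
the way to analytic continuation in `r`. -/
lemma mellinInv_ofReal_exp (f : ℂ → ℂ) (σ t : ℝ) :
    mellinInv σ f (Real.exp t) = 1 / (2 * Real.pi) * (Complex.exp (-(t * σ)) *
      ∫ y : ℝ, Complex.exp (-(t * Complex.I) * y) * f (σ + y * Complex.I)) := by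
  rw [mellinInv, ← integral_const_mul, Complex.real_smul]
  push_cast
  congr 1
  refine integral_congr_ae (Filter.Eventually.of_forall fun y => ?_)
  simp only [smul_eq_mul]
  rw [← mul_assoc, ← Complex.exp_add, Complex.cpow_def_of_ne_zero (Complex.exp_ne_zero _),
    ← Complex.ofReal_exp, ← Complex.ofReal_log (Real.exp_pos t).le, Real.log_exp]
  congr 2
  ring

/-- The weight spends half of the decay rate `1/2`, and thereby gives holomorphy for `|Im t| < 1/4`.
-/
lemma integrable_exp_mul_norm_eigenMellin {n : ℕ} {s ν σ : ℝ} (hs0 : 0 < s) (hs1 : s ≤ 1)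
    (h0 : 0 < σ) (h1 : σ < 2 * s * ν + n) :
    Integrable fun y : ℝ =>
      Real.exp (1 / 4 * |y|) * ‖eigenMellin n s ν (σ + y * Complex.I)‖ := by
  obtain ⟨C, hC, hb⟩ := exists_norm_eigenMellin_le n ν hs0 hs1 σ σ
  have hcont := continuous_eigenMellin_vertical hs0 h0 h1
  have h := integrable_of_norm_le_exp_neg_abs (C := C) (Y := 2) (κ := 1 / 4)
    (φ := fun y : ℝ => ((Real.exp (1 / 4 * |y|) : ℝ) : ℂ) * eigenMellin n s ν (σ + y * Complex.I))
    (Continuous.mul (by fun_prop) hcont) (by norm_num) fun y hy => ?_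
  · refine h.norm.congr (Filter.Eventually.of_forall fun y => ?_)
    simp only [norm_mul, Complex.norm_real, Real.norm_eq_abs, Real.abs_exp]
  · have := hb (σ + y * Complex.I) (by simp) (by simpa using hy)
    rw [norm_mul, Complex.norm_real, Real.norm_of_nonneg (Real.exp_pos _).le]
    calc _ ≤ Real.exp (1 / 4 * |y|) * (C * Real.exp (-(1 / 2) * |y|)) := by
          gcongr
          simpa using this
      _ = C * (Real.exp (1 / 4 * |y|) * Real.exp (-(1 / 2) * |y|)) := by ring
      _ = C * Real.exp (-(1 / 4) * |y|) := by
          rw [← Real.exp_add]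
          ring_nf

/-- For `r < 1` the residue series on the left still converges at `s = 1/2`; its step `1/s = 2`
makes it a Gauss series by duplication. -/
lemma mellinInv_eigenMellin_half_of_lt_one {n : ℕ} {ν r σ : ℝ} (hn : 1 ≤ n) (hr : 0 < r)
    (hr1 : r < 1) (h0 : 0 < σ) (h1 : σ < 2 * (1 / 2 : ℝ) * ν + n) :
    mellinInv σ (eigenMellin n (1 / 2 : ℝ) ν) r =
      2 * (Complex.Gamma (n + ν) / Complex.Gamma (n / 2) *
        quadraticContinuation ((n + ν) / 2) (n / 2) (-(r : ℂ) ^ 2)) := by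
  have hn' : (1 : ℝ) ≤ n := by exact_mod_cast hn
  refine (hasSum_mellinInv_eigenMellin_left hn (by norm_num) (by norm_num) hr
    (Or.inr ⟨rfl, hr1⟩) h0 h1).unique ?_
  refine ((hasSum_Gamma_div_Gamma_mul (x := n + ν) (c := n / 2) (w := -(r : ℂ) ^ 2)
    (by simp; linarith) (by simp; linarith) ?_).mul_left 2).congr_fun fun k => ?_
  · rw [norm_neg, norm_pow, Complex.norm_real, Real.norm_of_nonneg hr.le]
    nlinarith
  · rw [foxWrightTerm]
    congr 3
    · congr 1
      push_cast
      norm_num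
      ring
    · rw [one_mul]
    · ring

/-- The inverse Mellin transform in the case `s = 1/2`. -/
lemma mellinInv_eigenMellin_half {n : ℕ} {ν r σ : ℝ} (hn : 1 ≤ n) (hr : 0 < r)
    (h0 : 0 < σ) (h1 : σ < 2 * (1 / 2 : ℝ) * ν + n) :
    mellinInv σ (eigenMellin n (1 / 2 : ℝ) ν) r =
      2 * (Complex.Gamma (n + ν) / Complex.Gamma (n / 2) *
        quadraticContinuation ((n + ν) / 2) (n / 2) (-(r : ℂ) ^ 2)) := by
  have hn' : (1 : ℝ) ≤ n := by exact_mod_cast hn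
  have hcont := continuous_eigenMellin_vertical (n := n) (ν := ν) (by norm_num) h0 h1
  have hL := differentiableOn_integral_cexp_mul (c := 1 / 4) measurable_id
    hcont.aestronglyMeasurable
    (integrable_exp_mul_norm_eigenMellin (n := n) (ν := ν) (by norm_num) (by norm_num) h0 h1)
  have hU : IsOpen {t : ℂ | |t.im| < 1 / 4} := isOpen_lt (by fun_prop) continuous_const
  have hconv : IsPreconnected {t : ℂ | |t.im| < 1 / 4} := by
    have : {t : ℂ | |t.im| < 1 / 4} = Complex.imCLM ⁻¹' (Metric.ball 0 (1 / 4)) := by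
      ext t
      simp
    rw [this]
    exact ((convex_ball _ _).is_linear_preimage Complex.imCLM.isLinear).isPreconnected
  -- Both sides are holomorphic for `|Im t| < 1/4` and agree for real `t < 0`, that is for `r < 1`;
  -- the base point `-1` is one such `t`.
  have key := eqOn_of_eventually_ofReal
    (f := fun t : ℂ => 1 / (2 * Real.pi) * (Complex.exp (-(t * σ)) *
      ∫ y : ℝ, Complex.exp (-(t * Complex.I) * y) *
        eigenMellin n (1 / 2 : ℝ) ν (σ + y * Complex.I)))
    (g := fun t : ℂ => 2 * (Complex.Gamma (n + ν) / Complex.Gamma (n / 2) *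
        quadraticContinuation ((n + ν) / 2) (n / 2) (-Complex.exp (2 * t))))
    hU hconv ?_ ?_ (t := -1) (by simp) ?_
  · have hk := key (x := ((Real.log r : ℝ) : ℂ)) (by simp)
    simp only at hk
    rw [← mellinInv_ofReal_exp, Real.exp_log hr] at hk
    rw [hk, two_mul (Real.log r : ℂ), Complex.exp_add, ← Complex.ofReal_exp, Real.exp_log hr, sq]
  · refine DifferentiableOn.const_mul (DifferentiableOn.mul ?_ ?_) _
    · exact Differentiable.differentiableOn (by fun_prop)
    · refine hL.comp (f := fun t : ℂ => -(t * Complex.I))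
        (Differentiable.differentiableOn (by fun_prop)) fun t ht => ?_
      simpa using ht
  · intro t ht
    have h := differentiableAt_quadraticContinuation ((n + ν : ℂ) / 2) (c := (n : ℂ) / 2)
      (by simp; linarith) (mem_cutPlane_neg_exp ht)
    have h2 : DifferentiableAt ℂ (fun t : ℂ => -Complex.exp (2 * t)) t := by fun_prop
    exact (((h.comp t h2).const_mul _).const_mul _).differentiableWithinAt
  · filter_upwards [Iio_mem_nhds (show (-1 : ℝ) < 0 by norm_num)] with t ht
    have := mellinInv_eigenMellin_half_of_lt_one (ν := ν) hn (Real.exp_pos t)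
      (by simpa using ht) h0 h1
    rw [← mellinInv_ofReal_exp, this, two_mul (t : ℂ), Complex.exp_add, ← Complex.ofReal_exp, sq]

/-! ### The Fourier transform of `e^{-|ξ|} |ξ|^ν` by moments. -/

/-- Integration in polar coordinates of a power of a linear form against a radial function. -/
lemma exists_integral_inner_pow_mul_fun_norm {E : Type*} [NormedAddCommGroup E]
    [InnerProductSpace ℝ E] [FiniteDimensional ℝ E] [Nontrivial E] [MeasurableSpace E]
    [BorelSpace E] (μ : Measure E) [μ.IsAddHaarMeasure] (e : E) (k : ℕ) :
    ∃ A : ℝ, ∀ G : ℝ → ℝ, ∫ ξ, inner ℝ e ξ ^ k * G ‖ξ‖ ∂μ =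
      A * ∫ ρ in Set.Ioi (0 : ℝ), ρ ^ (Module.finrank ℝ E - 1) * (ρ ^ k * G ρ) := by
  -- Only the independence of this spherical moment from `G` matters; its value is found later from
  -- the Gaussian.
  refine ⟨∫ ω, inner ℝ e ω.1 ^ k ∂μ.toSphere, fun G => ?_⟩
  calc
    ∫ ξ, inner ℝ e ξ ^ k * G ‖ξ‖ ∂μ
      = ∫ ξ : ({(0)}ᶜ : Set E), inner ℝ e ξ.1 ^ k * G ‖ξ.1‖ ∂(μ.comap (↑)) := by
      rw [integral_subtype_comap (measurableSet_singleton _).compl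
        fun ξ => inner ℝ e ξ ^ k * G ‖ξ‖, restrict_compl_singleton]
    _ = ∫ x : Metric.sphere (0 : E) 1 × Set.Ioi (0 : ℝ),
          inner ℝ e x.1.1 ^ k * ((x.2 : ℝ) ^ k * G x.2)
          ∂μ.toSphere.prod (.volumeIoiPow (Module.finrank ℝ E - 1)) := by
      rw [← μ.measurePreserving_homeomorphUnitSphereProd.integral_comp
        (Homeomorph.measurableEmbedding _)]
      refine integral_congr_ae (Filter.Eventually.of_forall fun ξ => ?_)
      have hξ : ‖ξ.1‖ ≠ 0 := norm_ne_zero_iff.2 ξ.2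
      simp only [homeomorphUnitSphereProd_apply_fst_coe, homeomorphUnitSphereProd_apply_snd_coe,
        inner_smul_right, mul_pow]
      rw [← mul_assoc, mul_right_comm _ _ (‖ξ.1‖ ^ k), ← mul_pow, inv_mul_cancel₀ hξ, one_pow,
        one_mul]
    _ = (∫ ω, inner ℝ e ω.1 ^ k ∂μ.toSphere) *
          ∫ ρ : Set.Ioi (0 : ℝ), (ρ : ℝ) ^ k * G ρ
            ∂.volumeIoiPow (Module.finrank ℝ E - 1) :=
      integral_prod_mul (fun ω : Metric.sphere (0 : E) 1 => inner ℝ e ω.1 ^ k)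
        fun ρ : Set.Ioi (0 : ℝ) => (ρ : ℝ) ^ k * G ρ
    _ = _ := by
      congr 1
      simp only [Measure.volumeIoiPow, ENNReal.ofReal]
      rw [integral_withDensity_eq_integral_smul,
        integral_subtype_comap measurableSet_Ioi
          fun a ↦ Real.toNNReal (a ^ (Module.finrank ℝ E - 1)) • (a ^ k * G a),
        setIntegral_congr_fun measurableSet_Ioi fun x hx ↦ ?_]
      · rw [NNReal.smul_def, Real.coe_toNNReal _ (pow_nonneg hx.out.le _), smul_eq_mul]
      · exact (measurable_subtype_coe.pow_const _).real_toNNReal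

lemma pow_mul_pow_mul_rpow {ρ : ℝ} (hρ : 0 < ρ) {n : ℕ} (hn : 1 ≤ n) (k : ℕ) (ν : ℝ) :
    ρ ^ (n - 1) * (ρ ^ k * ρ ^ ν) = ρ ^ (n + ν + k - 1) := by
  rw [← Real.rpow_natCast, ← Real.rpow_natCast, ← Real.rpow_add hρ, ← Real.rpow_add hρ]
  push_cast [hn]
  ring_nf

lemma integral_pow_mul_exp_neg_sq {n : ℕ} (hn : 1 ≤ n) (k : ℕ) :
    ∫ ρ in Set.Ioi (0 : ℝ), ρ ^ (n - 1) * (ρ ^ k * Real.exp (-ρ ^ 2)) =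
      1 / 2 * Real.Gamma ((n + k) / 2) := by
  have hn' : (1 : ℝ) ≤ n := by exact_mod_cast hn
  have hk : (0 : ℝ) ≤ k := k.cast_nonneg
  have h := integral_rpow_mul_exp_neg_rpow (p := 2) (q := n + k - 1) two_pos (by linarith)
  rw [sub_add_cancel] at h
  rw [← h]
  refine setIntegral_congr_fun measurableSet_Ioi fun ρ hρ => ?_
  have := pow_mul_pow_mul_rpow hρ hn k 0
  rw [Real.rpow_zero, mul_one, add_zero] at this
  simp only [← mul_assoc, this, Real.rpow_two]

lemma integral_pow_mul_exp_neg_mul_rpow {n : ℕ} (hn : 1 ≤ n) {ν : ℝ} (hν : 0 < n + ν) (k : ℕ) :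
    ∫ ρ in Set.Ioi (0 : ℝ), ρ ^ (n - 1) * (ρ ^ k * (Real.exp (-ρ) * ρ ^ ν)) =
      Real.Gamma (n + ν + k) := by
  have hk : (0 : ℝ) ≤ k := k.cast_nonneg
  rw [Real.Gamma_eq_integral (by linarith)]
  refine setIntegral_congr_fun measurableSet_Ioi fun ρ hρ => ?_
  simp only [← pow_mul_pow_mul_rpow hρ hn k ν]
  ring

/-- Exponentially decaying radial functions with an integrable singularity. -/
lemma integrable_exp_neg_mul_norm_mul_rpow {n : ℕ} (hn : 1 ≤ n) {ν κ : ℝ} (hν : 0 < n + ν)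
    (hκ : 0 < κ) :
    Integrable fun ξ : EuclideanSpace ℝ (Fin n) => Real.exp (-κ * ‖ξ‖) * ‖ξ‖ ^ ν := by
  have : Nonempty (Fin n) := ⟨⟨0, hn⟩⟩
  rw [integrable_fun_norm_addHaar volume (f := fun ρ => Real.exp (-κ * ρ) * ρ ^ ν),
    finrank_euclideanSpace_fin]
  have h := integrableOn_rpow_mul_exp_neg_mul_rpow (p := 1) (s := n + ν - 1) (by linarith)
    one_pos hκ
  refine h.congr_fun (fun ρ hρ => ?_) measurableSet_Ioi
  have := pow_mul_pow_mul_rpow hρ hn 0 ν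
  simp only [pow_zero, one_mul, Nat.cast_zero, add_zero] at this
  simp only [Real.rpow_one, smul_eq_mul, ← this]
  ring

/-- Since `c u ≤ c²/2 + u²/2` and `|⟨e, ξ⟩| ≤ ‖ξ‖`, half of the Gaussian exponent absorbs the linear
one. -/
lemma integrable_exp_mul_inner_mul_exp_neg_sq {n : ℕ} (e : EuclideanSpace ℝ (Fin n))
    (he : ‖e‖ = 1) (c : ℝ) :
    Integrable fun ξ : EuclideanSpace ℝ (Fin n) =>
      Real.exp (c * |inner ℝ e ξ|) * ‖((Real.exp (-‖ξ‖ ^ 2) : ℝ) : ℂ)‖ := by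
  have h := (GaussianFourier.integrable_cexp_neg_mul_sq_norm_add (b := 1 / 2) (by simp) 0
    (0 : EuclideanSpace ℝ (Fin n))).norm.const_mul (Real.exp (c ^ 2 / 2))
  refine h.mono' (by fun_prop) (Filter.Eventually.of_forall fun ξ => ?_)
  have h1 : |inner ℝ e ξ| ≤ ‖ξ‖ := by simpa [he] using abs_real_inner_le_norm e ξ
  rw [Real.norm_of_nonneg (by positivity), Complex.norm_real,
    Real.norm_of_nonneg (Real.exp_pos _).le, Complex.norm_exp, ← Real.exp_add, ← Real.exp_add]
  refine Real.exp_le_exp.2 ?_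
  have h2 : (-(1 / 2 : ℂ) * (‖ξ‖ : ℂ) ^ 2 + 0 * (inner ℝ 0 ξ : ℝ)).re = -(1 / 2) * ‖ξ‖ ^ 2 := by
    rw [zero_mul, add_zero]
    have := Complex.ofReal_re (-(1 / 2) * ‖ξ‖ ^ 2)
    push_cast at this
    exact this
  rw [h2]
  have h3 : |inner ℝ e ξ| ^ 2 ≤ ‖ξ‖ ^ 2 := by gcongr
  nlinarith [sq_nonneg (c - |inner ℝ e ξ|)]

/-- The coefficients of an even power series. -/
lemma hasSum_even_iff {f : ℕ → ℂ} (hf : ∀ k, f (2 * k + 1) = 0) (s : ℂ) :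
    HasSum (fun k => f (2 * k)) s ↔ HasSum f s :=
  (mul_right_injective₀ (two_ne_zero' ℕ)).hasSum_iff fun k hk => by
    obtain ⟨j, hj | hj⟩ := Nat.even_or_odd' k
    · exact (hk ⟨j, hj.symm⟩).elim
    · rw [hj, hf]

lemma hasSum_cexp_sq_div_four (z : ℂ) :
    HasSum (fun k : ℕ => (if Even k then 1 / (4 ^ (k / 2) * ((k / 2).factorial : ℂ)) else 0) * z ^ k)
      (Complex.exp (z ^ 2 / 4)) := by
  refine (hasSum_even_iff (fun k => by simp) _).1 ?_
  have := NormedSpace.expSeries_div_hasSum_exp (z ^ 2 / 4)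
  rw [← Complex.exp_eq_exp_ℂ] at this
  refine this.congr_fun fun k => ?_
  have : 2 * k / 2 = k := by omega
  simp only [even_two_mul, if_true, this, div_pow, ← pow_mul]
  field_simp

/-- The moments of a Gaussian measure along a unit vector. -/
lemma integral_inner_pow_mul_exp_neg_sq {n : ℕ} (e : EuclideanSpace ℝ (Fin n))
    (he : ‖e‖ = 1) (k : ℕ) :
    (∫ ξ, ((inner ℝ e ξ : ℝ) : ℂ) ^ k * ((Real.exp (-‖ξ‖ ^ 2) : ℝ) : ℂ)) / (k.factorial : ℂ) =
      (Real.pi : ℂ) ^ (n / 2 : ℂ) *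
        (if Even k then 1 / (4 ^ (k / 2) * ((k / 2).factorial : ℂ)) else 0) := by
  rw [← sub_eq_zero]
  -- The moments are the Taylor coefficients in `z` of the Gaussian Laplace transform, which is
  -- known in closed form.
  refine coeff_eq_zero_of_hasSum_zero one_pos (a := fun k : ℕ =>
    (∫ ξ, ((inner ℝ e ξ : ℝ) : ℂ) ^ k * ((Real.exp (-‖ξ‖ ^ 2) : ℝ) : ℂ)) / (k.factorial : ℂ) -
      (Real.pi : ℂ) ^ (n / 2 : ℂ) *
        (if Even k then 1 / (4 ^ (k / 2) * ((k / 2).factorial : ℂ)) else 0)) (fun z hz => ?_) k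
  have h1 := hasSum_integral_cexp_mul (X := fun ξ => inner ℝ e ξ) (by fun_prop) (by fun_prop)
    (integrable_exp_mul_inner_mul_exp_neg_sq e he ‖z‖) le_rfl
  have h2 := GaussianFourier.integral_cexp_neg_mul_sq_norm_add (b := 1) (by simp) z e
  have h3 : ∫ ξ, Complex.exp (z * (inner ℝ e ξ : ℝ)) * ((Real.exp (-‖ξ‖ ^ 2) : ℝ) : ℂ) =
      (Real.pi : ℂ) ^ (n / 2 : ℂ) * Complex.exp (z ^ 2 / 4) := by
    simp only [he, finrank_euclideanSpace_fin, div_one, Complex.ofReal_one, one_pow, mul_one] at h2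
    rw [← h2]
    refine integral_congr_ae (Filter.Eventually.of_forall fun ξ => ?_)
    simp only [Complex.ofReal_exp, ← Complex.exp_add]
    push_cast
    ring_nf
  rw [h3] at h1
  have h4 := h1.sub ((hasSum_cexp_sq_div_four z).mul_left ((Real.pi : ℂ) ^ (n / 2 : ℂ)))
  rw [sub_self] at h4
  refine h4.congr_fun fun k => ?_
  ring

/-- The moments of `e^{-|ξ|} |ξ|^ν` along a unit vector. -/
lemma integral_inner_pow_mul_exp_neg_mul_rpow {n : ℕ} (hn : 1 ≤ n) {ν : ℝ} (hν : 0 < n + ν)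
    (e : EuclideanSpace ℝ (Fin n)) (he : ‖e‖ = 1) (k : ℕ) :
    (∫ ξ, ((inner ℝ e ξ : ℝ) : ℂ) ^ k * ((Real.exp (-‖ξ‖) * ‖ξ‖ ^ ν : ℝ) : ℂ)) /
        (k.factorial : ℂ) =
      2 * (Real.pi : ℂ) ^ (n / 2 : ℂ) *
        (if Even k then Complex.Gamma (n + ν + k) / Complex.Gamma ((n + k) / 2) /
          (4 ^ (k / 2) * ((k / 2).factorial : ℂ)) else 0) := by
  have : Nonempty (Fin n) := ⟨⟨0, hn⟩⟩
  have hn' : (1 : ℝ) ≤ n := by exact_mod_cast hn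
  have hk : (0 : ℝ) ≤ k := k.cast_nonneg
  -- One constant `A` serves both radial weights: the Gaussian moment determines it, as `Γ((n +
  -- k)/2) ≠ 0`, and makes it vanish for odd `k`.
  obtain ⟨A, hA⟩ := exists_integral_inner_pow_mul_fun_norm volume e k
  have hcast : ∀ G : ℝ → ℝ, ∫ ξ, ((inner ℝ e ξ : ℝ) : ℂ) ^ k * ((G ‖ξ‖ : ℝ) : ℂ) =
      ((∫ ξ, inner ℝ e ξ ^ k * G ‖ξ‖ : ℝ) : ℂ) := fun G => by
    rw [← integral_complex_ofReal]
    refine integral_congr_ae (Filter.Eventually.of_forall fun ξ => ?_)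
    simp
  have h1 := integral_inner_pow_mul_exp_neg_sq e he k
  rw [hcast fun ρ => Real.exp (-ρ ^ 2), hA fun ρ => Real.exp (-ρ ^ 2), finrank_euclideanSpace_fin,
    integral_pow_mul_exp_neg_sq hn] at h1
  rw [hcast fun ρ => Real.exp (-ρ) * ρ ^ ν, hA fun ρ => Real.exp (-ρ) * ρ ^ ν, finrank_euclideanSpace_fin,
    integral_pow_mul_exp_neg_mul_rpow hn hν]
  push_cast [← Complex.Gamma_ofReal] at h1 ⊢
  have hG : Complex.Gamma ((n + k) / 2) ≠ 0 := Complex.Gamma_ne_zero_of_re_pos (by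
    simp
    linarith)
  have hf : (k.factorial : ℂ) ≠ 0 := by exact_mod_cast k.factorial_ne_zero
  rw [div_eq_iff hf] at h1 ⊢
  split_ifs at h1 ⊢ with hk2
  · have h2 : (A : ℂ) = 2 * ((Real.pi : ℂ) ^ (n / 2 : ℂ) *
        (1 / (4 ^ (k / 2) * ((k / 2).factorial : ℂ))) * k.factorial) /
          Complex.Gamma ((n + k) / 2) := by
      rw [eq_div_iff hG]
      linear_combination 2 * h1
    rw [h2]
    ring
  · have h2 : (A : ℂ) = 0 := by
      have h3 : (A : ℂ) * Complex.Gamma ((n + k) / 2) = 0 := by linear_combination 2 * h1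
      exact (mul_eq_zero.1 h3).resolve_right hG
    rw [h2]
    ring

lemma integrable_exp_mul_inner_mul_exp_neg_mul_rpow {n : ℕ} (hn : 1 ≤ n) {ν : ℝ}
    (hν : 0 < n + ν) (e : EuclideanSpace ℝ (Fin n)) (he : ‖e‖ = 1) {c : ℝ} (hc0 : 0 ≤ c)
    (hc : c < 1) :
    Integrable fun ξ : EuclideanSpace ℝ (Fin n) =>
      Real.exp (c * |inner ℝ e ξ|) * ‖((Real.exp (-‖ξ‖) * ‖ξ‖ ^ ν : ℝ) : ℂ)‖ := by
  refine (integrable_exp_neg_mul_norm_mul_rpow hn hν (sub_pos.2 hc)).mono'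
    (Measurable.aestronglyMeasurable (by fun_prop)) (Filter.Eventually.of_forall fun ξ => ?_)
  have h1 : |inner ℝ e ξ| ≤ ‖ξ‖ := by simpa [he] using abs_real_inner_le_norm e ξ
  rw [Real.norm_of_nonneg (by positivity), Complex.norm_real, Real.norm_of_nonneg (by positivity),
    ← mul_assoc, ← Real.exp_add]
  gcongr
  nlinarith

/-- The Laplace transform of `e^{-|ξ|} |ξ|^ν`. -/
lemma integral_cexp_mul_inner_mul_exp_neg_mul_rpow {n : ℕ} (hn : 1 ≤ n) {ν : ℝ}
    (hν : 0 < n + ν) (e : EuclideanSpace ℝ (Fin n)) (he : ‖e‖ = 1) {z : ℂ} (hz : |z.re| < 1) :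
    ∫ ξ, Complex.exp (z * (inner ℝ e ξ : ℝ)) * ((Real.exp (-‖ξ‖) * ‖ξ‖ ^ ν : ℝ) : ℂ) =
      2 * (Real.pi : ℂ) ^ (n / 2 : ℂ) * (Complex.Gamma (n + ν) / Complex.Gamma (n / 2) *
        quadraticContinuation ((n + ν) / 2) (n / 2) (z ^ 2)) := by
  have hn' : (1 : ℝ) ≤ n := by exact_mod_cast hn
  have hsmall : ∀ z : ℂ, ‖z‖ < 1 →
      ∫ ξ, Complex.exp (z * (inner ℝ e ξ : ℝ)) * ((Real.exp (-‖ξ‖) * ‖ξ‖ ^ ν : ℝ) : ℂ) =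
      2 * (Real.pi : ℂ) ^ (n / 2 : ℂ) * (Complex.Gamma (n + ν) / Complex.Gamma (n / 2) *
        quadraticContinuation ((n + ν) / 2) (n / 2) (z ^ 2)) := fun z hz => by
    have h1 := hasSum_integral_cexp_mul (X := fun ξ => inner ℝ e ξ) (by fun_prop)
      (g := fun ξ => ((Real.exp (-‖ξ‖) * ‖ξ‖ ^ ν : ℝ) : ℂ))
      (Measurable.aestronglyMeasurable (by fun_prop))
      (integrable_exp_mul_inner_mul_exp_neg_mul_rpow hn hν e he (norm_nonneg z) hz) le_rfl
    simp only [integral_inner_pow_mul_exp_neg_mul_rpow hn hν e he] at h1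
    refine ((hasSum_even_iff (fun k => by simp) _).2 h1).unique ?_
    refine ((hasSum_Gamma_div_Gamma_mul (x := n + ν) (c := n / 2) (w := z ^ 2)
      (by simp; linarith) (by simp; linarith) ?_).mul_left _).congr_fun fun k => ?_
    · rw [norm_pow]
      nlinarith [norm_nonneg z]
    · have h2 : 2 * k / 2 = k := by omega
      have h3 : ((n : ℂ) + (2 * k : ℕ)) / 2 = n / 2 + k := by push_cast; ring
      simp only [even_two_mul, if_true, h2, h3, div_pow, ← pow_mul]
      push_cast
      field_simp
  -- A rate between `|re z|` and `1`: the strip contains `z` and the weight is still integrable.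
  set c := (|z.re| + 1) / 2 with hc
  have hU : IsOpen {t : ℂ | |t.re| < c} := isOpen_lt (by fun_prop) continuous_const
  have hconv : IsPreconnected {t : ℂ | |t.re| < c} := by
    have : {t : ℂ | |t.re| < c} = Complex.reCLM ⁻¹' (Metric.ball 0 c) := by
      ext t
      simp
    rw [this]
    exact ((convex_ball _ _).is_linear_preimage Complex.reCLM.isLinear).isPreconnected
  have hc0 : 0 < c := by positivity
  have hL := differentiableOn_integral_cexp_mul (X := fun ξ => inner ℝ e ξ) (c := c) (by fun_prop)
    (g := fun ξ => ((Real.exp (-‖ξ‖) * ‖ξ‖ ^ ν : ℝ) : ℂ))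
    (Measurable.aestronglyMeasurable (by fun_prop))
    (integrable_exp_mul_inner_mul_exp_neg_mul_rpow hn hν e he hc0.le (by linarith))
  refine eqOn_of_eventually_ofReal hU hconv hL
    (g := fun z => 2 * (Real.pi : ℂ) ^ (n / 2 : ℂ) * (Complex.Gamma (n + ν) /
      Complex.Gamma (n / 2) * quadraticContinuation ((n + ν) / 2) (n / 2) (z ^ 2)))
    (fun t ht => ?_) (t := 0) (by simpa using hc0) ?_ (x := z) ?_
  · have ht' : |t.re| < c := ht
    -- `t ^ 2` could lie on `[1, ∞)` only for real `t` with `|t| ≥ 1`, outside the strip.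
    have hmem : t ^ 2 ∈ cutPlane := by
      by_cases hi : t.im = 0
      · refine Or.inl ?_
        have := abs_lt.1 (ht'.trans (show c < 1 by linarith))
        simp [sq, hi]
        nlinarith
      by_cases hr : t.re = 0
      · refine Or.inl ?_
        simp [sq, hr]
        nlinarith [sq_nonneg t.im]
      · refine Or.inr ?_
        simp [sq]
        intro h
        exact (mul_ne_zero hr hi) (by linarith)
    have h := differentiableAt_quadraticContinuation ((n + ν : ℂ) / 2) (c := (n : ℂ) / 2)
      (by simp; linarith) hmem
    have h2 : DifferentiableAt ℂ (fun t : ℂ => t ^ 2) t := by fun_prop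
    exact (((h.comp t h2).const_mul _).const_mul _).differentiableWithinAt
  · filter_upwards [Metric.ball_mem_nhds (0 : ℝ) one_pos] with x hx
    exact hsmall x (by simpa using hx)
  · change |z.re| < c
    linarith

/-- The inverse Fourier transform of `e^{-|ξ|} |ξ|^ν`. -/
lemma invFourier_exp_neg_mul_rpow {n : ℕ} (hn : 1 ≤ n) {ν : ℝ} (hν : 0 < n + ν)
    {x : EuclideanSpace ℝ (Fin n)} (hx : x ≠ 0) :
    invFourier n (fun ξ => ((Real.exp (-‖ξ‖) * ‖ξ‖ ^ ν : ℝ) : ℂ)) x =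
      (((2 : ℝ) ^ (-(((n : ℝ) - 2) / 2)) * Real.Gamma (n + ν) / Real.Gamma ((n : ℝ) / 2) : ℝ) : ℂ) *
        quadraticContinuation ((n + ν) / 2) (n / 2) (-(‖x‖ : ℂ) ^ 2) := by
  have hx' : ‖x‖ ≠ 0 := norm_ne_zero_iff.2 hx
  -- The imaginary point `z = i‖x‖` turns the Laplace transform along `x/‖x‖` into the Fourier
  -- transform at `x`, with `z² = -‖x‖²`.
  have h := integral_cexp_mul_inner_mul_exp_neg_mul_rpow hn hν (‖x‖⁻¹ • x)
    (norm_smul_inv_norm (𝕜 := ℝ) hx) (z := ‖x‖ * Complex.I) (by simp)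
  rw [mul_pow, Complex.I_sq, mul_neg_one] at h
  have h2 : ∀ ξ, (‖x‖ * Complex.I) * ((inner ℝ (‖x‖⁻¹ • x) ξ : ℝ) : ℂ) =
      ((inner ℝ x ξ : ℝ) : ℂ) * Complex.I := fun ξ => by
    rw [inner_smul_left]
    have : (‖x‖ : ℂ) ≠ 0 := by exact_mod_cast hx'
    simp
    field_simp
  simp only [h2] at h
  rw [invFourier, h]
  have h3 : (2 * Real.pi) ^ (-((n : ℝ) / 2)) * (2 * Real.pi ^ ((n : ℝ) / 2)) =
      2 ^ (-(((n : ℝ) - 2) / 2)) := by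
    rw [Real.mul_rpow two_pos.le Real.pi_pos.le, show -(((n : ℝ) - 2) / 2) = -((n : ℝ) / 2) + 1 by ring,
      Real.rpow_add two_pos, Real.rpow_one, Real.rpow_neg Real.pi_pos.le]
    have : Real.pi ^ ((n : ℝ) / 2) ≠ 0 := (Real.rpow_pos_of_pos Real.pi_pos _).ne'
    field_simp
  rw [← h3]
  have h4 : (Real.pi : ℂ) ^ (n / 2 : ℂ) = ((Real.pi ^ ((n : ℝ) / 2) : ℝ) : ℂ) := by
    rw [Complex.ofReal_cpow Real.pi_pos.le]
    push_cast
    rfl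
  rw [h4]
  push_cast [← Complex.Gamma_ofReal]
  ring

/-! ### Assembly of the three cases. -/

theorem mainTheorem6 (n : ℕ) (hn : 1 ≤ n) (s ν : ℝ) (hs0 : 0 < s) (hs1 : s ≤ 1)
    (hν : -((n : ℝ) / (2 * s)) < ν) :
    -- the inverse Mellin integral converges absolutely on each line `Re z = σ` of the strip
    (∀ σ : ℝ, 0 < σ → σ < 2 * s * ν + n → Complex.VerticalIntegrable (eigenMellin n s ν) σ) ∧
    -- `s ∈ (1/2, 1]`
    (1 / 2 < s → ∀ σ : ℝ, 0 < σ → σ < 2 * s * ν + n → ∀ r : ℝ, 0 < r →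
      Summable (foxWrightTerm ((ν + n / (2 * s) : ℝ) : ℂ) ((1 / s : ℝ) : ℂ) (n / 2) 1
        (-((r : ℂ) ^ 2 / 4))) ∧
      mellinInv σ (eigenMellin n s ν) r =
        2 * foxWright ((ν + n / (2 * s) : ℝ) : ℂ) ((1 / s : ℝ) : ℂ) (n / 2) 1
          (-((r : ℂ) ^ 2 / 4))) ∧
    -- `s = 1/2`
    (s = 1 / 2 →
      -- as an inverse Mellin transform
      (∀ σ : ℝ, 0 < σ → σ < 2 * s * ν + n → ∀ r : ℝ, 0 < r →
        mellinInv σ (eigenMellin n s ν) r =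
            ((2 * Real.Gamma (n + ν) / Real.Gamma ((n : ℝ) / 2) : ℝ) : ℂ) *
              gaussHypergeometric ((n + ν) / 2) ((n + ν + 1) / 2) (n / 2) (-(r : ℂ) ^ 2)) ∧
      -- which is the inverse Fourier transform of `û_ν`
      Integrable (eigenFourier n s ν) ∧
      (∀ σ : ℝ, 0 < σ → σ < 2 * s * ν + n → ∀ x : EuclideanSpace ℝ (Fin n), x ≠ 0 →
        mellinInv σ (eigenMellin n s ν) ‖x‖ = invFourier n (eigenFourier n s ν) x) ∧
      -- with `û_ν` normalized to `e^{-|ξ|} |ξ|^ν`, in hypergeometric and in Legendre form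
      (∀ x : EuclideanSpace ℝ (Fin n), x ≠ 0 →
        invFourier n (fun ξ => ((Real.exp (-‖ξ‖) * ‖ξ‖ ^ ν : ℝ) : ℂ)) x =
            (((2 : ℝ) ^ (-(((n : ℝ) - 2) / 2)) * Real.Gamma (n + ν) /
                Real.Gamma ((n : ℝ) / 2) : ℝ) : ℂ) *
              gaussHypergeometric ((n + ν) / 2) ((n + ν + 1) / 2) (n / 2) (-(‖x‖ : ℂ) ^ 2) ∧
        invFourier n (fun ξ => ((Real.exp (-‖ξ‖) * ‖ξ‖ ^ ν : ℝ) : ℂ)) x =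
            ((Real.Gamma (n + ν) * ‖x‖ ^ (-(((n : ℝ) - 2) / 2)) *
                √(‖x‖ ^ 2 + 1) ^ (-((n : ℝ) / 2 + 1 + ν)) *
                legendreFun (-(((n : ℝ) - 2) / 2)) ((n : ℝ) / 2 + ν)
                  (1 / √(‖x‖ ^ 2 + 1)) : ℝ) : ℂ))) ∧
    -- `s ∈ (0, 1/2)`
    (s < 1 / 2 → ∀ σ : ℝ, 0 < σ → σ < 2 * s * ν + n → ∀ r : ℝ, 0 < r →
      Summable (foxWrightTerm ((s * ν + n / 2 : ℝ) : ℂ) (s : ℂ) ((-(s * ν) : ℝ) : ℂ)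
        ((-s : ℝ) : ℂ) ((-(2 / r) ^ (2 * s) : ℝ) : ℂ)) ∧
      mellinInv σ (eigenMellin n s ν) r =
        ((2 * s * (2 / r) ^ (2 * s * ν + n) : ℝ) : ℂ) *
          foxWright ((s * ν + n / 2 : ℝ) : ℂ) (s : ℂ) ((-(s * ν) : ℝ) : ℂ)
            ((-s : ℝ) : ℂ) ((-(2 / r) ^ (2 * s) : ℝ) : ℂ)) := by
  have hn' : (1 : ℝ) ≤ n := by exact_mod_cast hn
  have hpos : 0 < 2 * s * ν + n := by
    have := mul_lt_mul_of_pos_left hν (show 0 < 2 * s by positivity)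
    rw [mul_neg, mul_div_cancel₀ _ (by positivity)] at this
    linarith
  refine ⟨fun σ h0 h1 => verticalIntegrable_eigenMellin hs0 hs1 h0 h1, fun hs σ h0 h1 r hr => ?_,
    fun hs => ?_, fun hs σ h0 h1 r hr => ⟨?_, mellinInv_eigenMellin_right hs0 hs hr h0 h1⟩⟩
  · have h := hasSum_mellinInv_eigenMellin_left hn hs0 hs1 hr (Or.inl hs) h0 h1
    refine ⟨(summable_mul_left_iff two_ne_zero).1 h.summable, ?_⟩
    rw [foxWright, ← tsum_mul_left]
    exact h.tsum_eq.symm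
  · subst hs
    have hnν : 0 < (n : ℝ) + ν := by linarith
    have hc : 0 < (n / 2 : ℂ).re := by
      simp
      linarith
    have hcut : ∀ r : ℝ, -(r : ℂ) ^ 2 ∈ cutPlane := fun r => by
      refine Or.inl ?_
      rw [sub_neg_eq_add]
      have : (1 + (r : ℂ) ^ 2).re = 1 + r ^ 2 := by
        have := Complex.ofReal_re (1 + r ^ 2)
        push_cast at this
        exact this
      rw [this]
      positivity
    have hgauss : ∀ r : ℝ, gaussHypergeometric ((n + ν) / 2) ((n + ν + 1) / 2) (n / 2)
        (-(r : ℂ) ^ 2) = quadraticContinuation ((n + ν) / 2) (n / 2) (-(r : ℂ) ^ 2) := fun r =>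
      gaussHypergeometric_eq_quadraticContinuation hc (hcut r)
    have hmel : ∀ σ : ℝ, 0 < σ → σ < 2 * (1 / 2 : ℝ) * ν + n → ∀ r : ℝ, 0 < r →
        mellinInv σ (eigenMellin n (1 / 2 : ℝ) ν) r =
          ((2 * Real.Gamma (n + ν) / Real.Gamma ((n : ℝ) / 2) : ℝ) : ℂ) *
            gaussHypergeometric ((n + ν) / 2) ((n + ν + 1) / 2) (n / 2) (-(r : ℂ) ^ 2) :=
      fun σ h0 h1 r hr => by
        rw [mellinInv_eigenMellin_half hn hr h0 h1, hgauss]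
        push_cast [← Complex.Gamma_ofReal]
        ring
    have hfou : ∀ x : EuclideanSpace ℝ (Fin n), x ≠ 0 →
        invFourier n (fun ξ => ((Real.exp (-‖ξ‖) * ‖ξ‖ ^ ν : ℝ) : ℂ)) x =
          (((2 : ℝ) ^ (-(((n : ℝ) - 2) / 2)) * Real.Gamma (n + ν) /
            Real.Gamma ((n : ℝ) / 2) : ℝ) : ℂ) *
              gaussHypergeometric ((n + ν) / 2) ((n + ν + 1) / 2) (n / 2) (-(‖x‖ : ℂ) ^ 2) :=
      fun x hx => by rw [invFourier_exp_neg_mul_rpow hn hnν hx, hgauss]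
    -- At `s = 1/2` the constant `2^{n/2 + 1} s` is `2^{n/2}`.
    have heig : eigenFourier n (1 / 2 : ℝ) ν = fun ξ => (((2 : ℝ) ^ ((n : ℝ) / 2) : ℝ) : ℂ) *
        ((Real.exp (-‖ξ‖) * ‖ξ‖ ^ ν : ℝ) : ℂ) := by
      ext ξ
      rw [eigenFourier, ← Complex.ofReal_mul, Real.rpow_add two_pos, Real.rpow_one,
        show (2 : ℝ) * (1 / 2) = 1 by norm_num, Real.rpow_one, one_mul]
      congr 1
      ring
    refine ⟨hmel, ?_, fun σ h0 h1 x hx => ?_, fun x hx => ⟨hfou x hx, ?_⟩⟩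
    · rw [heig]
      refine ((integrable_exp_neg_mul_norm_mul_rpow hn hnν one_pos).ofReal.congr
        (Filter.Eventually.of_forall fun ξ => ?_)).const_mul _
      simp
    -- The Mellin and Fourier sides are not transformed into each other: each equals the same Gauss
    -- function, and `h3` matches the constants.
    · rw [hmel σ h0 h1 _ (norm_pos_iff.2 hx)]
      have h2 : invFourier n (eigenFourier n (1 / 2 : ℝ) ν) x =
          (((2 : ℝ) ^ ((n : ℝ) / 2) : ℝ) : ℂ) *
            invFourier n (fun ξ => ((Real.exp (-‖ξ‖) * ‖ξ‖ ^ ν : ℝ) : ℂ)) x := by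
        rw [invFourier, invFourier, heig]
        simp only [mul_left_comm _ (((2 : ℝ) ^ ((n : ℝ) / 2) : ℝ) : ℂ), integral_const_mul]
      have h3 : (2 : ℝ) ^ ((n : ℝ) / 2) * 2 ^ (-(((n : ℝ) - 2) / 2)) = 2 := by
        rw [← Real.rpow_add two_pos]
        ring_nf
        exact Real.rpow_one 2
      rw [h2, hfou x hx, ← mul_assoc, ← Complex.ofReal_mul]
      congr 2
      rw [mul_div_assoc, mul_div_assoc, ← mul_assoc, h3]
    · rw [hfou x hx]
      exact gaussHypergeometric_eq_legendreFun hn ν (norm_pos_iff.2 hx)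
  · have h := summable_foxWrightTerm_right hs0 hs hpos
      (show 0 ≤ (2 / r) ^ (2 * s) by positivity)
    exact h
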